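/- Let $0<\alpha\le 1$ and $\tau>0$. Let $\mathbb S^2\subset\mathbb R^3$ be the unit sphere with normalized surface measure $\mu$, let $\Delta_{\mathbb S^2}$ be its Laplace–Beltrami operator, and let $Y_{\ell,m}$ ($\ell\ge 0$, $-\ell\le m\le \ell$) be the complex spherical harmonics, given in spherical coordinates by $$Y_{\ell,m}=\sqrt{\tfrac{(2\ell+1)(\ell-m)!}{(\ell+m)!}}\,P_{\ell,m}(\cos\theta)e^{\mathrm i m\varphi}\ (m\ge 0),\qquad Y_{\ell,m}=(-1)^m\overline{Y_{\ell,-m}}\ (m<0),$$ where $P_{\ell,m}(t)=(-1)^m(1-t^2)^{m/2}\frac{d^m}{dt^m}\Big(\frac{1}{2^\ell \ell!}\frac{d^\ell}{dt^\ell}(t^2-1)^\ell\Big)$. Put $\lambda_\ell=\ell(\ell+1)$ and $E_\alpha(z)=\sum_{k\ge 0} z^k/\Gamma(\alpha k+1)$. On a probability space $(\Omega,\mathcal F,\mathbb P)$ let $W_\tau(t)$, $t\ge\tau$, be a real $L_2(\mathbb S^2)$-valued $Q$-Wiener process started at time $\tau$: $W_\tau(\tau)=0$, the trajectories are continuous (both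 almost surely), the increments are independent, and $W_\tau(t)-W_\tau(s)\sim\mathcal N(0,(t-s)Q)$ for $t\ge s\ge\tau$. Suppose that $QY_{\ell,m}=\mathcal A_\ell Y_{\ell,m}$ for all $\ell,m$, with numbers $\mathcal A_\ell\ge 0$ (the angular power spectrum of $W_\tau$) such that $$\sum_{\ell=0}^\infty(2\ell+1)\mathcal A_\ell<\infty .$$ Let $\widehat W_{\ell,m,\tau}(t)=\int_{\mathbb S^2}W_\tau(t)\overline{Y_{\ell,m}}\,d\mu$ and $\widehat W_{\ell,m,0}(s)=\widehat W_{\ell,m,\tau}(\tau+s)$, $s\ge 0$. Put $U^I(t)=0$ for $t\le\tau$ and $$U^I(t)=\sum_{\ell=0}^\infty\sum_{m=-\ell}^{\ell}\int_0^{t-\tau}E_\alpha\big(-\lambda_\ell(t-\tau-s)^\alpha\big)\,d\widehat W_{\ell,m,0}(s)\;Y_{\ell,m},\qquad t>\tau .$$ Then, for every $t>\tau$, the Wiener integrals exist and the series converges in $L_2(\Omega\times\mathbb S^2)$, and $U^I$ satisfies the equation $$dU^I(t)-D_t^{1-\alpha}\Delta_{\mathbb S^2}U^I(t)\,dt=dW_\tau(t)\quad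 (t\ge\tau),\qquad U^I(t)=0\quad (0<t\le\tau),$$ where $D_t^{1-\alpha}$ is the Riemann–Liouville derivative, in integral form and in the $L_2(\Omega\times\mathbb S^2)$ sense: for every $t\ge\tau$ the fractional integral $\frac1{\Gamma(\alpha)}\int_\tau^t (t-s)^{\alpha-1}\Delta_{\mathbb S^2}U^I(s)\,ds$, with $\Delta_{\mathbb S^2}U^I(s)$ understood as a distribution on $\mathbb S^2$, belongs to $L_2(\Omega\times\mathbb S^2)$, and for every $T>\tau$ $$\sup_{t\in[\tau,T]}\mathbb E\left\|U^I(t)-\frac1{\Gamma(\alpha)}\int_\tau^t\frac{\Delta_{\mathbb S^2}U^I(s)}{(t-s)^{1-\alpha}}\,ds-W_\tau(t)\right\|^2_{L_2(\mathbb S^2)}=0 .$$ Here the fractional integral is the element $F(t)$ of $L_2(\Omega\times\mathbb S^2)$ with $\langle F(t),\varphi\rangle=\frac1{\Gamma(\alpha)}\int_\tau^t(t-s)^{\alpha-1}\langle U^I(s),\Delta_{\mathbb S^2}\varphi\rangle\,ds$ for every smooth complex-valued $\varphi$ on $\mathbb S^2$, where $\langle f,\varphi\rangle=\int_{\mathbb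 S^2}f\overline{\varphi}\,d\mu$ and the right-hand side is a Bochner integral in $L_2(\Omega)$. -/

import Mathlib

open MeasureTheory ProbabilityTheory Polynomial

noncomputable section

/-! ### The sphere, its normalized surface measure, and the `L₂` spaces -/

/-- Euclidean space `ℝ³`. -/
abbrev E3 : Type := EuclideanSpace ℝ (Fin 3)

/-- The unit sphere `𝕊² ⊂ ℝ³`. -/
abbrev S2 : Type := Metric.sphere (0 : E3) 1

/-- The normalized surface measure on `𝕊²`: the surface measure divided by its total mass. -/
def sphereMeasure : Measure S2 :=
  ((volume : Measure E3).toSphere Set.univ)⁻¹ • (volume : Measure E3).toSphere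

instance instIsProbabilityMeasureSphere : IsProbabilityMeasure sphereMeasure := by
  constructor
  have h0 : (volume : Measure E3).toSphere Set.univ ≠ 0 := by
    rw [Ne, Measure.measure_univ_eq_zero]
    exact Measure.toSphere_ne_zero _
  simp only [sphereMeasure, Measure.smul_apply, smul_eq_mul]
  exact ENNReal.inv_mul_cancel h0 (measure_ne_top _ _)

/-- Complex `L₂(𝕊²)`, whose inner product is `⟪f, g⟫ = ∫ conj f * g`. -/
abbrev L2C : Type := Lp ℂ 2 sphereMeasure

/-- Real `L₂(𝕊²)`. -/
abbrev L2R : Type := Lp ℝ 2 sphereMeasure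

/-- A real element of `L₂(𝕊²)`, seen as a complex one. -/
def complexify (f : L2R) : L2C := Complex.ofRealCLM.compLp f

/-- The real part of an element of `L₂(𝕊²)`. -/
def rePart (f : L2C) : L2R := Complex.reCLM.compLp f

/-- The imaginary part of an element of `L₂(𝕊²)`. -/
def imPart (f : L2C) : L2R := Complex.imCLM.compLp f

theorem memLp_of_continuous_sphere {f : S2 → ℂ} (hf : Continuous f) :
    MemLp f 2 sphereMeasure := by
  obtain ⟨C, hC⟩ := isCompact_univ.exists_bound_of_continuousOn hf.continuousOn
  exact MemLp.of_bound hf.aestronglyMeasurable C (Filter.Eventually.of_forall fun x => hC x trivial)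

/-- The class in `L₂(𝕊²)` of a continuous function. -/
def contToL2 (f : S2 → ℂ) (hf : Continuous f) : L2C := (memLp_of_continuous_sphere hf).toLp f

/-! ### Spherical harmonics -/

/-- The Legendre polynomial `P_ℓ = (2^ℓ ℓ!)⁻¹ (d/dt)^ℓ (t² - 1)^ℓ`. -/
def legendreP (l : ℕ) : ℝ[X] :=
  C (((2 : ℝ) ^ l * (l.factorial : ℝ))⁻¹) * derivative^[l] ((X ^ 2 - 1) ^ l)

/-- The associated Legendre function `P_{ℓ,m}(t) = (-1)^m (1 - t²)^{m/2} (d/dt)^m P_ℓ(t)`,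
`-1 ≤ t ≤ 1`. -/
def assocLegendre (l m : ℕ) (t : ℝ) : ℝ :=
  (-1) ^ m * (Real.sqrt (1 - t ^ 2)) ^ m * (derivative^[m] (legendreP l)).eval t

/-- The spherical harmonic `Y_{ℓ,m}` with `m ≥ 0`, in Cartesian coordinates: since
`(sin θ)^m e^{imφ} = (x₁ + i x₂)^m`, this is
`√((2ℓ+1)(ℓ-m)!/(ℓ+m)!) P_{ℓ,m}(cos θ) e^{imφ}`; see `sphHarmNonneg_spherical`. -/
def sphHarmNonneg (l m : ℕ) (x : E3) : ℂ :=
  ((Real.sqrt ((2 * l + 1) * ((l - m).factorial : ℝ) / ((l + m).factorial : ℝ)) : ℝ) : ℂ) *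
    ((-1) ^ m * (((derivative^[m] (legendreP l)).eval (x 2) : ℝ) : ℂ) *
      ((x 0 : ℂ) + Complex.I * (x 1 : ℂ)) ^ m)

/-- The complex spherical harmonics `Y_{ℓ,m}`, `-ℓ ≤ m ≤ ℓ`, with
`Y_{ℓ,m} = (-1)^m conj Y_{ℓ,-m}` for `m < 0`. -/
def sphHarm (l : ℕ) (m : ℤ) (x : E3) : ℂ :=
  if 0 ≤ m then sphHarmNonneg l m.natAbs x
  else (-1) ^ m.natAbs * (starRingEnd ℂ) (sphHarmNonneg l m.natAbs x)

/-- The definition agrees with the usual one in spherical coordinates. -/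
theorem sphHarmNonneg_spherical (l m : ℕ) (θ φ : ℝ) (hθ : 0 ≤ θ) (hθ' : θ ≤ Real.pi) :
    sphHarmNonneg l m
        !₂[Real.sin θ * Real.cos φ, Real.sin θ * Real.sin φ, Real.cos θ] =
      ((Real.sqrt ((2 * l + 1) * ((l - m).factorial : ℝ) / ((l + m).factorial : ℝ)) : ℝ) : ℂ) *
        (assocLegendre l m (Real.cos θ) : ℂ) * Complex.exp (Complex.I * m * φ) := by
  have hs : Real.sqrt (1 - Real.cos θ ^ 2) = Real.sin θ := by
    rw [← Real.sin_sq]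
    exact Real.sqrt_sq (Real.sin_nonneg_of_nonneg_of_le_pi hθ hθ')
  have he : Complex.exp (Complex.I * m * φ) =
      (((Real.cos φ : ℝ) : ℂ) + Complex.I * ((Real.sin φ : ℝ) : ℂ)) ^ m := by
    have h1 : Complex.I * m * φ = (m : ℂ) * (φ * Complex.I) := by ring
    rw [h1, Complex.exp_nat_mul, Complex.exp_mul_I, Complex.ofReal_cos, Complex.ofReal_sin,
      mul_comm Complex.I]
  rw [he]
  simp only [sphHarmNonneg, assocLegendre, hs]
  simp only [Matrix.cons_val_zero, Matrix.cons_val_one, Matrix.cons_val]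
  have h3 : (((Real.sin θ * Real.cos φ : ℝ) : ℂ) + Complex.I * ((Real.sin θ * Real.sin φ : ℝ) : ℂ))
      = (Real.sin θ : ℂ) * (((Real.cos φ : ℝ) : ℂ) + Complex.I * ((Real.sin φ : ℝ) : ℂ)) := by
    push_cast
    ring
  rw [h3, mul_pow]
  push_cast
  ring

theorem continuous_sphHarm (l : ℕ) (m : ℤ) : Continuous fun x : S2 => sphHarm l m (x : E3) := by
  have h : ∀ k : ℕ, Continuous fun x : S2 => sphHarmNonneg l k (x : E3) := by
    intro k
    have hc : ∀ i : Fin 3, Continuous fun x : S2 => (x : E3) i := fun i => by fun_prop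
    have hp : Continuous fun x : S2 => (derivative^[k] (legendreP l)).eval ((x : E3) 2) :=
      (derivative^[k] (legendreP l)).continuous.comp (hc 2)
    have h0 := hc 0
    have h1 := hc 1
    unfold sphHarmNonneg
    fun_prop
  by_cases hm : 0 ≤ m
  · simpa only [sphHarm, hm, if_true] using h m.natAbs
  · simp only [sphHarm, hm, if_false]
    exact continuous_const.mul (Complex.continuous_conj.comp (h m.natAbs))

/-- `Y_{ℓ,m}` as an element of `L₂(𝕊²)`. -/
def sphHarmL2 (l : ℕ) (m : ℤ) : L2C :=
  contToL2 (fun x : S2 => sphHarm l m (x : E3)) (continuous_sphHarm l m)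

/-! ### The Laplace–Beltrami operator on smooth functions -/

/-- The Laplace–Beltrami operator of `𝕊²` at `x ∈ 𝕊²`: the Euclidean Laplacian of the extension
`y ↦ φ (y / ‖y‖)`, homogeneous of degree `0`. It depends only on the restriction of `φ` to `𝕊²`. -/
def laplaceBeltrami (φ : E3 → ℂ) (x : S2) : ℂ :=
  Laplacian.laplacian (fun y : E3 => φ (‖y‖⁻¹ • y)) (x : E3)

theorem continuous_laplaceBeltrami {φ : E3 → ℂ} (hφ : ContDiff ℝ (⊤ : ℕ∞) φ) :
    Continuous (laplaceBeltrami φ) := by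
  rw [continuous_iff_continuousAt]
  intro x
  have hx : (x : E3) ≠ 0 := by
    have := x.2
    intro h
    simp [h] at this
  have h1 : ContDiffAt ℝ 2 (fun y : E3 => φ (‖y‖⁻¹ • y)) (x : E3) := by
    have hn : ContDiffAt ℝ 2 (fun y : E3 => ‖y‖⁻¹ • y) (x : E3) :=
      ((contDiffAt_norm ℝ hx).inv (norm_ne_zero_iff.2 hx)).smul contDiffAt_id
    exact (hφ.of_le (WithTop.coe_le_coe.2 (le_top : (2 : ℕ∞) ≤ ⊤))).contDiffAt.comp _ hn
  have h2 : ContinuousAt (Laplacian.laplacian (fun y : E3 => φ (‖y‖⁻¹ • y))) (x : E3) := by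
    rw [InnerProductSpace.laplacian_eq_iteratedFDeriv_stdOrthonormalBasis]
    have h3 : ContinuousAt (iteratedFDeriv ℝ 2 (fun y : E3 => φ (‖y‖⁻¹ • y))) (x : E3) :=
      (h1.iteratedFDeriv_right (m := 0) (i := 2) (by norm_num)).continuousAt
    refine tendsto_finsetSum _ fun i _ => ?_
    exact ((ContinuousMultilinearMap.apply ℝ (fun _ : Fin 2 => E3) ℂ _).continuous.continuousAt).comp
      h3
  exact ContinuousAt.comp (f := fun y : S2 => (y : E3)) h2 continuous_subtype_val.continuousAt

/-- The restriction of a smooth function to `𝕊²`, as an element of `L₂(𝕊²)`. -/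
def testL2 (φ : E3 → ℂ) (hφ : ContDiff ℝ (⊤ : ℕ∞) φ) : L2C :=
  contToL2 (fun x : S2 => φ (x : E3)) (hφ.continuous.comp continuous_subtype_val)

/-- `Δ_{𝕊²} φ` as an element of `L₂(𝕊²)`, for a smooth function `φ`. -/
def laplaceTestL2 (φ : E3 → ℂ) (hφ : ContDiff ℝ (⊤ : ℕ∞) φ) : L2C :=
  contToL2 (laplaceBeltrami φ) (continuous_laplaceBeltrami hφ)

/-! ### The `Q`-Wiener process `W_τ` -/

/-- `W : [τ, ∞) → Ω → L₂(𝕊²)` is a (real) `Q`-Wiener process started at time `τ`, that is, an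
`L₂(𝕊²)`-valued time-delayed Brownian motion with covariance operator `Q`. Only the values `W t`
with `t ≥ τ` matter. The law of `W t - W s` is `N(0, (t - s) Q)`: every `⟨W t - W s, f⟩` is a
centred Gaussian variable of variance `(t - s) ⟨Q f, f⟩`. -/
structure IsQWiener {Ω : Type*} [MeasurableSpace Ω] (P : Measure Ω) (τ : ℝ)
    (Q : L2R →L[ℝ] L2R) (W : ℝ → Ω → L2R) : Prop where
  covariance_isPositive : Q.IsPositive
  aestronglyMeasurable : ∀ t, τ ≤ t → AEStronglyMeasurable (W t) P
  initial : ∀ᵐ ω ∂P, W τ ω = 0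
  continuous_paths : ∀ᵐ ω ∂P, ContinuousOn (fun t => W t ω) (Set.Ici τ)
  indep_increments :
    letI : MeasurableSpace L2R := borel L2R
    HasIndepIncrements (fun t : Set.Ici τ => W t) P
  gaussian_increments : ∀ s t, τ ≤ s → s ≤ t → ∀ f : L2R,
    P.map (fun ω => inner ℝ (W t ω - W s ω) f) =
      gaussianReal 0 (Real.toNNReal ((t - s) * inner ℝ (Q f) f))

/-- `A` is the angular power spectrum of a `Q`-Wiener process: `A ℓ ≥ 0` and
`Q Y_{ℓ,m} = A_ℓ Y_{ℓ,m}` (for the complex-linear extension of `Q`, so for the real and imaginary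
parts of `Y_{ℓ,m}`). -/
def IsAngularPowerSpectrum (Q : L2R →L[ℝ] L2R) (A : ℕ → ℝ) : Prop :=
  ∀ l : ℕ, 0 ≤ A l ∧ ∀ m ∈ Finset.Icc (-(l : ℤ)) l,
    Q (rePart (sphHarmL2 l m)) = A l • rePart (sphHarmL2 l m) ∧
    Q (imPart (sphHarmL2 l m)) = A l • imPart (sphHarmL2 l m)

/-- The Fourier coefficient `Ŵ_{ℓ,m,τ}(t) = ∫ W_τ(t) conj Y_{ℓ,m}`. -/
def fourierW {Ω : Type*} (W : ℝ → Ω → L2R) (l : ℕ) (m : ℤ) (t : ℝ) (ω : Ω) : ℂ :=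
  inner ℂ (sphHarmL2 l m) (complexify (W t ω))

/-- The Fourier coefficient `Ŵ_{ℓ,m,0}(s) = Ŵ_{ℓ,m,τ}(τ + s)` of the undelayed noise
`W_0(s) = W_τ(τ + s)`, `s ≥ 0`. -/
def fourierW0 {Ω : Type*} (τ : ℝ) (W : ℝ → Ω → L2R) (l : ℕ) (m : ℤ) (s : ℝ) (ω : Ω) : ℂ :=
  fourierW W l m (τ + s) ω

/-! ### Wiener integrals of deterministic functions -/

/-- The step function `∑_{i<n} c i 1_{(p i, p (i+1)]}`. -/
def stepFun (n : ℕ) (p c : ℕ → ℝ) (s : ℝ) : ℝ :=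
  ∑ i ∈ Finset.range n, (Set.Ioc (p i) (p (i + 1))).indicator (fun _ => c i) s

/-- The integral `∑_{i<n} c i (B (p (i+1)) - B (p i))` of a step function against a process. -/
def stepIntegral {Ω : Type*} (B : ℝ → Ω → ℂ) (n : ℕ) (p c : ℕ → ℝ) (ω : Ω) : ℂ :=
  ∑ i ∈ Finset.range n, (c i : ℂ) * (B (p (i + 1)) ω - B (p i) ω)

/-- `X` is the Wiener integral `∫_a^b g(s) dB(s)`: there are step functions on `[a, b]`
arbitrarily close to `g` in `L₂([a, b])` whose integrals are arbitrarily close to `X` in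
`L₂(Ω)`. -/
def IsWienerIntegral {Ω : Type*} [MeasurableSpace Ω] (P : Measure Ω) (B : ℝ → Ω → ℂ)
    (a b : ℝ) (g : ℝ → ℝ) (X : Lp ℂ 2 P) : Prop :=
  MemLp g 2 (volume.restrict (Set.Icc a b)) ∧
  ∀ ε : ENNReal, 0 < ε → ∃ (n : ℕ) (p c : ℕ → ℝ), Monotone p ∧ (∀ i, p i ∈ Set.Icc a b) ∧
    eLpNorm (fun s => stepFun n p c s - g s) 2 (volume.restrict (Set.Icc a b)) < ε ∧
    eLpNorm (fun ω => stepIntegral B n p c ω - X ω) 2 P < ε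

open Classical in
/-- The Wiener integral `∫_a^b g(s) dB(s)`, an element of `L₂(Ω)` (and `0` if it does not
exist). -/
def wienerIntegral {Ω : Type*} [MeasurableSpace Ω] (P : Measure Ω) (B : ℝ → Ω → ℂ)
    (a b : ℝ) (g : ℝ → ℝ) : Lp ℂ 2 P :=
  if h : ∃ X : Lp ℂ 2 P, IsWienerIntegral P B a b g X then h.choose else 0

/-! ### The field `U^I` -/

/-- The Mittag-Leffler function `E_α(z) = ∑ z^k / Γ(α k + 1)` at real arguments. -/
def mittagLeffler (α z : ℝ) : ℝ := ∑' k : ℕ, z ^ k / Real.Gamma (α * k + 1)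

/-- The eigenvalue `λ_ℓ = ℓ (ℓ + 1)`. -/
def lam (l : ℕ) : ℝ := (l : ℝ) * ((l : ℝ) + 1)

/-- The integrand `s ↦ E_α(-λ_ℓ (t - τ - s)^α)`. -/
def kernelU (α τ t : ℝ) (l : ℕ) (s : ℝ) : ℝ := mittagLeffler α (-lam l * (t - τ - s) ^ α)

/-- The space `L₂(Ω × 𝕊²)`, as the space of square integrable `L₂(𝕊²)`-valued random variables,
with norm `(E ‖·‖²_{L₂(𝕊²)})^{1/2}`. -/
abbrev L2Field {Ω : Type*} [MeasurableSpace Ω] (P : Measure Ω) : Type _ := Lp L2C 2 P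

/-- The random field `ω ↦ X(ω) f`, for a random variable `X ∈ L₂(Ω)` and `f ∈ L₂(𝕊²)`. -/
def randomMul {Ω : Type*} [MeasurableSpace Ω] (P : Measure Ω) (X : Lp ℂ 2 P) (f : L2C) :
    L2Field P :=
  (ContinuousLinearMap.toSpanSingleton ℂ f).compLp X

/-- The random coefficient `∫_0^{t-τ} E_α(-λ_ℓ (t - τ - s)^α) dŴ_{ℓ,m,0}(s)`. -/
def coeffU {Ω : Type*} [MeasurableSpace Ω] (P : Measure Ω) (α τ : ℝ) (W : ℝ → Ω → L2R)
    (t : ℝ) (l : ℕ) (m : ℤ) : Lp ℂ 2 P :=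
  wienerIntegral P (fourierW0 τ W l m) 0 (t - τ) (kernelU α τ t l)

/-- The part of degree `ℓ` of `U^I(t)`. -/
def degreeU {Ω : Type*} [MeasurableSpace Ω] (P : Measure Ω) (α τ : ℝ) (W : ℝ → Ω → L2R)
    (t : ℝ) (l : ℕ) : L2Field P :=
  ∑ m ∈ Finset.Icc (-(l : ℤ)) l, randomMul P (coeffU P α τ W t l m) (sphHarmL2 l m)

/-- The field `U^I(t) = ∑_ℓ ∑_m ∫_0^{t-τ} E_α(-λ_ℓ (t-τ-s)^α) dŴ_{ℓ,m,0}(s) Y_{ℓ,m}` for `t > τ`,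
and `U^I(t) = 0` for `t ≤ τ`. -/
def fieldU {Ω : Type*} [MeasurableSpace Ω] (P : Measure Ω) (α τ : ℝ) (W : ℝ → Ω → L2R)
    (t : ℝ) : L2Field P :=
  if τ < t then ∑' l : ℕ, degreeU P α τ W t l else 0

/-! ### The fractional integral of `Δ_{𝕊²} U` -/

/-- The random variable `ω ↦ ∫_{𝕊²} F(ω) conj f`. -/
def pairing {Ω : Type*} [MeasurableSpace Ω] (P : Measure Ω) (f : L2C) (F : L2Field P) :
    Lp ℂ 2 P :=
  (innerSL ℂ f).compLp F

/-- `F` is the fractional integral `Γ(α)⁻¹ ∫_τ^t (t - s)^(α-1) Δ_{𝕊²} U(s) ds`, where `Δ_{𝕊²} U(s)`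
is a distribution on `𝕊²`: for each smooth test function `φ` (the restriction to `𝕊²` of
a smooth function on `ℝ³`), `⟨F, φ⟩ = Γ(α)⁻¹ ∫_τ^t (t - s)^(α-1) ⟨U(s), Δ_{𝕊²} φ⟩ ds`, a convergent
Bochner integral in `L₂(Ω)`. There is at most one such `F`. -/
def IsFracIntegralLaplacian {Ω : Type*} [MeasurableSpace Ω] (P : Measure Ω) (α τ : ℝ)
    (U : ℝ → L2Field P) (t : ℝ) (F : L2Field P) : Prop :=
  ∀ (φ : E3 → ℂ) (hφ : ContDiff ℝ (⊤ : ℕ∞) φ),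
    IntervalIntegrable
      (fun s => ((t - s) ^ (α - 1) : ℝ) • pairing P (laplaceTestL2 φ hφ) (U s)) volume τ t ∧
    pairing P (testL2 φ hφ) F = ((Real.Gamma α)⁻¹ : ℝ) •
      ∫ s in τ..t, ((t - s) ^ (α - 1) : ℝ) • pairing P (laplaceTestL2 φ hφ) (U s)

end

/-! ### Green's identity on the sphere -/

section Green

open scoped Topology

/-! The equation is diagonal in spherical harmonics. Each `Ŵ_{ℓ,m,0}` has real covariance `A_ℓ
min(s,t)`, so its Wiener integral is a bounded linear map `HasBrownianCovariance.wiener` from real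
`L₂((0,∞))` to `L₂(Ω)`, of norm at most `√A_ℓ`. It sends `1_{(0,r]}` to the noise coefficient at
time `τ + r`, and `1_{(0,r]}(s) u(r - s)`, where `u(t) = E_α(-λ_ℓ t^α)`, to the coefficient of the
field. Integrating the Mittag-Leffler series termwise gives the scalar relaxation equation `λ Γ(α)⁻¹
∫_0^t (t-s)^(α-1) u(s) ds = 1 - u(t)` (`mlRelax_integral_eq`). By deterministic Fubini it becomes a
Volterra identity between elements of `L₂((0,∞))` (`integral_rpow_smul_convKernel`), and `wiener`
carries that identity to the coefficients. Because a bounded operator commutes with Bochner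
integrals, no stochastic Fubini theorem is needed.

Summing over `ℓ` requires `∫_0^T u² ≤ T` uniformly in `λ` (`integral_mlRelax_sq_le`). This is an
energy estimate: the kernel `x^(α-1)` is a positive superposition of exponentials, hence positive
definite (`fractional_kernel_energy_nonneg`), so multiplying the relaxation equation by `u` gives `∫
u(1-u) ≥ 0`. The degree `ℓ` part of the field then has squared norm at most `(2ℓ+1) A_ℓ (t-τ)`, and
orthogonality of the degrees gives convergence. Dominated convergence passes to the limit inside the
fractional integral, which is thereby identified as `U - W`, with `W` replaced by its harmonic
expansion; completeness of the harmonics shows that this expansion is `W` almost surely.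

The facts about the sphere all come from one Green identity, `integral_laplaceBeltrami_mul_sphMono`,
obtained by Euclidean integration by parts against a monomial times a radial cut-off. With test
function `1` it yields the moments of the surface measure, and through Legendre polynomials the
orthonormality (`inner_sphHarmL2`); with general test functions it yields the weak eigenvalue
equation (`inner_laplaceTestL2_sphHarmL2`). Completeness (`eq_zero_of_inner_sphHarmL2`) is
Stone–Weierstrass. -/

theorem laplacian_apply_eq_sum {f : E3 → ℂ} {y : E3} :
    Laplacian.laplacian f y = ∑ i, fderiv ℝ (fderiv ℝ f) y
      (EuclideanSpace.basisFun (Fin 3) ℝ i) (EuclideanSpace.basisFun (Fin 3) ℝ i) := by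
  rw [InnerProductSpace.laplacian_eq_iteratedFDeriv_orthonormalBasis f
    (EuclideanSpace.basisFun (Fin 3) ℝ)]
  simp [iteratedFDeriv_two_apply]

theorem fderiv_fderiv_apply {f : E3 → ℂ} {y : E3} (hf : ContDiffAt ℝ 2 f y) (e : E3) :
    fderiv ℝ (fderiv ℝ f) y e e = fderiv ℝ (fun z => fderiv ℝ f z e) y e := by
  have hd : DifferentiableAt ℝ (fderiv ℝ f) y :=
    (hf.fderiv_right (m := 1) (by norm_num)).differentiableAt (by norm_num)
  rw [fderiv_clm_apply hd (differentiableAt_const e)]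
  simp

theorem laplacian_comp_smul (f : E3 → ℂ) (c : ℝ) (y : E3) :
    Laplacian.laplacian (fun z => f (c • z)) y = (c : ℂ) ^ 2 * Laplacian.laplacian f (c • y) := by
  have h1 : fderiv ℝ (fun z => f (c • z)) = fun z => c • fderiv ℝ f (c • z) := by
    ext1 z
    exact fderiv_comp_smul (f := f) c
  have h2 : fderiv ℝ (fun z => c • fderiv ℝ f (c • z)) y
      = c • c • fderiv ℝ (fderiv ℝ f) (c • y) := by
    change fderiv ℝ (c • fun z => fderiv ℝ f (c • z)) y = _
    refine (congrFun (fderiv_const_smul_field (𝕜 := ℝ) (f := fun z => fderiv ℝ f (c • z)) c)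
      y).trans ?_
    exact congrArg (c • ·) (fderiv_comp_smul (f := fderiv ℝ f) c)
  rw [laplacian_apply_eq_sum, laplacian_apply_eq_sum, h1, h2, Finset.mul_sum]
  refine Finset.sum_congr rfl fun i _ => ?_
  simp
  ring

/-- Outside `K` the product vanishes locally, so `g` may be singular there. This matters because `g`
will be a radial extension, which is singular at the origin. -/
theorem integrable_mul_of_tsupport_subset {K : Set E3} {g h : E3 → ℂ} (hc : IsCompact K)
    (hh : Continuous h) (hs : tsupport h ⊆ K) (hg : ∀ y ∈ K, ContinuousAt g y) :
    Integrable (fun y => g y * h y) := by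
  have hcs : HasCompactSupport h := hc.of_isClosed_subset (isClosed_tsupport h) hs
  refine Continuous.integrable_of_hasCompactSupport ?_ hcs.mul_left
  rw [continuous_iff_continuousAt]
  intro y
  by_cases hy : y ∈ K
  · exact (hg y hy).mul hh.continuousAt
  · have : ∀ᶠ z in 𝓝 y, g z * h z = 0 := by
      filter_upwards [hc.isClosed.isOpen_compl.mem_nhds hy] with z hz
      rw [image_eq_zero_of_notMem_tsupport (fun h' => hz (hs h')), mul_zero]
    exact (continuousAt_const (y := (0 : ℂ))).congr (this.mono fun z hz => hz.symm)

/-- Two integrations by parts in each coordinate direction, without boundary terms since `ψ` has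
compact support. Regularity of `f` is needed only on that support. -/
theorem integral_laplacian_mul_eq {f ψ : E3 → ℂ} (hf : ∀ y ∈ tsupport ψ, ContDiffAt ℝ 2 f y)
    (hψ : ContDiff ℝ 2 ψ) (hc : HasCompactSupport ψ) :
    ∫ y, Laplacian.laplacian f y * ψ y = ∫ y, f y * Laplacian.laplacian ψ y := by
  replace hc : IsCompact (tsupport ψ) := hc
  have hfd : ∀ e : E3, ContDiff ℝ 1 (fun z => fderiv ℝ ψ z e) := fun e =>
    (hψ.fderiv_right (m := 1) (by norm_num)).clm_apply contDiff_const
  have hs1 : ∀ e : E3, tsupport (fun z => fderiv ℝ ψ z e) ⊆ tsupport ψ := fun e =>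
    (tsupport_fderiv_apply_subset ℝ e)
  have hs2 : ∀ e : E3, tsupport (fun y => fderiv ℝ (fun z => fderiv ℝ ψ z e) y e) ⊆ tsupport ψ :=
    fun e => (tsupport_fderiv_apply_subset ℝ e).trans (hs1 e)
  have hff : ∀ e : E3, ∀ y ∈ tsupport ψ, ContDiffAt ℝ 1 (fun z => fderiv ℝ f z e) y := fun e y hy =>
    ((hf y hy).fderiv_right (m := 1) (by norm_num)).clm_apply contDiffAt_const
  have hffc : ∀ e : E3, ∀ y ∈ tsupport ψ,
      ContinuousAt (fun y => fderiv ℝ (fun z => fderiv ℝ f z e) y e) y := fun e y hy =>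
    (((hff e y hy).fderiv_right (m := 0) (by norm_num)).clm_apply contDiffAt_const).continuousAt
  have hdd : ∀ e : E3, Continuous (fun y => fderiv ℝ (fun z => fderiv ℝ ψ z e) y e) := fun e =>
    (((hfd e).fderiv_right (m := 0) (by norm_num)).clm_apply contDiff_const).continuous
  have hfc : ∀ y ∈ tsupport ψ, ContinuousAt f y := fun y hy => (hf y hy).continuousAt
  have key : ∀ e : E3, ∫ y, fderiv ℝ (fun z => fderiv ℝ f z e) y e * ψ y
      = ∫ y, f y * fderiv ℝ (fun z => fderiv ℝ ψ z e) y e := by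
    intro e
    have h1 := integral_mul_fderiv_eq_neg_fderiv_mul_of_integrable (μ := (volume : Measure E3))
      (f := f) (g := fun z => fderiv ℝ ψ z e) (v := e)
      (integrable_mul_of_tsupport_subset hc (hfd e).continuous (hs1 e) fun y hy => (hff e y hy).continuousAt)
      (integrable_mul_of_tsupport_subset hc (hdd e) (hs2 e) hfc)
      (integrable_mul_of_tsupport_subset hc (hfd e).continuous (hs1 e) hfc)
      (fun y hy => (hf y (hs1 e hy)).differentiableAt (by norm_num))
      (fun y _ => (hfd e).differentiable (by norm_num) y)
    have h2 := integral_mul_fderiv_eq_neg_fderiv_mul_of_integrable (μ := (volume : Measure E3))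
      (f := fun z => fderiv ℝ f z e) (g := ψ) (v := e)
      (integrable_mul_of_tsupport_subset hc hψ.continuous subset_rfl (hffc e))
      (integrable_mul_of_tsupport_subset hc (hfd e).continuous (hs1 e) fun y hy => (hff e y hy).continuousAt)
      (integrable_mul_of_tsupport_subset hc hψ.continuous subset_rfl fun y hy => (hff e y hy).continuousAt)
      (fun y hy => (hff e y hy).differentiableAt (by norm_num))
      (fun y _ => hψ.differentiable (by norm_num) y)
    rw [h1, h2, neg_neg]
  have hL : ∀ y, Laplacian.laplacian f y * ψ y = ∑ i, fderiv ℝ (fun z => fderiv ℝ f z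
      (EuclideanSpace.basisFun (Fin 3) ℝ i)) y (EuclideanSpace.basisFun (Fin 3) ℝ i) * ψ y := by
    intro y
    by_cases hy : y ∈ tsupport ψ
    · rw [laplacian_apply_eq_sum, Finset.sum_mul]
      exact Finset.sum_congr rfl fun i _ => by rw [fderiv_fderiv_apply (hf y hy)]
    · simp [image_eq_zero_of_notMem_tsupport hy]
  have hR : ∀ y, f y * Laplacian.laplacian ψ y = ∑ i, f y * fderiv ℝ (fun z => fderiv ℝ ψ z
      (EuclideanSpace.basisFun (Fin 3) ℝ i)) y (EuclideanSpace.basisFun (Fin 3) ℝ i) := by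
    intro y
    rw [laplacian_apply_eq_sum, Finset.mul_sum]
    exact Finset.sum_congr rfl fun i _ => by rw [fderiv_fderiv_apply hψ.contDiffAt]
  simp_rw [hL, hR]
  rw [integral_finsetSum _ fun i _ => integrable_mul_of_tsupport_subset hc hψ.continuous subset_rfl (hffc _),
    integral_finsetSum _ fun i _ => integrable_mul_of_tsupport_subset hc (hdd _) (hs2 _) hfc]
  exact Finset.sum_congr rfl fun i _ => key _

/-- Integration in polar coordinates of a function which factors. -/
theorem integral_eq_toSphere_mul {h : E3 → ℂ} {a : S2 → ℂ} {b : ℝ → ℂ}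
    (hab : ∀ (x : S2) (r : ℝ), 0 < r → h (r • (x : E3)) = a x * b r) :
    ∫ y, h y = (∫ x, a x ∂(volume : Measure E3).toSphere) *
      ∫ r in Set.Ioi (0 : ℝ), (r : ℂ) ^ 2 * b r := by
  have hmp := (volume : Measure E3).measurePreserving_homeomorphUnitSphereProd
  calc ∫ y, h y = ∫ y : ({0}ᶜ : Set E3), h y ∂((volume : Measure E3).comap (↑)) := by
        rw [integral_subtype_comap (measurableSet_singleton _).compl fun y => h y,
          restrict_compl_singleton]
    _ = ∫ p : S2 × Set.Ioi (0 : ℝ), a p.1 * b p.2 ∂(volume : Measure E3).toSphere.prod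
          (.volumeIoiPow (Module.finrank ℝ E3 - 1)) := by
        rw [← hmp.integral_comp (Homeomorph.measurableEmbedding _)]
        refine integral_congr_ae (Filter.Eventually.of_forall fun y => ?_)
        have hy : (0 : ℝ) < ‖(y : E3)‖ := norm_pos_iff.2 y.2
        have := hab (homeomorphUnitSphereProd E3 y).1 ((homeomorphUnitSphereProd E3 y).2)
          (homeomorphUnitSphereProd E3 y).2.2
        change h y = a _ * b _
        rw [← this, homeomorphUnitSphereProd_apply_snd_coe,
          homeomorphUnitSphereProd_apply_fst_coe, smul_inv_smul₀ hy.ne']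
    _ = (∫ x, a x ∂(volume : Measure E3).toSphere) *
          ∫ r : Set.Ioi (0 : ℝ), b r ∂(.volumeIoiPow (Module.finrank ℝ E3 - 1)) :=
        integral_prod_mul a fun r : Set.Ioi (0 : ℝ) => b r
    _ = _ := by
        congr 1
        simp only [Measure.volumeIoiPow, ENNReal.ofReal]
        rw [integral_withDensity_eq_integral_smul,
          integral_subtype_comap measurableSet_Ioi
            fun r => Real.toNNReal (r ^ (Module.finrank ℝ E3 - 1)) • b r,
          setIntegral_congr_fun measurableSet_Ioi fun x hx => ?_]
        · have hx' : (0 : ℝ) < x := hx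
          simp only [NNReal.smul_def]
          rw [Real.coe_toNNReal _ (pow_nonneg hx'.le _)]
          simp
        · exact (measurable_subtype_coe.pow_const _).real_toNNReal

theorem contDiffAt_radialExt {φ : E3 → ℂ} (hφ : ContDiff ℝ (⊤ : ℕ∞) φ) {y : E3} (hy : y ≠ 0) :
    ContDiffAt ℝ 2 (fun y : E3 => φ (‖y‖⁻¹ • y)) y := by
  have hn : ContDiffAt ℝ 2 (fun y : E3 => ‖y‖⁻¹ • y) y :=
    ((contDiffAt_norm ℝ hy).inv (norm_ne_zero_iff.2 hy)).smul contDiffAt_id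
  exact (hφ.of_le (WithTop.coe_le_coe.2 (le_top : (2 : ℕ∞) ≤ ⊤))).contDiffAt.comp _ hn

/-- The radial extension is homogeneous of degree `0`, so its Laplacian is homogeneous of degree
`-2`. -/
theorem laplacian_radialExt_smul (φ : E3 → ℂ) {r : ℝ} (hr : 0 < r) (y : E3) :
    (r : ℂ) ^ 2 * Laplacian.laplacian (fun y : E3 => φ (‖y‖⁻¹ • y)) (r • y) =
      Laplacian.laplacian (fun y : E3 => φ (‖y‖⁻¹ • y)) y := by
  rw [← laplacian_comp_smul (fun y : E3 => φ (‖y‖⁻¹ • y))]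
  have : (fun z : E3 => φ (‖r • z‖⁻¹ • r • z)) = fun z => φ (‖z‖⁻¹ • z) := by
    funext z
    rw [norm_smul, Real.norm_of_nonneg hr.le, mul_inv, smul_smul]
    congr 2
    field_simp
  rw [this]

theorem norm_sphere_coe (x : S2) : ‖(x : E3)‖ = 1 := by
  have := x.2
  rwa [mem_sphere_zero_iff_norm] at this

/-- The Laplacian of a homogeneous function times a radial one. -/
theorem laplacian_mul_radial {g : E3 → ℂ} (hg : ContDiff ℝ 2 g) {d : ℕ}
    (hE : ∀ y, fderiv ℝ g y y = d * g y) {V : ℝ → ℝ} (hV : ContDiff ℝ 2 V) (y : E3) :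
    Laplacian.laplacian (fun y => g y * (V (‖y‖ ^ 2) : ℂ)) y =
      Laplacian.laplacian g y * (V (‖y‖ ^ 2) : ℂ) +
        g y * ((4 * d + 6) * ((deriv V (‖y‖ ^ 2) : ℝ) : ℂ) +
          4 * ‖y‖ ^ 2 * ((deriv (deriv V) (‖y‖ ^ 2) : ℝ) : ℂ)) := by
  have hV' : ContDiff ℝ 1 (deriv V) := by
    simpa using hV.iterate_deriv' 1 1
  have hsq : ∀ z : E3, HasFDerivAt (fun z : E3 => ‖z‖ ^ 2) (2 • innerSL ℝ z) z := fun z =>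
    (hasStrictFDerivAt_norm_sq z).hasFDerivAt
  have hcomp : ∀ {U : ℝ → ℝ}, Differentiable ℝ U → ∀ z : E3,
      HasFDerivAt (fun z : E3 => ((U (‖z‖ ^ 2) : ℝ) : ℂ))
        (Complex.ofRealCLM.comp (deriv U (‖z‖ ^ 2) • (2 • innerSL ℝ z))) z := fun hU z =>
    Complex.ofRealCLM.hasFDerivAt.comp z
      ((hU (‖z‖ ^ 2)).hasDerivAt.comp_hasFDerivAt z (hsq z))
  have hVd := hV.differentiable (by norm_num)
  have hVd' := hV'.differentiable (by norm_num)
  have hgd := hg.differentiable (by norm_num)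
  have hψ : ContDiff ℝ 2 (fun y => g y * (V (‖y‖ ^ 2) : ℂ)) :=
    hg.mul (Complex.ofRealCLM.contDiff.comp (hV.comp (contDiff_norm_sq ℝ)))
  have h1 : ∀ e : E3, (fun z => fderiv ℝ (fun y => g y * (V (‖y‖ ^ 2) : ℂ)) z e) =
      fun z => fderiv ℝ g z e * (V (‖z‖ ^ 2) : ℂ)
        + g z * ((2 * ((deriv V (‖z‖ ^ 2) : ℝ) : ℂ)) * (innerSL ℝ e z : ℝ)) := by
    intro e
    ext z
    have := (hgd z).hasFDerivAt.mul (hcomp hVd z)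
    have h0 : fderiv ℝ (fun y => g y * (V (‖y‖ ^ 2) : ℂ)) z = _ := this.fderiv
    rw [h0]
    simp [real_inner_comm]
    ring
  have h2 : ∀ e : E3, fderiv ℝ (fderiv ℝ (fun y => g y * (V (‖y‖ ^ 2) : ℂ))) y e e =
      fderiv ℝ (fderiv ℝ g) y e e * (V (‖y‖ ^ 2) : ℂ)
       + 4 * ((deriv V (‖y‖ ^ 2) : ℝ) : ℂ) * (fderiv ℝ g y e * (inner ℝ e y : ℝ))
       + 2 * g y * ((deriv V (‖y‖ ^ 2) : ℝ) : ℂ) * (inner ℝ e e : ℝ)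
       + 4 * g y * ((deriv (deriv V) (‖y‖ ^ 2) : ℝ) : ℂ) * ((inner ℝ e y : ℝ) ^ 2 : ℝ) := by
    intro e
    rw [fderiv_fderiv_apply hψ.contDiffAt, fderiv_fderiv_apply hg.contDiffAt, h1]
    have hgd' : DifferentiableAt ℝ (fun z => fderiv ℝ g z e) y :=
      (((hg.fderiv_right (m := 1) (by norm_num)).clm_apply contDiff_const).differentiable
        (by norm_num)) y
    have hin : HasFDerivAt (fun z : E3 => ((innerSL ℝ e z : ℝ) : ℂ))
        (Complex.ofRealCLM.comp (innerSL ℝ e)) y :=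
      (Complex.ofRealCLM.comp (innerSL ℝ e)).hasFDerivAt
    have := (hgd'.hasFDerivAt.mul (hcomp hVd y)).add ((hgd y).hasFDerivAt.mul
      (((hcomp hVd' y).const_mul 2).mul hin))
    refine (DFunLike.congr_fun (show fderiv ℝ _ y = _ from this.fderiv) e).trans ?_
    simp [real_inner_comm]
    ring
  rw [laplacian_apply_eq_sum, laplacian_apply_eq_sum]
  simp_rw [h2]
  rw [Finset.sum_add_distrib, Finset.sum_add_distrib, Finset.sum_add_distrib, ← Finset.sum_mul,
    ← Finset.mul_sum, ← Finset.mul_sum, ← Finset.mul_sum]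
  -- Euler's relation `hE` evaluates the cross terms and gives `4 * d`; the trace `3` of the
  -- identity gives the remaining `6`.
  have e1 : ∑ i, fderiv ℝ g y (EuclideanSpace.basisFun (Fin 3) ℝ i) *
      ((inner ℝ (EuclideanSpace.basisFun (Fin 3) ℝ i) y : ℝ) : ℂ) = d * g y := by
    rw [← hE y]
    conv_rhs => rw [← (EuclideanSpace.basisFun (Fin 3) ℝ).sum_repr' y]
    rw [map_sum]
    refine Finset.sum_congr rfl fun i _ => ?_
    rw [map_smul, Complex.real_smul, mul_comm, (EuclideanSpace.basisFun (Fin 3) ℝ).sum_repr' y]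
  have e2 : ∑ i : Fin 3, ((inner ℝ (EuclideanSpace.basisFun (Fin 3) ℝ i)
      (EuclideanSpace.basisFun (Fin 3) ℝ i) : ℝ) : ℂ) = 3 := by
    simp
  have e3 : ∑ i, (((inner ℝ (EuclideanSpace.basisFun (Fin 3) ℝ i) y : ℝ) ^ 2 : ℝ) : ℂ)
      = ‖y‖ ^ 2 := by
    rw [← Complex.ofReal_sum, OrthonormalBasis.sum_sq_inner_right]
    simp
  rw [e1, e2, e3]
  ring

/-- The monomials `z^k (x + iy)^m`. -/
noncomputable def sphMono (k m : ℕ) (y : E3) : ℂ :=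
  ((y 2 : ℝ) : ℂ) ^ k * ((y 0 : ℂ) + Complex.I * (y 1 : ℂ)) ^ m

/-- The linear form `z`. -/
noncomputable def coordZ : E3 →L[ℝ] ℂ := Complex.ofRealCLM.comp (EuclideanSpace.proj 2)

/-- The linear form `x + iy`. -/
noncomputable def coordW : E3 →L[ℝ] ℂ :=
  Complex.ofRealCLM.comp (EuclideanSpace.proj 0) +
    Complex.I • Complex.ofRealCLM.comp (EuclideanSpace.proj 1)

theorem sphMono_eq (k m : ℕ) : sphMono k m = fun y => coordZ y ^ k * coordW y ^ m := by
  funext y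
  simp [sphMono, coordZ, coordW]

theorem contDiff_sphMono (k m : ℕ) {n : WithTop ℕ∞} : ContDiff ℝ n (sphMono k m) := by
  rw [sphMono_eq]
  exact (coordZ.contDiff.pow k).mul (coordW.contDiff.pow m)

theorem hasFDerivAt_sphMono (k m : ℕ) (y : E3) :
    HasFDerivAt (sphMono k m)
      ((k * sphMono (k - 1) m y) • coordZ + (m * sphMono k (m - 1) y) • coordW) y := by
  have := (coordZ.hasFDerivAt (x := y).pow k).mul (coordW.hasFDerivAt (x := y).pow m)
  have h2 : sphMono k m = (fun y => coordZ y ^ k) * fun y => coordW y ^ m := sphMono_eq k m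
  rw [h2]
  refine this.congr_fderiv ?_
  ext e
  simp [sphMono_eq]
  ring

theorem fderiv_sphMono_self (k m : ℕ) (y : E3) :
    fderiv ℝ (sphMono k m) y y = ((k + m : ℕ) : ℂ) * sphMono k m y := by
  rw [(hasFDerivAt_sphMono k m y).fderiv]
  have h1 : (k : ℂ) * sphMono (k - 1) m y * coordZ y = k * sphMono k m y := by
    rcases k with _ | k
    · simp
    · simp only [sphMono_eq, Nat.add_sub_cancel]
      ring
  have h2 : (m : ℂ) * sphMono k (m - 1) y * coordW y = m * sphMono k m y := by
    rcases m with _ | m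
    · simp
    · simp only [sphMono_eq, Nat.add_sub_cancel]
      ring
  simp only [add_apply, smul_apply, smul_eq_mul, h1, h2]
  push_cast
  ring

theorem natCast_mul_pred (k : ℕ) : (k : ℂ) * ((k - 1 : ℕ) : ℂ) = k * (k - 1) := by
  rcases k with _ | k <;> simp

/-- The form `x + iy` is isotropic (`1 + i² = 0`) and orthogonal to `z`, so only the two derivatives
falling on `z^k` survive. The truncated `k - 2` is harmless because the coefficient vanishes for `k
< 2`. -/
theorem laplacian_sphMono (k m : ℕ) (y : E3) :
    Laplacian.laplacian (sphMono k m) y = k * (k - 1) * sphMono (k - 2) m y := by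
  rw [laplacian_apply_eq_sum]
  have h : ∀ e : E3, fderiv ℝ (fderiv ℝ (sphMono k m)) y e e =
      k * (k - 1) * sphMono (k - 2) m y * coordZ e ^ 2
      + 2 * k * m * sphMono (k - 1) (m - 1) y * (coordZ e * coordW e)
      + m * (m - 1) * sphMono k (m - 2) y * coordW e ^ 2 := by
    intro e
    rw [fderiv_fderiv_apply (contDiff_sphMono k m).contDiffAt]
    have h1 : (fun z => fderiv ℝ (sphMono k m) z e) = fun z =>
        (k * coordZ e) * sphMono (k - 1) m z + (m * coordW e) * sphMono k (m - 1) z := by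
      funext z
      rw [(hasFDerivAt_sphMono k m z).fderiv]
      simp only [add_apply, smul_apply, smul_eq_mul]
      ring
    rw [h1]
    have h2 := ((hasFDerivAt_sphMono (k - 1) m y).const_mul (k * coordZ e)).add
      ((hasFDerivAt_sphMono k (m - 1) y).const_mul (m * coordW e))
    refine (DFunLike.congr_fun (show fderiv ℝ _ y = _ from h2.fderiv) e).trans ?_
    simp only [add_apply, smul_apply, smul_eq_mul,
      Nat.sub_sub, Nat.reduceAdd]
    linear_combination (sphMono (k - 2) m y * coordZ e ^ 2) * natCast_mul_pred k +
      (sphMono k (m - 2) y * coordW e ^ 2) * natCast_mul_pred m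
  simp_rw [h]
  simp [Fin.sum_univ_three, coordZ, coordW]

theorem sphMono_smul (k m : ℕ) (r : ℝ) (y : E3) :
    sphMono k m (r • y) = (r : ℂ) ^ (k + m) * sphMono k m y := by
  simp only [sphMono_eq, map_smul, Complex.real_smul]
  ring

/-- A bump function around `1`, used as a radial cut-off. -/
noncomputable def radialBump : ContDiffBump (1 : ℝ) := ⟨1 / 4, 1 / 2, by norm_num, by norm_num⟩

theorem radialBump_sq_compactSupport : HasCompactSupport fun r : ℝ => radialBump (r ^ 2) := by
  refine HasCompactSupport.of_support_subset_isCompact (isCompact_Icc (a := (-2 : ℝ)) (b := 2)) ?_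
  intro r hr
  by_contra h
  apply hr
  refine radialBump.zero_of_le_dist ?_
  have : 4 ≤ r ^ 2 := by
    rw [Set.mem_Icc, not_and_or] at h
    rcases h with h | h <;> nlinarith
  rw [Real.dist_eq]
  refine le_trans ?_ (le_abs_self _)
  change (1 / 2 : ℝ) ≤ _
  linarith

/-- Polar coordinates leave this integral as a common factor on both sides of Green's identity;
positivity allows it to be cancelled. -/
theorem integral_radial_pos (d : ℕ) :
    0 < ∫ r in Set.Ioi (0 : ℝ), r ^ d * radialBump (r ^ 2) := by
  have hcont : Continuous fun r : ℝ => r ^ d * radialBump (r ^ 2) := by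
    have := radialBump.continuous
    fun_prop
  have hint : Integrable fun r : ℝ => r ^ d * radialBump (r ^ 2) :=
    hcont.integrable_of_hasCompactSupport radialBump_sq_compactSupport.mul_left
  rw [setIntegral_pos_iff_support_of_nonneg_ae _ hint.integrableOn]
  · refine lt_of_lt_of_le ?_ (measure_mono (s := Set.Ioo (1 : ℝ) (11 / 10)) fun r hr => ⟨?_, ?_⟩)
    · simp; norm_num
    · have h0 : (0 : ℝ) < r := by linarith [hr.1]
      have : 0 < radialBump (r ^ 2) := by
        refine radialBump.pos_of_mem_ball ?_
        rw [Metric.mem_ball, Real.dist_eq, abs_lt]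
        change -(1 / 2 : ℝ) < _ ∧ _ < (1 / 2 : ℝ)
        constructor <;> nlinarith [hr.1, hr.2]
      exact (by positivity : r ^ d * radialBump (r ^ 2) ≠ 0)
    · exact lt_trans zero_lt_one hr.1
  · filter_upwards [ae_restrict_mem measurableSet_Ioi] with r hr
    exact mul_nonneg (pow_nonneg (le_of_lt hr) _) radialBump.nonneg

/-- The difference of the two integrands is the derivative of `2 r^(d+3) V'(r²) + d r^(d+1) V(r²)`,
where `V` is the bump; this function vanishes at `0` and has compact support. The eigenvalue `d (d +
1)` originates here. -/
theorem integral_radial_eq (d : ℕ) :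
    ∫ r in Set.Ioi (0 : ℝ), r ^ 2 * (r ^ d * ((4 * d + 6) * deriv radialBump (r ^ 2) +
      4 * r ^ 2 * deriv (deriv radialBump) (r ^ 2))) =
    -(d * (d + 1)) * ∫ r in Set.Ioi (0 : ℝ), r ^ d * radialBump (r ^ 2) := by
  have hV : ContDiff ℝ 3 radialBump := radialBump.contDiff
  have hV1 : ContDiff ℝ 2 (deriv radialBump) := by simpa using hV.iterate_deriv' 2 1
  have hV2 : ContDiff ℝ 1 (deriv (deriv radialBump)) := by simpa using hV.iterate_deriv' 1 2
  have hcs0 := radialBump_sq_compactSupport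
  have hfar : ∀ r : ℝ, r ∉ Set.Icc (-2 : ℝ) 2 → radialBump =ᶠ[𝓝 (r ^ 2)] fun _ => 0 := by
    intro r h
    have : 4 < r ^ 2 := by
      rw [Set.mem_Icc, not_and_or] at h
      rcases h with h | h <;> nlinarith
    filter_upwards [lt_mem_nhds this] with s hs
    refine radialBump.zero_of_le_dist ?_
    rw [Real.dist_eq]
    refine le_trans ?_ (le_abs_self _)
    change (1 / 2 : ℝ) ≤ _
    linarith
  have hcs1 : HasCompactSupport fun r : ℝ => deriv radialBump (r ^ 2) := by
    refine HasCompactSupport.of_support_subset_isCompact (isCompact_Icc (a := (-2 : ℝ)) (b := 2)) ?_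
    intro r hr
    by_contra h
    exact hr (by simpa using (hfar r h).deriv_eq)
  have hcs2 : HasCompactSupport fun r : ℝ => deriv (deriv radialBump) (r ^ 2) := by
    refine HasCompactSupport.of_support_subset_isCompact (isCompact_Icc (a := (-2 : ℝ)) (b := 2)) ?_
    intro r hr
    by_contra h
    exact hr (by simpa using (hfar r h).deriv.deriv_eq)
  set G : ℝ → ℝ := fun r => 2 * r ^ (d + 3) * deriv radialBump (r ^ 2)
    + d * r ^ (d + 1) * radialBump (r ^ 2) with hG
  have hGd : ContDiff ℝ 1 G := by
    have a1 : ContDiff ℝ 1 (deriv radialBump) := hV1.of_le (by norm_num)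
    have a0 : ContDiff ℝ 1 radialBump := hV.of_le (by norm_num)
    fun_prop
  have hGc : HasCompactSupport G := hcs1.mul_left.add hcs0.mul_left
  have hGder : ∀ r, deriv G r = r ^ 2 * (r ^ d * ((4 * d + 6) * deriv radialBump (r ^ 2) +
      4 * r ^ 2 * deriv (deriv radialBump) (r ^ 2))) + d * (d + 1) *
        (r ^ d * radialBump (r ^ 2)) := by
    intro r
    have hsq : HasDerivAt (fun r : ℝ => r ^ 2) (2 * r) r := by simpa using hasDerivAt_pow 2 r
    have b0 : HasDerivAt (fun r : ℝ => radialBump (r ^ 2)) (deriv radialBump (r ^ 2) * (2 * r)) r :=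
      ((hV.differentiable (by norm_num)) _).hasDerivAt.comp r hsq
    have b1 : HasDerivAt (fun r : ℝ => deriv radialBump (r ^ 2))
        (deriv (deriv radialBump) (r ^ 2) * (2 * r)) r :=
      ((hV1.differentiable (by norm_num)) _).hasDerivAt.comp r hsq
    have c1 := (((hasDerivAt_pow (d + 3) r).const_mul 2).mul b1).add
      (((hasDerivAt_pow (d + 1) r).const_mul (d : ℝ)).mul b0)
    have c2 : deriv G r = _ := c1.deriv
    rw [c2]
    simp only [Nat.add_sub_cancel, show d + 3 - 1 = d + 2 by lia]
    push_cast
    ring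
  have hz := hGc.integral_Ioi_deriv_eq hGd 0
  have hG0 : G 0 = 0 := by simp [hG]
  rw [hG0, neg_zero] at hz
  simp_rw [hGder] at hz
  rw [integral_add, integral_const_mul] at hz
  · linarith
  · have k1 := hV1.continuous
    have k2 := hV2.continuous
    refine (Continuous.integrable_of_hasCompactSupport (by fun_prop) ?_).integrableOn
    exact ((hcs1.mul_left.add hcs2.mul_left).mul_left).mul_left
  · refine (Continuous.integrable_of_hasCompactSupport ?_ ?_).integrableOn
    · have := radialBump.continuous
      fun_prop
    · exact hcs0.mul_left.mul_left

theorem integral_sphereMeasure (f : S2 → ℂ) :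
    ∫ x, f x ∂sphereMeasure = ((volume : Measure E3).toSphere Set.univ)⁻¹.toReal •
      ∫ x, f x ∂(volume : Measure E3).toSphere := by
  rw [sphereMeasure, integral_smul_measure]

/-- Green's identity on the sphere against the monomials `z^k (x + iy)^m`. -/
theorem integral_laplaceBeltrami_mul_sphMono {φ : E3 → ℂ} (hφ : ContDiff ℝ (⊤ : ℕ∞) φ) (k m : ℕ) :
    ∫ x : S2, laplaceBeltrami φ x * sphMono k m x ∂sphereMeasure =
      ∫ x : S2, φ x * (k * (k - 1) * sphMono (k - 2) m x -
        (k + m) * (k + m + 1) * sphMono k m x) ∂sphereMeasure := by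
  set V : ℝ → ℝ := ⇑radialBump with hVdef
  set Φ : E3 → ℂ := fun y => φ (‖y‖⁻¹ • y) with hΦ
  set ψ : E3 → ℂ := fun y => sphMono k m y * (V (‖y‖ ^ 2) : ℂ) with hψdef
  have hV : ContDiff ℝ 4 V := radialBump.contDiff
  have hV1 : ContDiff ℝ 3 (deriv V) := by simpa using hV.iterate_deriv' 3 1
  have hV2 : ContDiff ℝ 2 (deriv (deriv V)) := by simpa using hV.iterate_deriv' 2 2
  have hψ : ContDiff ℝ 2 ψ := (contDiff_sphMono k m).mul
    (Complex.ofRealCLM.contDiff.comp ((hV.of_le (by norm_num)).comp (contDiff_norm_sq ℝ)))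
  set K : Set E3 := {y | ‖y‖ ^ 2 ∈ Metric.closedBall (1 : ℝ) (1 / 2)} with hK
  have hKclosed : IsClosed K :=
    Metric.isClosed_closedBall.preimage (by fun_prop : Continuous fun y : E3 => ‖y‖ ^ 2)
  have hKc : IsCompact K := by
    refine Metric.isCompact_of_isClosed_isBounded hKclosed
      ((Metric.isBounded_closedBall (x := (0 : E3)) (r := 2)).subset fun y hy => ?_)
    rw [hK, Set.mem_ofPred_eq, Metric.mem_closedBall, Real.dist_eq, abs_le] at hy
    rw [mem_closedBall_zero_iff]
    nlinarith [norm_nonneg y]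
  have hψK : tsupport ψ ⊆ K := by
    refine closure_minimal (fun y hy => ?_) hKclosed
    by_contra h
    apply hy
    rw [hK, Set.mem_ofPred_eq, Metric.mem_closedBall, not_le] at h
    have : V (‖y‖ ^ 2) = 0 := radialBump.zero_of_le_dist h.le
    simp [hψdef, this]
  have hK0 : ∀ y ∈ K, y ≠ 0 := by
    rintro y hy rfl
    rw [hK, Set.mem_ofPred_eq, Metric.mem_closedBall, Real.dist_eq, abs_le] at hy
    norm_num at hy
  have hψc : HasCompactSupport ψ := hKc.of_isClosed_subset (isClosed_tsupport ψ) hψK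
  have hΦd : ∀ y ∈ tsupport ψ, ContDiffAt ℝ 2 Φ y := fun y hy =>
    contDiffAt_radialExt hφ (hK0 y (hψK hy))
  -- The extension `Φ` of degree `0` is singular only at the origin, which the cut-off in `ψ`
  -- avoids.
  have main := integral_laplacian_mul_eq hΦd hψ hψc
  have hlap : ∀ y, Laplacian.laplacian ψ y = k * (k - 1) * sphMono (k - 2) m y * (V (‖y‖ ^ 2) : ℂ)
      + sphMono k m y * ((4 * (k + m : ℕ) + 6) * ((deriv V (‖y‖ ^ 2) : ℝ) : ℂ) +
          4 * ‖y‖ ^ 2 * ((deriv (deriv V) (‖y‖ ^ 2) : ℝ) : ℂ)) := by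
    intro y
    rw [hψdef, laplacian_mul_radial (contDiff_sphMono k m) (fderiv_sphMono_self k m)
      (hV.of_le (by norm_num)), laplacian_sphMono]
  have hnr : ∀ (x : S2) (r : ℝ), 0 < r → ‖r • (x : E3)‖ = r := by
    intro x r hr
    rw [norm_smul, norm_sphere_coe, mul_one, Real.norm_of_nonneg hr.le]
  have hΦr : ∀ (x : S2) (r : ℝ), 0 < r → Φ (r • (x : E3)) = φ x := by
    intro x r hr
    simp only [hΦ, hnr x r hr, smul_smul, inv_mul_cancel₀ hr.ne', one_smul]
  -- The factor `(r²)⁻¹` comes from the homogeneity of `Laplacian Φ` and cancels the Jacobian `r²`,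
  -- so the radial integrals on both sides become multiples of the same constant `C`.
  have hL := integral_eq_toSphere_mul (h := fun y => Laplacian.laplacian Φ y * ψ y)
    (a := fun x : S2 => laplaceBeltrami φ x * sphMono k m x)
    (b := fun r => ((r : ℂ) ^ 2)⁻¹ * (r ^ (k + m) * V (r ^ 2))) (by
      intro x r hr
      have hr' : (r : ℂ) ≠ 0 := Complex.ofReal_ne_zero.2 hr.ne'
      have h1 := laplacian_radialExt_smul φ hr (x : E3)
      simp only [hψdef, hnr x r hr, sphMono_smul, laplaceBeltrami]
      rw [← h1]
      linear_combination (-(Laplacian.laplacian (fun y : E3 => φ (‖y‖⁻¹ • y)) (r • (x : E3)) *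
        sphMono k m x * (r : ℂ) ^ (k + m) * V (r ^ 2))) * mul_inv_cancel₀ (pow_ne_zero 2 hr'))
  have hR1 := integral_eq_toSphere_mul
    (h := fun y => Φ y * (k * (k - 1) * sphMono (k - 2) m y * (V (‖y‖ ^ 2) : ℂ)))
    (a := fun x : S2 => φ x * (k * (k - 1) * sphMono (k - 2) m x))
    (b := fun r => ((r : ℂ) ^ 2)⁻¹ * (r ^ (k + m) * V (r ^ 2))) (by
      intro x r hr
      have hr' : (r : ℂ) ≠ 0 := Complex.ofReal_ne_zero.2 hr.ne'
      have h1 : (k : ℂ) * (k - 1) * (r : ℂ) ^ (k - 2 + m)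
          = k * (k - 1) * (((r : ℂ) ^ 2)⁻¹ * r ^ (k + m)) := by
        rcases k with _ | _ | k
        · simp
        · simp
        · simp only [show k + 1 + 1 - 2 = k by lia]
          field_simp
          ring
      simp only [hnr x r hr, hΦr x r hr, sphMono_smul]
      linear_combination (φ x * sphMono (k - 2) m x * V (r ^ 2)) * h1)
  have hR2 := integral_eq_toSphere_mul
    (h := fun y => Φ y * (sphMono k m y * ((4 * (k + m : ℕ) + 6) * ((deriv V (‖y‖ ^ 2) : ℝ) : ℂ) +
          4 * ‖y‖ ^ 2 * ((deriv (deriv V) (‖y‖ ^ 2) : ℝ) : ℂ))))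
    (a := fun x : S2 => φ x * sphMono k m x)
    (b := fun r => r ^ (k + m) * ((4 * (k + m : ℕ) + 6) * ((deriv V (r ^ 2) : ℝ) : ℂ) +
          4 * r ^ 2 * ((deriv (deriv V) (r ^ 2) : ℝ) : ℂ))) (by
      intro x r hr
      simp only [hnr x r hr, hΦr x r hr, sphMono_smul]
      ring)
  have hb1 : ∫ r in Set.Ioi (0 : ℝ), (r : ℂ) ^ 2 * (((r : ℂ) ^ 2)⁻¹ * (r ^ (k + m) * V (r ^ 2)))
      = ((∫ r in Set.Ioi (0 : ℝ), r ^ (k + m) * V (r ^ 2) : ℝ) : ℂ) := by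
    rw [← integral_complex_ofReal]
    refine setIntegral_congr_fun measurableSet_Ioi fun r hr => ?_
    have hr' : (r : ℂ) ≠ 0 := Complex.ofReal_ne_zero.2 (ne_of_gt hr)
    rw [mul_inv_cancel_left₀ (pow_ne_zero 2 hr')]
    push_cast
    rfl
  have hb2 : ∫ r in Set.Ioi (0 : ℝ), (r : ℂ) ^ 2 * (r ^ (k + m) * ((4 * (k + m : ℕ) + 6) *
      ((deriv V (r ^ 2) : ℝ) : ℂ) + 4 * r ^ 2 * ((deriv (deriv V) (r ^ 2) : ℝ) : ℂ)))
      = -((k + m) * (k + m + 1)) * ((∫ r in Set.Ioi (0 : ℝ), r ^ (k + m) * V (r ^ 2) : ℝ) : ℂ) := by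
    have h1 := congrArg (fun t : ℝ => (t : ℂ)) (integral_radial_eq (k + m))
    simp only [← integral_complex_ofReal] at h1
    push_cast at h1 ⊢
    exact h1
  have hpos := integral_radial_pos (k + m)
  set C : ℝ := ∫ r in Set.Ioi (0 : ℝ), r ^ (k + m) * V (r ^ 2) with hC
  have hfar : ∀ y : E3, y ∉ K → V =ᶠ[𝓝 (‖y‖ ^ 2)] fun _ => 0 := by
    intro y hy
    rw [hK, Set.mem_ofPred_eq] at hy
    filter_upwards [Metric.isClosed_closedBall.isOpen_compl.mem_nhds hy] with s hs
    rw [Set.mem_compl_iff, Metric.mem_closedBall, not_le] at hs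
    exact radialBump.zero_of_le_dist hs.le
  have hΦc : ∀ y ∈ K, ContinuousAt Φ y := fun y hy =>
    (contDiffAt_radialExt hφ (hK0 y hy)).continuousAt
  have c0 := hV.continuous
  have c1 := hV1.continuous
  have c2 := hV2.continuous
  have m1 : Continuous (sphMono (k - 2) m) := (contDiff_sphMono (k - 2) m (n := 0)).continuous
  have m2 : Continuous (sphMono k m) := (contDiff_sphMono k m (n := 0)).continuous
  have hint1 : Integrable fun y : E3 =>
      Φ y * (k * (k - 1) * sphMono (k - 2) m y * (V (‖y‖ ^ 2) : ℂ)) := by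
    refine integrable_mul_of_tsupport_subset hKc (by fun_prop)
      (closure_minimal (fun y hy => ?_) hKclosed) hΦc
    by_contra h
    exact hy (by simp [(hfar y h).eq_of_nhds])
  have hint2 : Integrable fun y : E3 => Φ y * (sphMono k m y * ((4 * (k + m : ℕ) + 6) *
      ((deriv V (‖y‖ ^ 2) : ℝ) : ℂ) +
          4 * ‖y‖ ^ 2 * ((deriv (deriv V) (‖y‖ ^ 2) : ℝ) : ℂ))) := by
    refine integrable_mul_of_tsupport_subset hKc (by fun_prop)
      (closure_minimal (fun y hy => ?_) hKclosed) hΦc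
    by_contra h
    exact hy (by simp [(hfar y h).deriv_eq, (hfar y h).deriv.deriv_eq])
  have hR : ∫ y, Φ y * Laplacian.laplacian ψ y =
      (∫ y, Φ y * (k * (k - 1) * sphMono (k - 2) m y * (V (‖y‖ ^ 2) : ℂ))) +
      ∫ y, Φ y * (sphMono k m y * ((4 * (k + m : ℕ) + 6) * ((deriv V (‖y‖ ^ 2) : ℝ) : ℂ) +
          4 * ‖y‖ ^ 2 * ((deriv (deriv V) (‖y‖ ^ 2) : ℝ) : ℂ))) := by
    rw [← integral_add hint1 hint2]
    refine integral_congr_ae (Filter.Eventually.of_forall fun y => ?_)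
    simp only [hlap, mul_add]
  rw [hL, hR, hR1, hR2, hb1, hb2] at main
  have hC' : (C : ℂ) ≠ 0 := Complex.ofReal_ne_zero.2 hpos.ne'
  have hcs : Continuous fun x : S2 => φ x := hφ.continuous.comp continuous_subtype_val
  have hint : ∀ {f : S2 → ℂ}, Continuous f → Integrable f (volume : Measure E3).toSphere :=
    fun hf => hf.integrable_of_hasCompactSupport (HasCompactSupport.of_compactSpace _)
  have m1' : Continuous fun x : S2 => sphMono (k - 2) m x := m1.comp continuous_subtype_val
  have m2' : Continuous fun x : S2 => sphMono k m x := m2.comp continuous_subtype_val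
  have e : ∫ x : S2, φ x * (k * (k - 1) * sphMono (k - 2) m x -
        (k + m) * (k + m + 1) * sphMono k m x) ∂(volume : Measure E3).toSphere =
      (∫ x : S2, φ x * (k * (k - 1) * sphMono (k - 2) m x) ∂(volume : Measure E3).toSphere) -
      (k + m) * (k + m + 1) * ∫ x : S2, φ x * sphMono k m x ∂(volume : Measure E3).toSphere := by
    rw [← integral_const_mul, ← integral_sub (hint (by fun_prop)) (hint (by fun_prop))]
    refine integral_congr_ae (Filter.Eventually.of_forall fun y => ?_)
    simp only
    ring
  rw [integral_sphereMeasure, integral_sphereMeasure, e]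
  congr 1
  apply mul_right_cancel₀ hC'
  rw [main]
  ring

end Green

/-! ### Legendre polynomials -/

section Legendre

/-- `(d/dt)^n (t² - 1)^l`. -/
noncomputable def rodrigues (l n : ℕ) : ℝ[X] := derivative^[n] ((X ^ 2 - 1) ^ l)

theorem derivative_rodrigues (l n : ℕ) : derivative (rodrigues l n) = rodrigues l (n + 1) := by
  rw [rodrigues, rodrigues, Function.iterate_succ_apply']

theorem rodrigues_ode_zero (l : ℕ) :
    (X ^ 2 - 1) * rodrigues l 1 = 2 * (l : ℝ[X]) * X * rodrigues l 0 := by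
  simp only [rodrigues, Function.iterate_one, Function.iterate_zero, id_eq]
  rcases l with _ | l
  · simp
  · rw [derivative_pow_succ]
    simp
    ring

theorem C_two_eq : (C 2 : ℝ[X]) = 2 := map_ofNat C 2

theorem C_three_eq : (C 3 : ℝ[X]) = 3 := map_ofNat C 3

/-- With `f = (t²-1)^l`, differentiate the first-order equation `(t²-1) f' = 2 l t f` repeatedly;
each differentiation raises `n` by one. -/
theorem rodrigues_ode (l n : ℕ) :
    (X ^ 2 - 1) * rodrigues l (n + 2) =
      2 * ((l : ℝ[X]) - ((n : ℝ[X]) + 1)) * X * rodrigues l (n + 1)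
        + ((n : ℝ[X]) + 1) * (2 * (l : ℝ[X]) - (n : ℝ[X])) * rodrigues l n := by
  induction n with
  | zero =>
    have h := congrArg derivative (rodrigues_ode_zero l)
    simp only [derivative_mul, derivative_rodrigues, derivative_sub, derivative_X_pow,
      derivative_one, derivative_natCast, derivative_X, derivative_ofNat] at h
    norm_num [C_two_eq] at h ⊢
    linear_combination h
  | succ n ih =>
    have h := congrArg derivative ih
    simp only [derivative_mul, derivative_add, derivative_rodrigues, derivative_sub,
      derivative_X_pow, derivative_one, derivative_natCast, derivative_X, derivative_ofNat] at h
    norm_num [C_two_eq] at h ⊢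
    linear_combination h

/-- The derivative `(d/dt)^m P_l`. -/
noncomputable def legendreD (l m : ℕ) : ℝ[X] := derivative^[m] (legendreP l)

theorem derivative_legendreD (l m : ℕ) : derivative (legendreD l m) = legendreD l (m + 1) := by
  rw [legendreD, legendreD, Function.iterate_succ_apply']

theorem legendreD_eq (l m : ℕ) :
    legendreD l m = C (((2 : ℝ) ^ l * (l.factorial : ℝ))⁻¹) * rodrigues l (l + m) := by
  rw [legendreD, legendreP, iterate_derivative_C_mul, rodrigues, add_comm l m,
    Function.iterate_add_apply]

/-- The associated Legendre equation with the factor `(1-t²)^(m/2)` removed: it is `rodrigues_ode`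
at order `l + m`. -/
theorem legendreD_ode (l m : ℕ) :
    (X ^ 2 - 1) * legendreD l (m + 2) + 2 * ((m : ℝ[X]) + 1) * X * legendreD l (m + 1) =
      ((l : ℝ[X]) + (m : ℝ[X]) + 1) * ((l : ℝ[X]) - (m : ℝ[X])) * legendreD l m := by
  have h := rodrigues_ode l (l + m)
  simp only [legendreD_eq, ← add_assoc]
  push_cast at h ⊢
  linear_combination (C (((2 : ℝ) ^ l * (l.factorial : ℝ))⁻¹)) * h

theorem natDegree_sq_sub_one_pow (l : ℕ) : ((X ^ 2 - 1 : ℝ[X]) ^ l).natDegree = 2 * l := by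
  rw [natDegree_pow, show (X ^ 2 - 1 : ℝ[X]) = X ^ 2 - C 1 by simp, natDegree_X_pow_sub_C, mul_comm]

theorem coeff_sq_sub_one_pow (l : ℕ) : ((X ^ 2 - 1 : ℝ[X]) ^ l).coeff (2 * l) = 1 := by
  have hm : ((X ^ 2 - 1 : ℝ[X]) ^ l).Monic := by
    rw [show (X ^ 2 - 1 : ℝ[X]) = X ^ 2 - C 1 by simp]
    exact (monic_X_pow_sub_C 1 two_ne_zero).pow l
  have := hm.coeff_natDegree
  rwa [natDegree_sq_sub_one_pow] at this

theorem rodrigues_two_mul (l : ℕ) : rodrigues l (2 * l) = C ((2 * l).factorial : ℝ) := by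
  have h : (rodrigues l (2 * l)).natDegree = 0 := by
    have := natDegree_iterate_derivative ((X ^ 2 - 1 : ℝ[X]) ^ l) (2 * l)
    rw [natDegree_sq_sub_one_pow, Nat.sub_self] at this
    exact Nat.le_zero.1 this
  rw [eq_C_of_natDegree_eq_zero h, rodrigues, coeff_iterate_derivative, zero_add,
    coeff_sq_sub_one_pow]
  simp [Nat.descFactorial_self]

theorem degree_legendreD (j m : ℕ) : (legendreD (m + j) m).degree = j := by
  have hc : ((2 : ℝ) ^ (m + j) * ((m + j).factorial : ℝ))⁻¹ ≠ 0 := by positivity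
  have h1 : (rodrigues (m + j) (m + j + m)).natDegree ≤ j := by
    have := natDegree_iterate_derivative ((X ^ 2 - 1 : ℝ[X]) ^ (m + j)) (m + j + m)
    rw [natDegree_sq_sub_one_pow] at this
    refine this.trans ?_
    lia
  have h2 : (rodrigues (m + j) (m + j + m)).coeff j ≠ 0 := by
    rw [rodrigues, coeff_iterate_derivative, show j + (m + j + m) = 2 * (m + j) by ring,
      coeff_sq_sub_one_pow]
    simp only [nsmul_eq_mul, mul_one, ne_eq, Nat.cast_eq_zero, Nat.descFactorial_eq_zero_iff_lt]
    lia
  rw [legendreD_eq, degree_C_mul hc]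
  exact degree_eq_of_le_of_coeff_ne_zero (natDegree_le_iff_degree_le.1 h1) h2

/-- For fixed `m` the degrees are exactly `0, 1, 2, …`. This is the algebraic half of the
completeness of the harmonics. -/
theorem span_range_legendreD (m : ℕ) :
    Submodule.span ℝ (Set.range fun j => legendreD (m + j) m) = ⊤ := by
  let S : Polynomial.Sequence ℝ := ⟨fun j => legendreD (m + j) m, fun j => degree_legendreD j m⟩
  exact S.span fun i => (leadingCoeff_ne_zero.2 (S.ne_zero i)).isUnit

/-- The points `±1` are zeros of order `l`, so fewer than `l` derivatives leave a zero there; this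
removes boundary terms below. -/
theorem eval_rodrigues_of_lt {l n : ℕ} (h : n < l) {t : ℝ} (ht : t ^ 2 = 1) :
    (rodrigues l n).eval t = 0 := by
  have h1 : (X ^ 2 - 1 : ℝ[X]) ^ (l - n) ∣ rodrigues l n :=
    pow_sub_dvd_iterate_derivative_of_pow_dvd n dvd_rfl
  have h2 : (X ^ 2 - 1 : ℝ[X]) ∣ rodrigues l n :=
    (dvd_pow_self _ (by lia)).trans h1
  obtain ⟨q, hq⟩ := h2
  rw [hq]
  simp [ht]

variable {L : ℝ[X] →ₗ[ℝ] ℝ}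

/-- `L` plays the role of the mean over `[-1, 1]`, used only through the fundamental theorem of
calculus `hL`. It will be the average over the sphere of a polynomial in `z`. -/
theorem mean_by_parts (hL : ∀ p, L (derivative p) = (p.eval 1 - p.eval (-1)) / 2) {p q : ℝ[X]}
    (h1 : (p * q).eval 1 = 0) (h2 : (p * q).eval (-1) = 0) :
    L (derivative p * q) = -L (p * derivative q) := by
  have := hL (p * q)
  rw [h1, h2, derivative_mul, map_add] at this
  linarith

/-- Sturm–Liouville form: one derivative is moved off `legendreD l' (m + 1)`, and the Legendre
equation evaluates the derivative of `(1-t²)^(m+1) P_l^(m+1)`. The weight vanishes at `±1`, so there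
are no boundary terms. -/
theorem mean_legendreD_succ (hL : ∀ p, L (derivative p) = (p.eval 1 - p.eval (-1)) / 2)
    (l l' m : ℕ) :
    L ((1 - X ^ 2) ^ (m + 1) * legendreD l (m + 1) * legendreD l' (m + 1)) =
      ((l : ℝ) + m + 1) * (l - m) * L ((1 - X ^ 2) ^ m * legendreD l m * legendreD l' m) := by
  have h := mean_by_parts hL (p := (1 - X ^ 2) ^ (m + 1) * legendreD l (m + 1))
    (q := legendreD l' m) (by simp) (by simp)
  rw [derivative_legendreD] at h
  have h2 : derivative ((1 - X ^ 2) ^ (m + 1) * legendreD l (m + 1)) =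
      -((1 - X ^ 2) ^ m * (((l : ℝ[X]) + (m : ℝ[X]) + 1) * ((l : ℝ[X]) - (m : ℝ[X])) * legendreD l m)) := by
    rw [← legendreD_ode, derivative_mul, derivative_legendreD, derivative_pow_succ]
    simp
    ring
  rw [h2] at h
  have h3 : -((1 - X ^ 2) ^ m * (((l : ℝ[X]) + (m : ℝ[X]) + 1) * ((l : ℝ[X]) - (m : ℝ[X])) * legendreD l m)) * legendreD l' m
      = (-(((l : ℝ) + m + 1) * (l - m))) • ((1 - X ^ 2) ^ m * legendreD l m * legendreD l' m) := by
    rw [smul_eq_C_mul]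
    simp
    ring
  rw [h3, map_smul, smul_eq_mul] at h
  linarith

/-- At `m = 0` the recursion can be applied with `l` and `l'` exchanged; the two outcomes differ by
the factor `l(l+1) - l'(l'+1) ≠ 0`. The same recursion then propagates the vanishing to all `m`. -/
theorem mean_legendreD_of_ne (hL : ∀ p, L (derivative p) = (p.eval 1 - p.eval (-1)) / 2)
    {l l' : ℕ} (hl : l ≠ l') (m : ℕ) :
    L ((1 - X ^ 2) ^ m * legendreD l m * legendreD l' m) = 0 := by
  induction m with
  | zero =>
    have h1 := mean_legendreD_succ hL l l' 0
    have h2 := mean_legendreD_succ hL l' l 0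
    rw [mul_right_comm, h1, mul_right_comm _ (legendreD l' 0)] at h2
    simp only [Nat.cast_zero, add_zero, sub_zero] at h2
    have h3 : (l : ℝ) * (l + 1) - l' * (l' + 1) ≠ 0 := by
      have : ((l : ℝ) - l') * (l + l' + 1) ≠ 0 :=
        mul_ne_zero (sub_ne_zero.2 (by exact_mod_cast hl)) (by positivity)
      intro h
      apply this
      linarith
    have h4 : ((l : ℝ) * (l + 1) - l' * (l' + 1)) *
      L ((1 - X ^ 2) ^ 0 * legendreD l 0 * legendreD l' 0) = 0 := by linarith
    exact (mul_eq_zero.1 h4).resolve_left h3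
  | succ m ih => rw [mean_legendreD_succ hL, ih, mul_zero]

/-- A Beta integral: `X (1-X²)^(l+1)` vanishes at `±1`, so the mean of its derivative is zero, which
links consecutive values of `l`. -/
theorem mean_one_sub_sq_pow (hL : ∀ p, L (derivative p) = (p.eval 1 - p.eval (-1)) / 2) (l : ℕ) :
    L ((1 - X ^ 2) ^ l) * (2 * l + 1).factorial = (2 ^ l * l.factorial) ^ 2 := by
  induction l with
  | zero =>
    have := hL X
    simp at this ⊢
    rw [this]
  | succ l ih =>
    have h := hL (X * (1 - X ^ 2) ^ (l + 1))
    have h2 : derivative (X * (1 - X ^ 2) ^ (l + 1) : ℝ[X]) =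
        ((2 * l + 3 : ℝ)) • (1 - X ^ 2) ^ (l + 1) - ((2 * l + 2 : ℝ)) • (1 - X ^ 2) ^ l := by
      rw [derivative_mul, derivative_pow_succ, smul_eq_C_mul, smul_eq_C_mul]
      simp [C_two_eq, C_three_eq]
      ring
    rw [h2, map_sub, map_smul, map_smul] at h
    simp at h
    have e : (2 * (l + 1) + 1).factorial = (2 * l + 3) * ((2 * l + 2) * (2 * l + 1).factorial) := by
      rw [show 2 * (l + 1) + 1 = (2 * l + 1 + 1) + 1 by ring, Nat.factorial_succ, Nat.factorial_succ]
    rw [e, Nat.factorial_succ l]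
    push_cast
    rw [show L ((1 - X ^ 2) ^ (l + 1)) * ((2 * (l : ℝ) + 3) * ((2 * l + 2) * (2 * l + 1).factorial))
      = ((2 * (l : ℝ) + 3) * L ((1 - X ^ 2) ^ (l + 1))) * ((2 * l + 2) * (2 * l + 1).factorial) by
        ring, show (2 * (l : ℝ) + 3) * L ((1 - X ^ 2) ^ (l + 1)) = (2 * l + 2) *
          L ((1 - X ^ 2) ^ l) by linarith]
    linear_combination (2 * (l : ℝ) + 2) ^ 2 * ih

/-- Successive integrations by parts; the factor carrying fewer than `l` derivatives kills the
boundary terms. At `j = l` the other factor is the constant `(2l)!`, which leaves a Beta integral.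
-/
theorem mean_rodrigues_mul (hL : ∀ p, L (derivative p) = (p.eval 1 - p.eval (-1)) / 2) (l : ℕ)
    {j : ℕ} (hj : j ≤ l) :
    L (rodrigues l l * rodrigues l l) = (-1) ^ j * L (rodrigues l (l - j) * rodrigues l (l + j)) := by
  induction j with
  | zero => simp
  | succ j ih =>
    have hz : ∀ {t : ℝ}, t ^ 2 = 1 → (rodrigues l (l - (j + 1)) * rodrigues l (l + j)).eval t = 0 := by
      intro t ht
      rw [eval_mul, eval_rodrigues_of_lt (by lia) ht, zero_mul]
    have h := mean_by_parts hL (p := rodrigues l (l - (j + 1))) (q := rodrigues l (l + j))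
      (hz (by norm_num)) (hz (by norm_num))
    rw [derivative_rodrigues, derivative_rodrigues, show l - (j + 1) + 1 = l - j by lia] at h
    rw [ih (by lia), h, add_assoc]
    ring

theorem mean_legendreD_zero (hL : ∀ p, L (derivative p) = (p.eval 1 - p.eval (-1)) / 2) (l : ℕ) :
    L (legendreD l 0 * legendreD l 0) = (2 * (l : ℝ) + 1)⁻¹ := by
  have h1 := mean_rodrigues_mul hL l le_rfl
  have e : rodrigues l 0 * rodrigues l (l + l) =
      ((-1 : ℝ) ^ l * (2 * l).factorial) • (1 - X ^ 2) ^ l := by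
    rw [← two_mul, rodrigues_two_mul, smul_eq_C_mul, rodrigues, Function.iterate_zero, id_eq,
      show (X ^ 2 - 1 : ℝ[X]) = (-1) * (1 - X ^ 2) by ring, mul_pow]
    simp
    ring
  rw [Nat.sub_self, e, map_smul, smul_eq_mul] at h1
  have h2 := mean_one_sub_sq_pow hL l
  have e2 : legendreD l 0 * legendreD l 0 =
      ((((2 : ℝ) ^ l * (l.factorial : ℝ))⁻¹) ^ 2) • (rodrigues l l * rodrigues l l) := by
    rw [legendreD_eq, add_zero, smul_eq_C_mul]
    simp
    ring
  rw [e2, map_smul, smul_eq_mul, h1]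
  have h3 : ((-1 : ℝ) ^ l) * (-1) ^ l = 1 := by rw [← mul_pow]; simp
  have h4 : (((2 * l).factorial : ℝ)) ≠ 0 := by positivity
  rw [Nat.factorial_succ] at h2
  push_cast at h2
  have h5 : ((2 * l).factorial : ℝ) * L ((1 - X ^ 2) ^ l) =
    (2 ^ l * (l.factorial : ℝ)) ^ 2 / (2 * l + 1) := by
    rw [eq_div_iff (by positivity)]
    linarith
  rw [show ((-1 : ℝ) ^ l * ((-1) ^ l * ((2 * l).factorial : ℝ) * L ((1 - X ^ 2) ^ l)))
    = ((-1 : ℝ) ^ l * (-1) ^ l) * (((2 * l).factorial : ℝ) * L ((1 - X ^ 2) ^ l)) by ring, h3, h5]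
  field_simp

/-- Iterating `mean_legendreD_succ` from `m = 0` accumulates the factors `(l+m+1)(l-m)`, which form
the factorial quotient in the normalisation of the harmonics. -/
theorem mean_legendreD_self (hL : ∀ p, L (derivative p) = (p.eval 1 - p.eval (-1)) / 2)
    {l m : ℕ} (hm : m ≤ l) :
    L ((1 - X ^ 2) ^ m * legendreD l m * legendreD l m) =
      ((l + m).factorial : ℝ) / ((2 * l + 1) * ((l - m).factorial : ℝ)) := by
  induction m with
  | zero =>
    have := mean_legendreD_zero hL l
    rw [pow_zero, one_mul, this]
    simp
    field_simp
  | succ m ih =>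
    have e : (l - m).factorial = (l - m) * (l - (m + 1)).factorial := by
      rw [← Nat.mul_factorial_pred (n := l - m) (by lia)]
      rfl
    have h1 : ((l - m : ℕ) : ℝ) = l - m := by
      push_cast [show m ≤ l by lia]
      rfl
    have h2 : (l : ℝ) - m ≠ 0 := by
      rw [← h1]
      exact_mod_cast (by lia : l - m ≠ 0)
    rw [mean_legendreD_succ hL, ih (by lia), e, ← add_assoc, Nat.factorial_succ]
    push_cast
    rw [h1]
    field_simp

end Legendre

/-! ### Spherical harmonics: moments, orthonormality, eigenfunctions -/

section Sphere

open scoped ComplexConjugate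

theorem integrable_sphere {f : S2 → ℂ} (hf : Continuous f) : Integrable f sphereMeasure :=
  hf.integrable_of_hasCompactSupport (HasCompactSupport.of_compactSpace _)

theorem continuous_sphMono (k m : ℕ) : Continuous fun x : S2 => sphMono k m x :=
  (contDiff_sphMono k m (n := 0)).continuous.comp continuous_subtype_val

theorem coordW_mul_conj (x : S2) : coordW x * conj (coordW x) = 1 - coordZ x ^ 2 := by
  have h := norm_sphere_coe x
  rw [EuclideanSpace.norm_eq, Real.sqrt_eq_one, Fin.sum_univ_three] at h
  simp only [Real.norm_eq_abs, sq_abs] at h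
  rw [Complex.mul_conj]
  simp only [coordW, coordZ, Complex.normSq_apply]
  simp
  norm_cast
  linarith

/-- Green's identity with the test function `1`, whose Laplacian is zero. -/
theorem moment_recurrence (k m : ℕ) :
    ((k : ℂ) + m) * (k + m + 1) * ∫ x : S2, sphMono k m x ∂sphereMeasure =
      k * (k - 1) * ∫ x : S2, sphMono (k - 2) m x ∂sphereMeasure := by
  have h := integral_laplaceBeltrami_mul_sphMono (φ := fun _ => 1) contDiff_const k m
  have h0 : ∀ x, laplaceBeltrami (fun _ => 1) x = 0 := by
    intro x
    simp [laplaceBeltrami]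
  simp only [h0, zero_mul, integral_zero, one_mul] at h
  rw [integral_sub (((integrable_sphere (continuous_sphMono _ _))).const_mul _)
    (((integrable_sphere (continuous_sphMono _ _))).const_mul _), integral_const_mul,
    integral_const_mul] at h
  exact (sub_eq_zero.1 h.symm).symm

/-- The recurrence lowers `k` by two and its right side vanishes for `k < 2`; the factor on the left
is nonzero because `m ≠ 0`. -/
theorem integral_sphMono_eq_zero {m : ℕ} (hm : m ≠ 0) (k : ℕ) :
    ∫ x : S2, sphMono k m x ∂sphereMeasure = 0 := by
  induction k using Nat.strong_induction_on with
  | _ k ih =>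
    have h := moment_recurrence k m
    have h2 : (k : ℂ) * (k - 1) * ∫ x : S2, sphMono (k - 2) m x ∂sphereMeasure = 0 := by
      rcases k with _ | _ | k
      · simp
      · simp
      · rw [ih (k + 1 + 1 - 2) (by lia), mul_zero]
    rw [h2] at h
    have h3 : ((k : ℂ) + m) * (k + m + 1) ≠ 0 := by
      norm_cast
      positivity
    exact (mul_eq_zero.1 h).resolve_left h3

/-- The mean over the sphere of a polynomial in `z`. -/
noncomputable def zMean : ℝ[X] →ₗ[ℝ] ℝ where
  toFun p := ∫ x : S2, p.eval ((x : E3) 2) ∂sphereMeasure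
  map_add' p q := by
    have hp : ∀ p : ℝ[X], Integrable (fun x : S2 => p.eval ((x : E3) 2)) sphereMeasure := fun p =>
      Continuous.integrable_of_hasCompactSupport
        (p.continuous.comp (by fun_prop : Continuous fun x : S2 => (x : E3) 2))
        (HasCompactSupport.of_compactSpace _)
    simp only [eval_add]
    exact integral_add (hp p) (hp q)
  map_smul' c p := by
    simp only [eval_smul, smul_eq_mul, RingHom.id_apply]
    exact integral_const_mul _ _

theorem zMean_apply (p : ℝ[X]) :
    zMean p = ∫ x : S2, p.eval ((x : E3) 2) ∂sphereMeasure := rfl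

/-- Archimedes' theorem at the level of moments: the recurrence with `m = 0` starts from total mass
`1` at `k = 0` and from `0` at `k = 1`, and yields the moments of the uniform law on `[-1, 1]`. -/
theorem zMean_X_pow (k : ℕ) : zMean (X ^ k) = (1 - (-1) ^ (k + 1)) / (2 * (k + 1)) := by
  have hc : ∀ k, ((zMean (X ^ k) : ℝ) : ℂ) = ∫ x : S2, sphMono k 0 x ∂sphereMeasure := by
    intro k
    rw [zMean_apply, ← integral_complex_ofReal]
    simp [sphMono]
  induction k using Nat.strong_induction_on with
  | _ k ih =>
    rcases k with _ | _ | k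
    · simp [zMean_apply]
    · have h := moment_recurrence 1 0
      rw [← hc] at h
      norm_num at h
      rw [pow_one] at *
      rw [h]
      norm_num
    · have h := moment_recurrence (k + 2) 0
      rw [← hc, ← hc] at h
      norm_cast at h
      push_cast at h
      simp only [add_zero] at h
      rw [ih k (by lia)] at h
      have h1 : ((k : ℝ) + 2) * (k + 1) ≠ 0 := by positivity
      have h2 : ((k : ℝ) + 2) * (k + 3) ≠ 0 := by positivity
      apply mul_left_cancel₀ h2
      push_cast
      have h3 : ((k : ℝ) + 2) * (k + 3) * zMean (X ^ (k + 1 + 1)) =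
        ((k : ℝ) + 2) * (k + 1) * ((1 - (-1) ^ (k + 1)) / (2 * (k + 1))) := by
        linear_combination h
      rw [h3]
      field_simp
      ring

theorem zMean_derivative (p : ℝ[X]) : zMean (derivative p) = (p.eval 1 - p.eval (-1)) / 2 := by
  induction p using Polynomial.induction_on' with
  | add p q hp hq =>
    rw [derivative_add, map_add, hp, hq, eval_add, eval_add]
    ring
  | monomial n a =>
    rw [derivative_monomial, ← smul_X_eq_monomial, map_smul, zMean_X_pow]
    rcases n with _ | n
    · simp
    · simp
      field_simp

/-- `p(z) w^a \bar w^b` with `w = x + iy`. -/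
noncomputable def zwFun (p : ℝ[X]) (a b : ℕ) (x : E3) : ℂ :=
  ((p.eval (x 2) : ℝ) : ℂ) * coordW x ^ a * conj (coordW x) ^ b

theorem coordZ_apply (x : E3) : coordZ x = ((x 2 : ℝ) : ℂ) := rfl

theorem coordW_apply (x : E3) : coordW x = (x 0 : ℂ) + Complex.I * (x 1 : ℂ) := by
  simp [coordW]

theorem continuous_zwFun (p : ℝ[X]) (a b : ℕ) : Continuous fun x : S2 => zwFun p a b x := by
  have h1 : Continuous fun x : S2 => p.eval ((x : E3) 2) :=
    p.continuous.comp (by fun_prop)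
  have h2 : Continuous fun x : S2 => coordW (x : E3) :=
    coordW.continuous.comp continuous_subtype_val
  have h3 : Continuous fun x : S2 => conj (coordW (x : E3)) := Complex.continuous_conj.comp h2
  unfold zwFun
  fun_prop

theorem zwFun_add (p q : ℝ[X]) (a b : ℕ) (x : E3) :
    zwFun (p + q) a b x = zwFun p a b x + zwFun q a b x := by
  simp [zwFun]; ring

theorem zwFun_smul (c : ℝ) (p : ℝ[X]) (a b : ℕ) (x : E3) :
    zwFun (c • p) a b x = c * zwFun p a b x := by
  simp [zwFun]; ring

theorem zwFun_mul (p q : ℝ[X]) (a b c d : ℕ) (x : E3) :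
    zwFun p a b x * zwFun q c d x = zwFun (p * q) (a + c) (b + d) x := by
  simp [zwFun]; ring

theorem conj_zwFun (p : ℝ[X]) (a b : ℕ) (x : E3) : conj (zwFun p a b x) = zwFun p b a x := by
  simp [zwFun]; ring

theorem zwFun_X_pow (k m : ℕ) (x : E3) : zwFun (X ^ k) m 0 x = sphMono k m x := by
  simp [zwFun, sphMono_eq, coordZ_apply]

/-- On the sphere `|w|² = 1 - z²`, so a common factor `w conj w` can be absorbed into the polynomial
in `z`. -/
theorem zwFun_succ_succ (p : ℝ[X]) (a b : ℕ) (x : S2) :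
    zwFun p (a + 1) (b + 1) x = zwFun (p * (1 - X ^ 2)) a b x := by
  have h := coordW_mul_conj x
  simp only [zwFun, eval_mul, eval_sub, eval_one, eval_pow, eval_X]
  rw [coordZ_apply] at h
  push_cast
  linear_combination (((p.eval ((x : E3) 2) : ℝ) : ℂ) * coordW x ^ a * conj (coordW (x : E3)) ^ b) * h

theorem integral_zwFun_pos {a : ℕ} (ha : a ≠ 0) (p : ℝ[X]) :
    ∫ x : S2, zwFun p a 0 x ∂sphereMeasure = 0 := by
  induction p using Polynomial.induction_on' with
  | add p q hp hq =>
    simp only [zwFun_add]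
    rw [integral_add (integrable_sphere (continuous_zwFun _ _ _))
      (integrable_sphere (continuous_zwFun _ _ _)), hp, hq, add_zero]
  | monomial n c =>
    simp only [← smul_X_eq_monomial, zwFun_smul, zwFun_X_pow]
    rw [integral_const_mul, integral_sphMono_eq_zero ha, mul_zero]

/-- Cancelling common powers of `w` and its conjugate leaves a pure nonzero power of one of them,
whose moments vanish. -/
theorem integral_zwFun_of_ne {a b : ℕ} (hab : a ≠ b) (p : ℝ[X]) :
    ∫ x : S2, zwFun p a b x ∂sphereMeasure = 0 := by
  induction a generalizing b p with
  | zero =>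
    have h := integral_zwFun_pos (a := b) (by lia) p
    have h2 : ∀ x : S2, zwFun p 0 b x = conj (zwFun p b 0 x) := fun x => (conj_zwFun _ _ _ _).symm
    simp only [h2]
    rw [integral_conj, h, map_zero]
  | succ a ih =>
    rcases b with _ | b
    · exact integral_zwFun_pos (by lia) p
    · simp only [zwFun_succ_succ]
      exact ih (by lia) _

theorem integral_zwFun_self (a : ℕ) (p : ℝ[X]) :
    ∫ x : S2, zwFun p a a x ∂sphereMeasure = ((zMean ((1 - X ^ 2) ^ a * p) : ℝ) : ℂ) := by
  induction a generalizing p with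
  | zero =>
    rw [zMean_apply, ← integral_complex_ofReal]
    simp [zwFun]
  | succ a ih =>
    simp only [zwFun_succ_succ, ih]
    congr 2
    ring

/-- The coefficient of the spherical harmonic `Y_{l,m}`. -/
noncomputable def sphCoeff (l : ℕ) (m : ℤ) : ℝ :=
  (if 0 ≤ m then (-1) ^ m.natAbs else 1) *
    Real.sqrt ((2 * l + 1) * ((l - m.natAbs).factorial : ℝ) / ((l + m.natAbs).factorial : ℝ))

/-- One of `m.toNat` and `(-m).toNat` is zero, so a single formula covers both signs of `m`. For `m
< 0` the two factors `(-1)^m` cancel, which explains the case distinction in `sphCoeff`. -/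
theorem sphHarm_eq_zwFun (l : ℕ) (m : ℤ) (x : E3) :
    sphHarm l m x = sphCoeff l m * zwFun (legendreD l m.natAbs) m.toNat (-m).toNat x := by
  unfold sphHarm sphCoeff
  by_cases hm : 0 ≤ m
  · obtain ⟨n, rfl⟩ := Int.eq_ofNat_of_zero_le hm
    simp [sphHarmNonneg, zwFun, legendreD, coordW_apply]
    ring
  · obtain ⟨n, rfl⟩ : ∃ n : ℕ, m = -n := ⟨m.natAbs, by lia⟩
    have h1 : ((-1 : ℂ) ^ n) * (-1) ^ n = 1 := by rw [← mul_pow]; simp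
    simp only [hm, if_false, Int.natAbs_neg, Int.natAbs_natCast, sphHarmNonneg, map_mul, map_pow,
      map_neg, map_one, Complex.conj_ofReal, zwFun, legendreD, coordW_apply, Int.toNat_natCast,
      neg_neg, Int.toNat_neg_natCast, pow_zero]
    push_cast
    linear_combination ((√((2 * l + 1) * ((l - n).factorial : ℝ) / ((l + n).factorial : ℝ)) : ℝ) : ℂ)
      * (((derivative^[n] (legendreP l)).eval (x 2) : ℝ) : ℂ) *
      conj (((x 0 : ℝ) : ℂ) + Complex.I * (x 1 : ℂ)) ^ n * h1

theorem inner_contToL2 {f g : S2 → ℂ} (hf : Continuous f) (hg : Continuous g) :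
    inner ℂ (contToL2 f hf) (contToL2 g hg) = ∫ x, conj (f x) * g x ∂sphereMeasure := by
  rw [L2.inner_def]
  refine integral_congr_ae ?_
  filter_upwards [(memLp_of_continuous_sphere hf).coeFn_toLp,
    (memLp_of_continuous_sphere hg).coeFn_toLp] with x h1 h2
  rw [contToL2, contToL2, h1, h2, RCLike.inner_apply, mul_comm]

/-- In the product the exponents of `w` and `conj w` differ by `m' - m`, so the integral vanishes
unless `m = m'`; then everything reduces to the weighted Legendre means. -/
theorem inner_sphHarmL2 (l l' : ℕ) (m m' : ℤ) (hm : m.natAbs ≤ l) :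
    inner ℂ (sphHarmL2 l m) (sphHarmL2 l' m') = if l = l' ∧ m = m' then 1 else 0 := by
  rw [sphHarmL2, sphHarmL2, inner_contToL2]
  have h : ∀ x : S2, conj (sphHarm l m x) * sphHarm l' m' x = (sphCoeff l m * sphCoeff l' m' : ℝ) *
      zwFun (legendreD l m.natAbs * legendreD l' m'.natAbs) ((-m).toNat + m'.toNat)
        (m.toNat + (-m').toNat) x := by
    intro x
    rw [sphHarm_eq_zwFun, sphHarm_eq_zwFun, map_mul, conj_zwFun, Complex.conj_ofReal, ← zwFun_mul]
    push_cast
    ring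
  simp only [h]
  rw [integral_const_mul]
  by_cases hmm : m = m'
  · subst hmm
    rw [show (-m).toNat + m.toNat = m.natAbs by lia, show m.toNat + (-m).toNat = m.natAbs by lia,
      integral_zwFun_self, ← mul_assoc ((1 - X ^ 2 : ℝ[X]) ^ m.natAbs)]
    by_cases hl : l = l'
    · subst hl
      rw [mean_legendreD_self zMean_derivative hm]
      simp only [and_self, if_true]
      have h1 : sphCoeff l m * sphCoeff l m =
          (2 * l + 1) * ((l - m.natAbs).factorial : ℝ) / ((l + m.natAbs).factorial : ℝ) := by
        unfold sphCoeff
        have h2 : (if 0 ≤ m then (-1 : ℝ) ^ m.natAbs else 1) *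
            (if 0 ≤ m then (-1 : ℝ) ^ m.natAbs else 1) = 1 := by
          split_ifs
          · rw [← mul_pow]; simp
          · simp
        rw [mul_mul_mul_comm, h2, one_mul, Real.mul_self_sqrt (by positivity)]
      rw [h1, ← Complex.ofReal_mul]
      norm_cast
      field_simp
    · simp [mean_legendreD_of_ne zMean_derivative hl, hl]
  · rw [integral_zwFun_of_ne (by lia)]
    simp [hmm]

end Sphere

/-! ### Spherical harmonics: eigenfunctions, completeness -/

section SphereComplete

open scoped ComplexConjugate

theorem continuous_laplaceBeltrami_mul {φ : E3 → ℂ} (hφ : ContDiff ℝ (⊤ : ℕ∞) φ) {f : S2 → ℂ}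
    (hf : Continuous f) : Integrable (fun x => laplaceBeltrami φ x * f x) sphereMeasure :=
  integrable_sphere ((continuous_laplaceBeltrami hφ).mul hf)

theorem zwFun_sub (p q : ℝ[X]) (a b : ℕ) (x : E3) :
    zwFun (p - q) a b x = zwFun p a b x - zwFun q a b x := by
  simp [zwFun]; ring

/-- The differential operator on polynomials induced by the Laplace–Beltrami operator on
`p(z) (x + iy)^m`. -/
noncomputable def zLaplace (m : ℕ) : ℝ[X] →ₗ[ℝ] ℝ[X] where
  toFun p := (1 - X ^ 2) * derivative (derivative p) - (2 * ((m : ℝ[X]) + 1)) * X * derivative p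
    - (m : ℝ[X]) * ((m : ℝ[X]) + 1) * p
  map_add' p q := by
    simp only [derivative_add]
    ring
  map_smul' c p := by
    simp only [RingHom.id_apply, smul_eq_C_mul, derivative_C_mul]
    ring

theorem zLaplace_X_pow (k m : ℕ) : zLaplace m (X ^ k) =
    ((k : ℝ) * (k - 1)) • X ^ (k - 2) - (((k : ℝ) + m) * (k + m + 1)) • X ^ k := by
  simp only [zLaplace, LinearMap.coe_mk, AddHom.coe_mk, smul_eq_C_mul]
  rcases k with _ | _ | k
  · simp
  · simp
    ring
  · simp
    ring

theorem zLaplace_legendreD (l m : ℕ) : zLaplace m (legendreD l m) = (-lam l) • legendreD l m := by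
  have h := legendreD_ode l m
  simp only [zLaplace, LinearMap.coe_mk, AddHom.coe_mk, derivative_legendreD, lam, smul_eq_C_mul]
  simp
  linear_combination -h

/-- Both sides are linear in `p`, and on `X^k` this is Green's identity for `sphMono`. -/
theorem integral_laplaceBeltrami_mul_zwFun {φ : E3 → ℂ} (hφ : ContDiff ℝ (⊤ : ℕ∞) φ) (m : ℕ)
    (p : ℝ[X]) :
    ∫ x : S2, laplaceBeltrami φ x * zwFun p m 0 x ∂sphereMeasure =
      ∫ x : S2, φ x * zwFun (zLaplace m p) m 0 x ∂sphereMeasure := by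
  have hφc : Continuous fun x : S2 => φ x := hφ.continuous.comp continuous_subtype_val
  induction p using Polynomial.induction_on' with
  | add p q hp hq =>
    simp only [map_add, zwFun_add, mul_add]
    rw [integral_add (continuous_laplaceBeltrami_mul hφ (continuous_zwFun _ _ _))
      (continuous_laplaceBeltrami_mul hφ (continuous_zwFun _ _ _)), hp, hq]
    exact (integral_add (integrable_sphere (hφc.mul (continuous_zwFun _ _ _)))
      (integrable_sphere (hφc.mul (continuous_zwFun _ _ _)))).symm
  | monomial n c =>
    simp only [← smul_X_eq_monomial, map_smul, zwFun_smul, mul_left_comm _ (c : ℂ)]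
    rw [integral_const_mul, integral_const_mul]
    simp only [zwFun_X_pow]
    rw [integral_laplaceBeltrami_mul_sphMono hφ]
    congr 2
    funext x
    rw [zLaplace_X_pow, zwFun_sub, zwFun_smul, zwFun_smul, zwFun_X_pow, zwFun_X_pow]
    push_cast
    ring

theorem laplaceBeltrami_conj {φ : E3 → ℂ} (x : S2) :
    laplaceBeltrami (fun y => conj (φ y)) x = conj (laplaceBeltrami φ x) := by
  have := InnerProductSpace.laplacian_CLE_comp_left (l := Complex.conjCLE)
    (f := fun y : E3 => φ (‖y‖⁻¹ • y))
  exact congrFun this x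

theorem contDiff_conj {φ : E3 → ℂ} (hφ : ContDiff ℝ (⊤ : ℕ∞) φ) :
    ContDiff ℝ (⊤ : ℕ∞) fun y => conj (φ y) :=
  Complex.conjCLE.contDiff.comp hφ

/-- For `m ≥ 0` this is Green's identity with the Legendre equation. Negative `m` involve powers of
`conj w`; they follow by applying that case to `conj φ` and conjugating. -/
theorem integral_laplaceBeltrami_mul_sphHarm {φ : E3 → ℂ} (hφ : ContDiff ℝ (⊤ : ℕ∞) φ)
    (l : ℕ) (m : ℤ) :
    ∫ x : S2, laplaceBeltrami φ x * sphHarm l m x ∂sphereMeasure =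
      -lam l * ∫ x : S2, φ x * sphHarm l m x ∂sphereMeasure := by
  have key : ∀ {φ : E3 → ℂ}, ContDiff ℝ (⊤ : ℕ∞) φ → ∀ n : ℕ,
      ∫ x : S2, laplaceBeltrami φ x * zwFun (legendreD l n) n 0 x ∂sphereMeasure =
      -lam l * ∫ x : S2, φ x * zwFun (legendreD l n) n 0 x ∂sphereMeasure := by
    intro φ hφ n
    rw [integral_laplaceBeltrami_mul_zwFun hφ, zLaplace_legendreD, ← integral_const_mul]
    refine integral_congr_ae (Filter.Eventually.of_forall fun x => ?_)
    simp only [zwFun_smul]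
    push_cast
    ring
  simp only [sphHarm_eq_zwFun, mul_left_comm _ ((sphCoeff l m : ℝ) : ℂ)]
  rw [integral_const_mul, integral_const_mul, mul_left_comm]
  congr 1
  rcases le_total 0 m with hm | hm
  · obtain ⟨n, rfl⟩ := Int.eq_ofNat_of_zero_le hm
    simpa using key hφ n
  · obtain ⟨n, rfl⟩ : ∃ n : ℕ, m = -n := ⟨m.natAbs, by lia⟩
    have h := congrArg conj (key (contDiff_conj hφ) n)
    rw [map_mul, ← integral_conj, ← integral_conj] at h
    simp only [laplaceBeltrami_conj, map_mul, conj_zwFun, Complex.conj_conj, map_neg,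
      Complex.conj_ofReal] at h
    simpa using h

/-- Weak form of `Δ Y_{l,m} = -λ_l Y_{l,m}`. -/
theorem inner_laplaceTestL2_sphHarmL2 {φ : E3 → ℂ} (hφ : ContDiff ℝ (⊤ : ℕ∞) φ) (l : ℕ) (m : ℤ) :
    inner ℂ (laplaceTestL2 φ hφ) (sphHarmL2 l m) =
      -lam l * inner ℂ (testL2 φ hφ) (sphHarmL2 l m) := by
  rw [laplaceTestL2, testL2, sphHarmL2, inner_contToL2, inner_contToL2]
  have := integral_laplaceBeltrami_mul_sphHarm (contDiff_conj hφ) l m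
  simpa only [laplaceBeltrami_conj] using this

/-- The functions `p(z) w^a \bar w^b` as continuous functions on the sphere. -/
noncomputable def zwCont (p : ℝ[X]) (a b : ℕ) : C(S2, ℂ) := ⟨fun x => zwFun p a b x,
  continuous_zwFun p a b⟩

/-- The algebra of polynomial functions on the sphere. -/
noncomputable def sphPolyAlg : StarSubalgebra ℂ C(S2, ℂ) where
  toSubalgebra := (Submodule.span ℂ {f | ∃ p a b, f = zwCont p a b}).toSubalgebra
    (Submodule.subset_span ⟨1, 0, 0, by ext x; simp [zwCont, zwFun]⟩) (by
      intro f g hf hg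
      have h := Submodule.mul_mem_mul hf hg
      rw [Submodule.span_mul_span] at h
      refine Submodule.span_mono ?_ h
      rintro _ ⟨_, ⟨p, a, b, rfl⟩, _, ⟨q, c, d, rfl⟩, rfl⟩
      exact ⟨p * q, a + c, b + d, by ext x; exact zwFun_mul p q a b c d x⟩)
  star_mem' := by
    intro f hf
    change star f ∈ Submodule.span ℂ _
    change f ∈ Submodule.span ℂ _ at hf
    induction hf using Submodule.span_induction with
    | mem f hf =>
      obtain ⟨p, a, b, rfl⟩ := hf
      exact Submodule.subset_span ⟨p, b, a, by ext x; exact conj_zwFun p a b x⟩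
    | zero => simp
    | add f g _ _ hf hg =>
      rw [star_add]
      exact Submodule.add_mem _ hf hg
    | smul c f _ hf =>
      rw [star_smul]
      exact Submodule.smul_mem _ _ hf

theorem zwCont_mem_sphPolyAlg (p : ℝ[X]) (a b : ℕ) : zwCont p a b ∈ sphPolyAlg :=
  Submodule.subset_span ⟨p, a, b, rfl⟩

theorem sphPolyAlg_separatesPoints : sphPolyAlg.SeparatesPoints := by
  intro x y hxy
  by_contra h
  push Not at h
  apply hxy
  have hz := h (zwCont X 0 0) ⟨zwCont X 0 0, zwCont_mem_sphPolyAlg _ _ _, rfl⟩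
  have hw := h (zwCont 1 1 0) ⟨zwCont 1 1 0, zwCont_mem_sphPolyAlg _ _ _, rfl⟩
  simp only [zwCont, zwFun, coordW_apply, ContinuousMap.coe_mk, eval_X, eval_one, pow_zero, pow_one,
    mul_one, Complex.ofReal_one, one_mul, Complex.ofReal_inj] at hz hw
  have hre := congrArg Complex.re hw
  have him := congrArg Complex.im hw
  simp at hre him
  ext i
  fin_cases i
  · exact hre
  · exact him
  · exact hz

theorem sphCoeff_ne_zero (l : ℕ) (m : ℤ) : sphCoeff l m ≠ 0 := by
  unfold sphCoeff
  refine mul_ne_zero ?_ (Real.sqrt_pos.2 (by positivity)).ne'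
  split_ifs <;> simp

theorem sphHarmL2_eq_smul (l : ℕ) (m : ℤ) :
    sphHarmL2 l m = (sphCoeff l m : ℂ) • ContinuousMap.toLp 2 sphereMeasure ℂ
        (zwCont (legendreD l m.natAbs) m.toNat (-m).toNat) := by
  rw [← map_smul]
  refine Lp.ext ?_
  refine (memLp_of_continuous_sphere (continuous_sphHarm l m)).coeFn_toLp.trans ?_
  refine Filter.EventuallyEq.trans ?_ (ContinuousMap.coeFn_toLp sphereMeasure _).symm
  exact Filter.Eventually.of_forall fun x => sphHarm_eq_zwFun l m x

/-- Derivatives of Legendre polynomials span all `p`, which settles `p(z) w^n` and `p(z) conj w^n`;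
mixed powers reduce to these through `|w|² = 1 - z²`. Hence `Λ` vanishes on the polynomial
functions, which are dense by Stone–Weierstrass. -/
theorem continuousLinearMap_eq_zero_of_sphHarm {Λ : C(S2, ℂ) →L[ℂ] ℂ}
    (hΛY : ∀ l : ℕ, ∀ m ∈ Finset.Icc (-(l : ℤ)) l,
      Λ (zwCont (legendreD l m.natAbs) m.toNat (-m).toNat) = 0) : ∀ g, Λ g = 0 := by
  have hlin : ∀ (a b : ℕ) (S : Set ℝ[X]), (∀ p ∈ S, Λ (zwCont p a b) = 0) →
      ∀ p ∈ Submodule.span ℝ S, Λ (zwCont p a b) = 0 := by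
    intro a b S hS p hp
    induction hp using Submodule.span_induction with
    | mem p hp => exact hS p hp
    | zero =>
      rw [show zwCont 0 a b = 0 by ext x; simp [zwCont, zwFun], map_zero]
    | add p q _ _ hp hq =>
      rw [show zwCont (p + q) a b = zwCont p a b + zwCont q a b by
        ext x; exact zwFun_add p q a b x, map_add, hp, hq, add_zero]
    | smul c p _ hp =>
      rw [show zwCont (c • p) a b = (c : ℂ) • zwCont p a b by
        ext x; exact zwFun_smul c p a b x, map_smul, hp, smul_zero]
  have hpure : ∀ (n : ℕ) (p : ℝ[X]), Λ (zwCont p n 0) = 0 ∧ Λ (zwCont p 0 n) = 0 := by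
    intro n p
    have hp : p ∈ Submodule.span ℝ (Set.range fun j => legendreD (n + j) n) := by
      rw [span_range_legendreD]; trivial
    constructor
    · refine hlin n 0 _ ?_ p hp
      rintro _ ⟨j, rfl⟩
      simpa using hΛY (n + j) n (by rw [Finset.mem_Icc]; lia)
    · refine hlin 0 n _ ?_ p hp
      rintro _ ⟨j, rfl⟩
      simpa using hΛY (n + j) (-n) (by rw [Finset.mem_Icc]; lia)
  have hall : ∀ (a b : ℕ) (p : ℝ[X]), Λ (zwCont p a b) = 0 := by
    intro a
    induction a with
    | zero => exact fun b p => (hpure b p).2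
    | succ a ih =>
      rintro (_ | b) p
      · exact (hpure _ p).1
      · rw [show zwCont p (a + 1) (b + 1) = zwCont (p * (1 - X ^ 2)) a b by
          ext x; exact zwFun_succ_succ p a b x]
        exact ih b _
  have hspan : (sphPolyAlg : Set C(S2, ℂ)) ⊆ {g | Λ g = 0} := by
    intro g hg
    change g ∈ Submodule.span ℂ _ at hg
    induction hg using Submodule.span_induction with
    | mem g hg =>
      obtain ⟨p, a, b, rfl⟩ := hg
      exact hall a b p
    | zero => exact map_zero Λ
    | add f g _ _ hf hg =>
      change Λ _ = 0 at hf hg ⊢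
      rw [map_add, hf, hg, add_zero]
    | smul c f _ hf =>
      change Λ _ = 0 at hf ⊢
      rw [map_smul, hf, smul_zero]
  intro g
  have hcl : closure (sphPolyAlg : Set C(S2, ℂ)) ⊆ {g | Λ g = 0} :=
    closure_minimal hspan (isClosed_eq Λ.continuous continuous_const)
  have htop := ContinuousMap.starSubalgebra_topologicalClosure_eq_top_of_separatesPoints
    sphPolyAlg sphPolyAlg_separatesPoints
  refine hcl ?_
  rw [← StarSubalgebra.topologicalClosure_coe, htop]
  trivial

/-- The spherical harmonics are complete in `L₂(𝕊²)`. -/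
theorem eq_zero_of_inner_sphHarmL2 {f : L2C}
    (h : ∀ l : ℕ, ∀ m ∈ Finset.Icc (-(l : ℤ)) l, inner ℂ (sphHarmL2 l m) f = 0) : f = 0 := by
  have hΛ0 := continuousLinearMap_eq_zero_of_sphHarm
    (Λ := (innerSL ℂ f).comp (ContinuousMap.toLp 2 sphereMeasure ℂ)) (by
      intro l m hm
      have h2 := h l m hm
      rw [sphHarmL2_eq_smul, inner_smul_left, mul_eq_zero] at h2
      have h4 := h2.resolve_left (by simpa using sphCoeff_ne_zero l m)
      have h5 := congrArg conj h4
      rwa [inner_conj_symm, map_zero] at h5)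
  have hdense : DenseRange (ContinuousMap.toLp (E := ℂ) 2 sphereMeasure ℂ) :=
    ContinuousMap.toLp_denseRange ℂ sphereMeasure ℂ (by simp)
  have hfin : ∀ g : L2C, inner ℂ f g = 0 := by
    intro g
    refine hdense.induction_on (p := fun g => inner ℂ f g = 0) g
      (isClosed_eq (by fun_prop) continuous_const) ?_
    exact fun g => hΛ0 g
  exact inner_self_eq_zero.1 (hfin f)

end SphereComplete

/-! ### The Mittag-Leffler function -/

section MittagLeffler

open Real

/-- Keep only the part `t > R` of Euler's integral, where `t^x ≥ R^x`. With `R` free this shows that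
`Γ` outgrows every geometric sequence. -/
theorem rpow_mul_exp_neg_le_Gamma {R x : ℝ} (hR : 0 < R) (hx : 0 ≤ x) :
    R ^ x * Real.exp (-R) ≤ Real.Gamma (x + 1) := by
  have hint : IntegrableOn (fun t => Real.exp (-t) * t ^ (x + 1 - 1)) (Set.Ioi 0) :=
    Real.GammaIntegral_convergent (by linarith)
  rw [Real.Gamma_eq_integral (by linarith)]
  calc R ^ x * Real.exp (-R) = ∫ t in Set.Ioi R, R ^ x * Real.exp (-t) := by
        rw [integral_const_mul, integral_exp_neg_Ioi]
    _ ≤ ∫ t in Set.Ioi R, Real.exp (-t) * t ^ (x + 1 - 1) := by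
        refine setIntegral_mono_on ?_ (hint.mono_set (Set.Ioi_subset_Ioi hR.le)) measurableSet_Ioi ?_
        · exact (integrableOn_exp_neg_Ioi R).const_mul _
        · intro t ht
          rw [mul_comm, add_sub_cancel_right]
          exact mul_le_mul_of_nonneg_left (Real.rpow_le_rpow hR.le (le_of_lt ht) hx)
            (Real.exp_pos _).le
    _ ≤ _ := by
        refine setIntegral_mono_set hint ?_ (Set.Ioi_subset_Ioi hR.le).eventuallyLE
        filter_upwards [ae_restrict_mem measurableSet_Ioi] with t ht
        exact mul_nonneg (Real.exp_pos _).le (Real.rpow_nonneg (le_of_lt ht) _)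

theorem Gamma_mittag_pos {α : ℝ} (hα : 0 < α) (k : ℕ) : 0 < Real.Gamma (α * k + 1) :=
  Real.Gamma_pos_of_pos (by positivity)

theorem summable_mittagLeffler {α : ℝ} (hα : 0 < α) (z : ℝ) :
    Summable fun k : ℕ => |z| ^ k / Real.Gamma (α * k + 1) := by
  -- With `R^α = B` the lower bound for `Γ(α k + 1)` is `B^k exp (-R)`; since `B ≥ 2|z|`, the terms
  -- are at most `exp R * 2^(-k)`.
  set B : ℝ := 2 * (|z| + 1) with hB
  have hBpos : 0 < B := by positivity
  set R : ℝ := B ^ α⁻¹ with hR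
  have hRpos : 0 < R := Real.rpow_pos_of_pos hBpos _
  have hgeo : Summable fun k : ℕ => Real.exp R * (1 / 2 : ℝ) ^ k :=
    (summable_geometric_two).mul_left _
  refine Summable.of_nonneg_of_le (fun k => ?_) (fun k => ?_) hgeo
  · exact div_nonneg (by positivity) (Gamma_mittag_pos hα k).le
  · have h1 := rpow_mul_exp_neg_le_Gamma hRpos (x := α * k) (by positivity)
    have h2 : R ^ (α * k) = B ^ k := by
      rw [hR, ← Real.rpow_mul hBpos.le, inv_mul_cancel_left₀ hα.ne', Real.rpow_natCast]
    rw [h2] at h1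
    rw [div_le_iff₀ (Gamma_mittag_pos hα k)]
    calc |z| ^ k ≤ (B / 2) ^ k := by
          gcongr
          rw [hB]
          linarith
      _ = Real.exp R * (1 / 2 : ℝ) ^ k * (B ^ k * Real.exp (-R)) := by
          rw [Real.exp_neg, div_pow, div_pow, one_pow]
          field_simp
      _ ≤ _ := by gcongr

theorem continuous_mittagLeffler {α : ℝ} (hα : 0 < α) : Continuous (mittagLeffler α) := by
  rw [continuous_iff_continuousAt]
  intro z
  have h : ContinuousOn (mittagLeffler α) (Metric.ball 0 (|z| + 1)) := by
    refine continuousOn_tsum (u := fun k : ℕ => |(|z| + 1)| ^ k / Real.Gamma (α * k + 1))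
      (fun k => by fun_prop) (summable_mittagLeffler hα _) ?_
    intro k x hx
    rw [mem_ball_zero_iff, Real.norm_eq_abs] at hx
    rw [norm_div, norm_pow, Real.norm_eq_abs, Real.norm_of_nonneg (Gamma_mittag_pos hα k).le,
      abs_of_nonneg (by positivity : (0 : ℝ) ≤ |z| + 1)]
    have := Gamma_mittag_pos hα k
    gcongr
  refine h.continuousAt (Metric.isOpen_ball.mem_nhds ?_)
  rw [mem_ball_zero_iff, Real.norm_eq_abs]
  linarith

/-- The function `t ↦ E_α(-λ t^α)`. -/
noncomputable def mlRelax (α lam t : ℝ) : ℝ := mittagLeffler α (-lam * t ^ α)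

theorem continuous_mlRelax {α : ℝ} (hα : 0 < α) (lam : ℝ) : Continuous (mlRelax α lam) :=
  (continuous_mittagLeffler hα).comp
    (continuous_const.mul (Real.continuous_rpow_const hα.le))

theorem intervalIntegrable_sub_rpow {α : ℝ} (hα : 0 < α) (a t : ℝ) :
    IntervalIntegrable (fun s => (t - s) ^ (α - 1)) volume a t := by
  have := (intervalIntegral.intervalIntegrable_rpow' (r := α - 1) (by linarith)
    (a := t - a) (b := t - t)).comp_sub_left t
  simpa using this

theorem integral_sub_rpow_mul_rpow {α β t : ℝ} (hα : 0 < α) (hβ : 0 ≤ β) (ht : 0 ≤ t) :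
    ∫ s in (0 : ℝ)..t, (t - s) ^ (α - 1) * s ^ β =
      t ^ (α + β) * (Real.Gamma α * Real.Gamma (β + 1) / Real.Gamma (α + β + 1)) := by
  rcases ht.eq_or_lt with rfl | ht
  · rw [intervalIntegral.integral_same, Real.zero_rpow (by linarith), zero_mul]
  have h1 := Complex.betaIntegral_scaled ((β + 1 : ℝ) : ℂ) (α : ℂ) ht
  have h2 := Complex.Gamma_mul_Gamma_eq_betaIntegral (s := ((β + 1 : ℝ) : ℂ)) (t := (α : ℂ))
    (by simp; linarith) (by simpa using hα)
  have hG : Real.Gamma (α + β + 1) ≠ 0 := (Real.Gamma_pos_of_pos (by linarith)).ne'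
  have h3 : Complex.betaIntegral ((β + 1 : ℝ) : ℂ) (α : ℂ) =
      ((Real.Gamma α * Real.Gamma (β + 1) / Real.Gamma (α + β + 1) : ℝ) : ℂ) := by
    rw [← Complex.ofReal_add, Complex.Gamma_ofReal, Complex.Gamma_ofReal, Complex.Gamma_ofReal,
      show β + 1 + α = α + β + 1 by ring] at h2
    push_cast at h2 ⊢
    rw [eq_div_iff (by exact_mod_cast hG)]
    linear_combination -h2
  rw [h3] at h1
  have h4 : ∫ x in (0 : ℝ)..t, (x : ℂ) ^ (((β + 1 : ℝ) : ℂ) - 1) * ((t : ℂ) - x) ^ ((α : ℂ) - 1) =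
      ((∫ s in (0 : ℝ)..t, (t - s) ^ (α - 1) * s ^ β : ℝ) : ℂ) := by
    rw [← intervalIntegral.integral_ofReal]
    refine intervalIntegral.integral_congr fun s hs => ?_
    rw [Set.uIcc_of_le ht.le] at hs
    rw [Complex.ofReal_mul, Complex.ofReal_cpow (by linarith [hs.2]), Complex.ofReal_cpow hs.1]
    push_cast
    rw [mul_comm]
    congr 2
    ring
  rw [h4, show (((β + 1 : ℝ) : ℂ) + α - 1) = ((α + β : ℝ) : ℂ) by push_cast; ring,
    ← Complex.ofReal_cpow ht.le] at h1
  exact_mod_cast h1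

/-- The fractional relaxation equation in integral form. -/
theorem mlRelax_integral_eq {α : ℝ} (hα : 0 < α) (lam : ℝ) {t : ℝ} (ht : 0 ≤ t) :
    lam * (Real.Gamma α)⁻¹ * ∫ s in (0 : ℝ)..t, (t - s) ^ (α - 1) * mlRelax α lam s =
      1 - mlRelax α lam t := by
  set F : ℕ → ℝ → ℝ := fun k s => (t - s) ^ (α - 1) *
    ((-lam) ^ k * s ^ (α * k) / Real.Gamma (α * k + 1)) with hF
  set c : ℕ → ℝ := fun k => (-lam) ^ k * t ^ (α * k) / Real.Gamma (α * k + 1) with hc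
  have hΓ : Real.Gamma α ≠ 0 := (Real.Gamma_pos_of_pos hα).ne'
  have hpow : ∀ (k : ℕ) {s : ℝ}, 0 ≤ s → (-lam * s ^ α) ^ k = (-lam) ^ k * s ^ (α * k) := by
    intro k s hs
    rw [mul_pow, ← Real.rpow_natCast (s ^ α), ← Real.rpow_mul hs]
  have hsum : Summable fun k => |c k| := by
    refine (summable_mittagLeffler hα (-lam * t ^ α)).congr fun k => ?_
    simp only [hc]
    rw [← hpow k ht, abs_div, abs_pow, abs_of_pos (Gamma_mittag_pos hα k)]
  have hFint : ∀ k, Integrable (F k) (volume.restrict (Set.Ioc 0 t)) := by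
    intro k
    have := (intervalIntegrable_sub_rpow hα 0 t).mul_continuousOn
      (g := fun s => (-lam) ^ k * s ^ (α * k) / Real.Gamma (α * k + 1)) (by
        have := Real.continuous_rpow_const (q := α * k) (by positivity)
        fun_prop)
    exact (intervalIntegrable_iff_integrableOn_Ioc_of_le ht).1 this
  -- By the Beta integral, fractional integration takes the `k`-th power of the series to the
  -- `(k+1)`-st. The factor `d` is free so that the same formula serves the terms and their absolute
  -- values.
  have hval : ∀ (d : ℝ) (k : ℕ), ∫ s in (0 : ℝ)..t, (t - s) ^ (α - 1) *
      (d * s ^ (α * k) / Real.Gamma (α * k + 1)) =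
      Real.Gamma α * (d * t ^ (α * (k + 1 : ℕ)) / Real.Gamma (α * (k + 1 : ℕ) + 1)) := by
    intro d k
    have := integral_sub_rpow_mul_rpow (β := α * k) hα (by positivity) ht
    have h2 : ∀ s : ℝ, (t - s) ^ (α - 1) * (d * s ^ (α * k) / Real.Gamma (α * k + 1)) =
        (d / Real.Gamma (α * k + 1)) * ((t - s) ^ (α - 1) * s ^ (α * k)) := fun s => by ring
    simp only [h2]
    rw [intervalIntegral.integral_const_mul, this,
      show α * ((k + 1 : ℕ) : ℝ) = α + α * k by push_cast; ring]
    have := (Gamma_mittag_pos hα k).ne'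
    field_simp
  have hFnorm : ∀ k, ∫ s in Set.Ioc 0 t, ‖F k s‖ =
      Real.Gamma α * (|(-lam)| ^ k * t ^ (α * (k + 1 : ℕ)) / Real.Gamma (α * (k + 1 : ℕ) + 1)) := by
    intro k
    rw [← hval, intervalIntegral.integral_of_le ht]
    refine setIntegral_congr_fun measurableSet_Ioc fun s hs => ?_
    simp only [hF]
    rw [norm_mul, norm_div, norm_mul, norm_pow, Real.norm_of_nonneg (Gamma_mittag_pos hα k).le,
      Real.norm_of_nonneg (Real.rpow_nonneg (by linarith [hs.2]) _),
      Real.norm_of_nonneg (Real.rpow_nonneg hs.1.le _), Real.norm_eq_abs]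
  have hFsum : Summable fun k => ∫ s in Set.Ioc 0 t, ‖F k s‖ := by
    simp only [hFnorm]
    refine Summable.mul_left _ ?_
    -- For `lam ≠ 0` the shifted series is compared with the Mittag-Leffler series after division by
    -- `|lam|`; for `lam = 0` only one term is nonzero.
    rcases eq_or_ne lam 0 with rfl | hl
    · refine summable_of_ne_finset_zero (s := {0}) fun k hk => ?_
      have : k ≠ 0 := by simpa using hk
      simp [this]
    · have h1 := ((summable_nat_add_iff 1).2 hsum).mul_left |(-lam)|⁻¹
      refine h1.congr fun k => ?_
      simp only [hc]
      have hl' : |(-lam)| ≠ 0 := by simpa using hl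
      rw [abs_div, abs_mul, abs_pow, abs_of_pos (Gamma_mittag_pos hα (k + 1)),
        abs_of_nonneg (Real.rpow_nonneg ht _)]
      field_simp
      ring
  have hsw := hasSum_integral_of_summable_integral_norm hFint hFsum
  have h1 : ∫ s in (0 : ℝ)..t, (t - s) ^ (α - 1) * mlRelax α lam s =
      ∫ s in Set.Ioc 0 t, ∑' k, F k s := by
    rw [intervalIntegral.integral_of_le ht]
    refine setIntegral_congr_fun measurableSet_Ioc fun s hs => ?_
    simp only [hF, mlRelax, mittagLeffler]
    rw [tsum_mul_left]
    congr 2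
    ext k
    rw [hpow k hs.1.le]
  have h2 : ∀ k, ∫ s in Set.Ioc 0 t, F k s = Real.Gamma α *
      ((-lam) ^ k * t ^ (α * (k + 1 : ℕ)) / Real.Gamma (α * (k + 1 : ℕ) + 1)) := by
    intro k
    rw [← hval, intervalIntegral.integral_of_le ht]
  simp only [h2] at hsw
  rw [← h1] at hsw
  have h3 : HasSum (fun k => c (k + 1))
      (-(lam * (Real.Gamma α)⁻¹ * ∫ s in (0 : ℝ)..t, (t - s) ^ (α - 1) * mlRelax α lam s)) := by
    have := hsw.mul_left (-(lam * (Real.Gamma α)⁻¹))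
    rw [neg_mul] at this
    refine this.congr_fun ?_ |> id
    intro k
    simp only [hc]
    field_simp
    ring
  have h4 : mlRelax α lam t = ∑' k, c k := by
    simp only [mlRelax, mittagLeffler, hc, hpow _ ht]
  have h5 := hsum.of_abs.tsum_eq_zero_add
  rw [← h4, h3.tsum_eq] at h5
  have h6 : c 0 = 1 := by simp [hc]
  rw [h5, h6]
  ring

/-- Positivity of the exponential convolution kernels. -/
theorem exp_kernel_energy_nonneg {u : ℝ → ℝ} (hu : Continuous u) {r T : ℝ} (hr : 0 ≤ r)
    (hT : 0 ≤ T) :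
    0 ≤ ∫ t in (0 : ℝ)..T, u t * ∫ s in (0 : ℝ)..t, Real.exp (-(r * (t - s))) * u s := by
  set I : ℝ → ℝ := fun t => ∫ s in (0 : ℝ)..t, Real.exp (r * s) * u s with hI
  set v : ℝ → ℝ := fun t => Real.exp (-(r * t)) * I t with hv
  have hcont : Continuous fun s => Real.exp (r * s) * u s := by fun_prop
  have hId : ∀ t, HasDerivAt I (Real.exp (r * t) * u t) t := fun t =>
    intervalIntegral.integral_hasDerivAt_right (hcont.intervalIntegrable _ _)
      hcont.aestronglyMeasurable.stronglyMeasurableAtFilter hcont.continuousAt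
  -- The convolution `v` solves `v' = u - r v` with `v 0 = 0`, so `u v = (v²/2)' + r v²`, and both
  -- terms have nonnegative integral.
  have hvd : ∀ t, HasDerivAt v (u t - r * v t) t := by
    intro t
    have h1 : HasDerivAt (fun t => Real.exp (-(r * t))) (Real.exp (-(r * t)) * (-(r * 1))) t :=
      (((hasDerivAt_id t).const_mul r).neg).exp
    refine (h1.mul (hId t)).congr_deriv ?_
    have : Real.exp (-(r * t)) * Real.exp (r * t) = 1 := by rw [← Real.exp_add]; simp
    simp only [hv]
    linear_combination u t * this
  have hvc : Continuous v := continuous_iff_continuousAt.2 fun t => (hvd t).continuousAt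
  have hveq : ∀ t, ∫ s in (0 : ℝ)..t, Real.exp (-(r * (t - s))) * u s = v t := by
    intro t
    simp only [hv, hI]
    rw [← intervalIntegral.integral_const_mul]
    congr 1
    ext s
    rw [← mul_assoc, ← Real.exp_add]
    congr 2
    ring
  simp only [hveq]
  have hsq : ∀ t, HasDerivAt (fun t => v t ^ 2 / 2) (v t * (u t - r * v t)) t := by
    intro t
    refine (((hvd t).pow 2).div_const 2).congr_deriv ?_
    simp
    ring
  have hFTC := intervalIntegral.integral_eq_sub_of_hasDerivAt (a := 0) (b := T)
    (fun t _ => hsq t) ((by fun_prop : Continuous fun t => v t * (u t - r * v t)).intervalIntegrable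
      _ _)
  have hv0 : v 0 = 0 := by simp [hv, hI]
  rw [hv0] at hFTC
  have hsplit : ∫ t in (0 : ℝ)..T, u t * v t =
      (∫ t in (0 : ℝ)..T, v t * (u t - r * v t)) + ∫ t in (0 : ℝ)..T, r * v t ^ 2 := by
    rw [← intervalIntegral.integral_add]
    · congr 1
      ext t
      ring
    · exact (by fun_prop : Continuous fun t => v t * (u t - r * v t)).intervalIntegrable _ _
    · exact (by fun_prop : Continuous fun t => r * v t ^ 2).intervalIntegrable _ _
  rw [hsplit, hFTC]
  have : 0 ≤ ∫ t in (0 : ℝ)..T, r * v t ^ 2 :=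
    intervalIntegral.integral_nonneg hT fun t _ => by positivity
  have := sq_nonneg (v T)
  linarith

/-- For `α < 1` the fractional kernel is, up to `Γ(1-α)`, the Laplace transform of the positive
weight `r^(-α)`. -/
theorem rpow_eq_integral_exp {α : ℝ} (hα1 : α < 1) (x : ℝ) (hx : 0 < x) :
    IntegrableOn (fun r => r ^ (-α) * Real.exp (-(r * x))) (Set.Ioi 0) ∧
    ∫ r in Set.Ioi 0, r ^ (-α) * Real.exp (-(r * x)) = x ^ (α - 1) * Real.Gamma (1 - α) := by
  have h1 := Real.integral_rpow_mul_exp_neg_mul_Ioi (a := 1 - α) (by linarith) hx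
  have h2 : ∫ r in Set.Ioi 0, r ^ (-α) * Real.exp (-(r * x)) =
      x ^ (α - 1) * Real.Gamma (1 - α) := by
    rw [one_div, Real.inv_rpow hx.le, ← Real.rpow_neg hx.le, neg_sub] at h1
    rw [← h1]
    congr 1
    ext r
    rw [mul_comm r x]
    congr 2
    ring
  refine ⟨?_, h2⟩
  -- A function that is not integrable has integral `0` by convention, whereas the value found is
  -- positive.
  by_contra h
  rw [integral_undef h] at h2
  exact absurd h2.symm (mul_pos (Real.rpow_pos_of_pos hx _)
    (Real.Gamma_pos_of_pos (by linarith))).ne'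

/-- The inner integral is `t^α / α`, bounded on `(0, T]`. This supplies the majorant for every use
of Fubini in the energy estimate. -/
theorem integrable_sub_rpow_triangle {α : ℝ} (hα : 0 < α) (T : ℝ) :
    Integrable ({p : ℝ × ℝ | p.2 < p.1}.indicator fun p : ℝ × ℝ => (p.1 - p.2) ^ (α - 1))
      ((volume.restrict (Set.Ioc 0 T)).prod (volume.restrict (Set.Ioc 0 T))) := by
  set ν : Measure ℝ := volume.restrict (Set.Ioc 0 T) with hν
  set Δ : Set (ℝ × ℝ) := {p | p.2 < p.1} with hΔ
  have hΔm : MeasurableSet Δ := measurableSet_lt measurable_snd measurable_fst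
  have hms : AEStronglyMeasurable (Δ.indicator fun p : ℝ × ℝ => (p.1 - p.2) ^ (α - 1))
      (ν.prod ν) := by
    refine (Measurable.indicator ?_ hΔm).aestronglyMeasurable
    fun_prop
  have hin : ∀ t ∈ Set.Ioc 0 T, Integrable (fun s => Δ.indicator
      (fun p : ℝ × ℝ => (p.1 - p.2) ^ (α - 1)) (t, s)) ν ∧
      ∫ s, ‖Δ.indicator (fun p : ℝ × ℝ => (p.1 - p.2) ^ (α - 1)) (t, s)‖ ∂ν = t ^ α / α := by
    intro t ht
    have h1 : ∀ s, Δ.indicator (fun p : ℝ × ℝ => (p.1 - p.2) ^ (α - 1)) (t, s) =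
        (Set.Iio t).indicator (fun s => (t - s) ^ (α - 1)) s := fun s => by
      by_cases h : s < t <;> simp [Set.indicator, hΔ, h]
    have h4 : Set.Iio t ∩ Set.Ioc 0 T = Set.Ioo 0 t := by
      ext s
      simp only [Set.mem_inter_iff, Set.mem_Iio, Set.mem_Ioc, Set.mem_Ioo]
      constructor
      · rintro ⟨h2, h3, -⟩
        exact ⟨h3, h2⟩
      · rintro ⟨h2, h3⟩
        exact ⟨h3, h2, h3.le.trans ht.2⟩
    have h5 := intervalIntegrable_sub_rpow hα 0 t
    rw [intervalIntegrable_iff_integrableOn_Ioo_of_le ht.1.le] at h5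
    simp only [h1]
    constructor
    · rw [integrable_indicator_iff measurableSet_Iio, hν, IntegrableOn,
        Measure.restrict_restrict measurableSet_Iio, h4]
      exact h5
    · simp only [norm_indicator_eq_indicator_norm]
      rw [integral_indicator measurableSet_Iio, hν, Measure.restrict_restrict measurableSet_Iio,
        h4]
      have h6 : ∫ s in Set.Ioo 0 t, ‖(t - s) ^ (α - 1)‖ = ∫ s in Set.Ioo 0 t, (t - s) ^ (α - 1) :=
        setIntegral_congr_fun measurableSet_Ioo fun s hs =>
          Real.norm_of_nonneg (Real.rpow_nonneg (by linarith [hs.2]) _)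
      rw [h6, ← integral_Ioc_eq_integral_Ioo, ← intervalIntegral.integral_of_le ht.1.le,
        intervalIntegral.integral_comp_sub_left (fun s => s ^ (α - 1)) t, sub_self, sub_zero,
        integral_rpow (Or.inl (by linarith)), sub_add_cancel, Real.zero_rpow hα.ne', sub_zero]
  rw [integrable_prod_iff hms]
  constructor
  · filter_upwards [ae_restrict_mem measurableSet_Ioc] with t ht
    exact (hin t ht).1
  · have h7 : Integrable (fun t : ℝ => t ^ α / α) ν :=
      ((Real.continuous_rpow_const hα.le).div_const α).integrableOn_Ioc
    refine h7.congr ?_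
    filter_upwards [ae_restrict_mem measurableSet_Ioc] with t ht
    exact (hin t ht).2.symm

set_option maxHeartbeats 1000000 in
/-- Positivity of the kernel of the fractional integral of order `α ≤ 1`. -/
theorem fractional_kernel_energy_nonneg {u : ℝ → ℝ} (hu : Continuous u) {α T : ℝ} (hα : 0 < α)
    (hα1 : α ≤ 1) (hT : 0 ≤ T) :
    0 ≤ ∫ t in (0 : ℝ)..T, u t * ∫ s in (0 : ℝ)..t, (t - s) ^ (α - 1) * u s := by
  -- At `α = 1` the weight `r^(-α)` is not integrable near `0`; there the kernel is constant, that
  -- is, the exponential kernel of rate `0`.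
  rcases hα1.eq_or_lt with rfl | hα1
  · simpa using exp_kernel_energy_nonneg hu le_rfl hT
  obtain ⟨M, hM⟩ := (isCompact_Icc (a := (0 : ℝ)) (b := T)).exists_bound_of_continuousOn
    hu.continuousOn
  have hM0 : 0 ≤ M := (norm_nonneg _).trans (hM 0 ⟨le_rfl, hT⟩)
  set ν : Measure ℝ := volume.restrict (Set.Ioc 0 T) with hν
  set ρ : Measure ℝ := volume.restrict (Set.Ioi 0) with hρ
  set Δ : Set (ℝ × ℝ) := {p | p.2 < p.1} with hΔ
  have hΔm : MeasurableSet Δ := measurableSet_lt measurable_snd measurable_fst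
  have hae : ∀ᵐ p ∂(ν.prod ν), p.1 ∈ Set.Ioc 0 T ∧ p.2 ∈ Set.Ioc 0 T := by
    rw [hν, Measure.prod_restrict]
    exact ae_restrict_mem (measurableSet_Ioc.prod measurableSet_Ioc)
  -- passing from the triangle to iterated integrals
  have hiter : ∀ k : ℝ → ℝ, Integrable (Δ.indicator fun p => u p.1 * (k (p.1 - p.2) * u p.2))
      (ν.prod ν) → ∫ p, Δ.indicator (fun p => u p.1 * (k (p.1 - p.2) * u p.2)) p ∂(ν.prod ν) =
      ∫ t in (0 : ℝ)..T, u t * ∫ s in (0 : ℝ)..t, k (t - s) * u s := by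
    intro k hk
    rw [integral_prod _ hk, intervalIntegral.integral_of_le hT]
    refine setIntegral_congr_fun measurableSet_Ioc fun t ht => ?_
    rw [intervalIntegral.integral_of_le ht.1.le, ← integral_const_mul]
    have h1 : ∀ s, Δ.indicator (fun p => u p.1 * (k (p.1 - p.2) * u p.2)) (t, s) =
        (Set.Iio t).indicator (fun s => u t * (k (t - s) * u s)) s := fun s => by
      by_cases h : s < t <;> simp [Set.indicator, hΔ, h]
    simp only [h1]
    rw [integral_indicator measurableSet_Iio, hν, Measure.restrict_restrict measurableSet_Iio,
      integral_Ioc_eq_integral_Ioo]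
    congr 2
    ext s
    simp only [Set.mem_inter_iff, Set.mem_Iio, Set.mem_Ioc, Set.mem_Ioo]
    constructor
    · rintro ⟨h2, h3, -⟩
      exact ⟨h3, h2⟩
    · rintro ⟨h2, h3⟩
      exact ⟨h3, h2, h3.le.trans ht.2⟩
  have hkm : ∀ k : ℝ → ℝ, Measurable k → AEStronglyMeasurable
      (Δ.indicator fun p : ℝ × ℝ => u p.1 * (k (p.1 - p.2) * u p.2)) (ν.prod ν) := by
    intro k hk
    refine (Measurable.indicator ?_ hΔm).aestronglyMeasurable
    have := hu.measurable
    fun_prop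
  have hsing : Integrable (Δ.indicator fun p : ℝ × ℝ => (p.1 - p.2) ^ (α - 1)) (ν.prod ν) :=
    integrable_sub_rpow_triangle hα T
  set G : ℝ × ℝ → ℝ → ℝ := fun p r => Δ.indicator
    (fun p : ℝ × ℝ => u p.1 * (r ^ (-α) * Real.exp (-(r * (p.1 - p.2))) * u p.2)) p with hG
  have hGm : Measurable (Function.uncurry G) := by
    have e : Function.uncurry G = (Δ ×ˢ (Set.univ : Set ℝ)).indicator (fun q : (ℝ × ℝ) × ℝ =>
        u q.1.1 * (q.2 ^ (-α) * Real.exp (-(q.2 * (q.1.1 - q.1.2))) * u q.1.2)) := by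
      ext ⟨p, r⟩
      by_cases h : p ∈ Δ <;> simp [hG, Function.uncurry, Set.indicator, h]
    rw [e]
    refine Measurable.indicator ?_ (hΔm.prod MeasurableSet.univ)
    have := hu.measurable
    fun_prop
  have hGp : ∀ p : ℝ × ℝ, Integrable (G p) ρ ∧ ∫ r, G p r ∂ρ = Real.Gamma (1 - α) *
      Δ.indicator (fun p => u p.1 * ((p.1 - p.2) ^ (α - 1) * u p.2)) p := by
    intro p
    by_cases hp : p ∈ Δ
    · obtain ⟨h1, h2⟩ := rpow_eq_integral_exp hα1 (p.1 - p.2) (sub_pos.2 hp)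
      have h3 : G p = fun r => (u p.1 * u p.2) * (r ^ (-α) * Real.exp (-(r * (p.1 - p.2)))) := by
        ext r
        simp only [hG, Set.indicator, hp, if_true]
        ring
      rw [h3]
      refine ⟨h1.const_mul _, ?_⟩
      rw [integral_const_mul, h2]
      simp only [Set.indicator, hp, if_true]
      ring
    · have h3 : G p = fun r => 0 := by
        ext r
        simp only [hG, Set.indicator, hp, if_false]
      rw [h3]
      simp [hp]
  have hGnorm : ∀ p : ℝ × ℝ, p.1 ∈ Set.Ioc 0 T ∧ p.2 ∈ Set.Ioc 0 T → ∫ r, ‖G p r‖ ∂ρ ≤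
      (M * M * Real.Gamma (1 - α)) * Δ.indicator (fun p : ℝ × ℝ => (p.1 - p.2) ^ (α - 1)) p := by
    intro p hpT
    by_cases hp : p ∈ Δ
    · obtain ⟨h1, h2⟩ := rpow_eq_integral_exp hα1 (p.1 - p.2) (sub_pos.2 hp)
      have h3 : ∫ r, ‖G p r‖ ∂ρ = (‖u p.1‖ * ‖u p.2‖) * ((p.1 - p.2) ^ (α - 1) *
          Real.Gamma (1 - α)) := by
        rw [← h2, ← integral_const_mul]
        refine setIntegral_congr_fun measurableSet_Ioi fun r hr => ?_
        simp only [hG, Set.indicator, hp, if_true, norm_mul, Real.norm_of_nonneg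
          (Real.rpow_nonneg (le_of_lt hr) _), Real.norm_of_nonneg (Real.exp_pos _).le]
        ring
      rw [h3]
      simp only [Set.indicator, hp, if_true]
      have h4 := hM p.1 ⟨hpT.1.1.le, hpT.1.2⟩
      have h5 := hM p.2 ⟨hpT.2.1.le, hpT.2.2⟩
      have h6 : 0 ≤ (p.1 - p.2) ^ (α - 1) * Real.Gamma (1 - α) :=
        mul_nonneg (Real.rpow_nonneg (sub_pos.2 hp).le _) (Real.Gamma_pos_of_pos (by linarith)).le
      calc _ ≤ (M * M) * ((p.1 - p.2) ^ (α - 1) * Real.Gamma (1 - α)) := by gcongr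
        _ = _ := by ring
    · simp [hG, hp]
  have hGint : Integrable (Function.uncurry G) ((ν.prod ν).prod ρ) := by
    rw [integrable_prod_iff hGm.aestronglyMeasurable]
    refine ⟨Filter.Eventually.of_forall fun p => (hGp p).1, ?_⟩
    refine (hsing.const_mul (M * M * Real.Gamma (1 - α))).mono' ?_ ?_
    · exact hGm.norm.aestronglyMeasurable.integral_prod_right'
    · filter_upwards [hae] with p hp
      rw [Real.norm_of_nonneg (integral_nonneg fun r => norm_nonneg _)]
      exact hGnorm p hp
  -- Integrating `G` over `r` first gives the fractional energy times `Γ(1-α)`; integrating over the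
  -- triangle first gives exponential energies, which are nonnegative.
  have hswap := integral_integral_swap hGint
  have hpos : 0 ≤ ∫ r, ∫ p, G p r ∂(ν.prod ν) ∂ρ := by
    refine setIntegral_nonneg measurableSet_Ioi fun r hr => ?_
    have hr' : 0 < r := hr
    have h1 : ∀ p, G p r = r ^ (-α) * Δ.indicator
        (fun p => u p.1 * (Real.exp (-(r * (p.1 - p.2))) * u p.2)) p := by
      intro p
      by_cases hp : p ∈ Δ
      · simp only [hG, Set.indicator, hp, if_true]
        ring
      · simp [hG, hp]
    simp only [h1]
    rw [integral_const_mul]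
    refine mul_nonneg (Real.rpow_nonneg hr'.le _) ?_
    rw [hiter (fun x => Real.exp (-(r * x)))]
    · exact exp_kernel_energy_nonneg hu hr'.le hT
    · refine Integrable.of_bound (hkm (fun x => Real.exp (-(r * x))) (by fun_prop)) (M * (1 * M)) ?_
      filter_upwards [hae] with p hpT
      by_cases hp : p ∈ Δ
      · simp only [Set.indicator, hp, if_true, norm_mul, Real.norm_of_nonneg (Real.exp_pos _).le]
        have h4 := hM p.1 ⟨hpT.1.1.le, hpT.1.2⟩
        have h5 := hM p.2 ⟨hpT.2.1.le, hpT.2.2⟩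
        have h6 : Real.exp (-(r * (p.1 - p.2))) ≤ 1 := by
          rw [Real.exp_le_one_iff, neg_nonpos]
          exact mul_nonneg hr'.le (sub_pos.2 hp).le
        gcongr
      · simp only [Set.indicator, hp, if_false, norm_zero]
        positivity
  rw [← hswap] at hpos
  simp only [(hGp _).2] at hpos
  rw [integral_const_mul, hiter (fun x => x ^ (α - 1))] at hpos
  · exact nonneg_of_mul_nonneg_right hpos (Real.Gamma_pos_of_pos (by linarith))
  · have hm := hkm (fun x => x ^ (α - 1)) (by fun_prop)
    refine (hsing.const_mul (M * M)).mono' hm ?_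
    filter_upwards [hae] with p hpT
    by_cases hp : p ∈ Δ
    · have h4 := hM p.1 ⟨hpT.1.1.le, hpT.1.2⟩
      have h5 := hM p.2 ⟨hpT.2.1.le, hpT.2.2⟩
      have h6 := Real.rpow_nonneg (sub_pos.2 hp).le (α - 1)
      simp only [Set.indicator, hp, if_true, norm_mul, Real.norm_of_nonneg h6]
      calc _ ≤ M * ((p.1 - p.2) ^ (α - 1) * M) := by gcongr
        _ = _ := by ring
    · simp [hp]

/-- The `L₂` bound for the relaxation function, uniform in `λ`. -/
theorem integral_mlRelax_sq_le {α lam T : ℝ} (hα : 0 < α) (hα1 : α ≤ 1) (hl : 0 ≤ lam)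
    (hT : 0 ≤ T) : ∫ t in (0 : ℝ)..T, mlRelax α lam t ^ 2 ≤ T := by
  have hu := continuous_mlRelax hα lam
  set u := mlRelax α lam
  have hE := fractional_kernel_energy_nonneg hu hα hα1 hT
  have hc : 0 ≤ lam * (Real.Gamma α)⁻¹ := mul_nonneg hl (inv_nonneg.2 (Real.Gamma_pos_of_pos hα).le)
  -- Multiply the relaxation equation by `u` and integrate; the right side is a nonnegative multiple
  -- of the fractional energy.
  have h1 : ∫ t in (0 : ℝ)..T, u t * (1 - u t) = lam * (Real.Gamma α)⁻¹ *
      ∫ t in (0 : ℝ)..T, u t * ∫ s in (0 : ℝ)..t, (t - s) ^ (α - 1) * u s := by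
    rw [← intervalIntegral.integral_const_mul]
    refine intervalIntegral.integral_congr fun t ht => ?_
    rw [Set.uIcc_of_le hT] at ht
    rw [← mlRelax_integral_eq hα lam ht.1]
    ring
  have h2 : 0 ≤ ∫ t in (0 : ℝ)..T, u t * (1 - u t) := h1 ▸ mul_nonneg hc hE
  -- The integrand on the left equals `1 - (u - 1)²`.
  have h3 : ∫ t in (0 : ℝ)..T, (2 * (u t * (1 - u t)) + u t ^ 2) ≤ ∫ t in (0 : ℝ)..T, (1 : ℝ) := by
    refine intervalIntegral.integral_mono_on hT ?_ (by simp) fun t _ => ?_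
    · exact (by fun_prop : Continuous fun t => 2 * (u t * (1 - u t)) + u t ^ 2).intervalIntegrable _ _
    · nlinarith [sq_nonneg (u t - 1)]
  rw [intervalIntegral.integral_add, intervalIntegral.integral_const_mul] at h3
  · simp at h3
    linarith
  · exact (by fun_prop : Continuous fun t => 2 * (u t * (1 - u t))).intervalIntegrable _ _
  · exact (by fun_prop : Continuous fun t => u t ^ 2).intervalIntegrable _ _

end MittagLeffler

/-! ### Wiener integrals as a bounded operator on `L₂((0, ∞))` -/

noncomputable section WienerIsometry

open scoped NNReal

/-- Two families with proportional Gram matrices have proportional norms of real linear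
combinations. -/
theorem norm_sq_linearCombination_of_gram {ι E F : Type*} [NormedAddCommGroup E]
    [InnerProductSpace ℝ E] [NormedAddCommGroup F] [InnerProductSpace ℂ F] [Module ℝ F]
    [IsScalarTower ℝ ℂ F] {v : ι → E} {b : ι → F} {A : ℝ}
    (h : ∀ i j, (inner ℂ (b i) (b j)).re = A * inner ℝ (v i) (v j)) (x : ι →₀ ℝ) :
    ‖Finsupp.linearCombination ℝ b x‖ ^ 2 = A * ‖Finsupp.linearCombination ℝ v x‖ ^ 2 := by
  have e1 : ‖Finsupp.linearCombination ℝ b x‖ ^ 2 =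
      (inner ℂ (Finsupp.linearCombination ℝ b x) (Finsupp.linearCombination ℝ b x)).re :=
    (inner_self_eq_norm_sq (𝕜 := ℂ) _).symm
  have sm : ∀ (r : ℝ) (y : F), r • y = (r : ℂ) • y := fun r y => by
    rw [← one_smul ℂ y, ← smul_assoc, Complex.real_smul, mul_one, one_smul]
  rw [e1, ← real_inner_self_eq_norm_sq]
  simp only [Finsupp.linearCombination_apply, Finsupp.sum, sum_inner, inner_sum, sm (_ : ℝ) (b _), inner_smul_left,
    inner_smul_right, Complex.conj_ofReal, Complex.re_sum, Complex.re_ofReal_mul, h,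
    Finset.mul_sum, RCLike.conj_to_real]
  refine Finset.sum_congr rfl fun i _ => Finset.sum_congr rfl fun j _ => ?_
  ring

/-- Real `L₂((0, ∞))`. -/
abbrev L2Time : Type := Lp ℝ 2 ((volume : Measure ℝ).restrict (Set.Ioi 0))

theorem restrict_Ioi_Ioc_ne_top (t : ℝ) :
    ((volume : Measure ℝ).restrict (Set.Ioi 0)) (Set.Ioc 0 t) ≠ ⊤ := by
  refine ((Measure.restrict_apply_le _ _).trans_lt ?_).ne
  simp

/-- The class of `1_{(0, t]}` in `L₂((0, ∞))`. -/
def timeIndicator (t : ℝ≥0) : L2Time :=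
  indicatorConstLp 2 measurableSet_Ioc (restrict_Ioi_Ioc_ne_top t) (1 : ℝ)

theorem inner_timeIndicator_left (t : ℝ≥0) (h : L2Time) :
    inner ℝ (timeIndicator t) h = ∫ s in Set.Ioc 0 (t : ℝ), h s := by
  rw [timeIndicator, L2.inner_indicatorConstLp_one, Measure.restrict_restrict measurableSet_Ioc,
    Set.inter_eq_left.2 Set.Ioc_subset_Ioi_self]

theorem inner_timeIndicator (s t : ℝ≥0) :
    inner ℝ (timeIndicator s) (timeIndicator t) = ((min s t : ℝ≥0) : ℝ) := by
  rw [inner_timeIndicator_left]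
  have : ∀ᵐ r ∂(volume.restrict (Set.Ioc 0 (s : ℝ))),
      timeIndicator t r = (Set.Ioc 0 (t : ℝ)).indicator (fun _ => (1 : ℝ)) r := by
    refine ae_mono (Measure.restrict_mono_set _ (Set.Ioc_subset_Ioi_self)) ?_
    exact indicatorConstLp_coeFn
  rw [integral_congr_ae this, setIntegral_indicator measurableSet_Ioc, Set.Ioc_inter_Ioc]
  simp [NNReal.coe_min]

/-- An element orthogonal to all `1_{(0,t]}` has zero primitive, so it vanishes almost everywhere by
Lebesgue differentiation. -/
theorem dense_span_timeIndicator :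
    DenseRange (Finsupp.linearCombination ℝ timeIndicator) := by
  have h : (Submodule.span ℝ (Set.range timeIndicator)).topologicalClosure = ⊤ := by
    rw [Submodule.topologicalClosure_eq_top_iff, Submodule.eq_bot_iff]
    intro h hh
    have h0 : ∀ t : ℝ≥0, ∫ s in Set.Ioc 0 (t : ℝ), h s = 0 := fun t => by
      rw [← inner_timeIndicator_left]
      exact (Submodule.mem_orthogonal _ _).1 hh _ (Submodule.subset_span ⟨t, rfl⟩)
    have hint : ∀ t : ℝ, 0 ≤ t → IntervalIntegrable h volume 0 t := fun t ht => by
      rw [intervalIntegrable_iff_integrableOn_Ioc_of_le ht]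
      have : IsFiniteMeasure (volume.restrict (Set.Ioc 0 t)) := ⟨by simp⟩
      exact ((Lp.memLp h).mono_measure
        (Measure.restrict_mono_set _ Set.Ioc_subset_Ioi_self)).integrable (by norm_num)
    have hz : ∀ n : ℕ, ∀ᵐ x, x ∈ Set.Ioo (0 : ℝ) n → h x = 0 := fun n => by
      filter_upwards [(hint n n.cast_nonneg).ae_hasDerivAt_integral] with x hx hxn
      have hI : Set.uIcc (0 : ℝ) n = Set.Icc (0 : ℝ) n := Set.uIcc_of_le n.cast_nonneg
      have hd := hx (by rw [hI]; exact Set.Ioo_subset_Icc_self hxn) 0 (by simp)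
      refine hd.unique ((hasDerivAt_const x (0 : ℝ)).congr_of_eventuallyEq ?_)
      filter_upwards [lt_mem_nhds hxn.1] with t ht
      rw [intervalIntegral.integral_of_le ht.le]
      exact h0 ⟨t, ht.le⟩
    refine (Lp.eq_zero_iff_ae_eq_zero).2 ?_
    rw [Filter.EventuallyEq, ae_restrict_iff' measurableSet_Ioi]
    filter_upwards [ae_all_iff.2 hz] with x hx hx0
    obtain ⟨n, hn⟩ := exists_nat_gt x
    exact hx n ⟨hx0, hn⟩
  rw [DenseRange, ← LinearMap.coe_range, Finsupp.range_linearCombination]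
  exact (Submodule.dense_iff_topologicalClosure_eq_top).2 h

variable {Ω : Type*} [MeasurableSpace Ω]

/-- The process `B` on `[0, ∞)` is square integrable with the real covariance
`re E (conj (B s) B t) = A min(s, t)` of a Brownian motion of variance `A`. -/
structure HasBrownianCovariance (P : Measure Ω) (A : ℝ) (B : ℝ → Ω → ℂ) : Prop where
  memLp : ∀ s, 0 ≤ s → MemLp (B s) 2 P
  covariance : ∀ s t, 0 ≤ s → s ≤ t → ∫ ω, (starRingEnd ℂ (B s ω) * B t ω).re ∂P = A * s

namespace HasBrownianCovariance

variable {P : Measure Ω} {A : ℝ} {B : ℝ → Ω → ℂ}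

/-- The class of `B t` in `L₂(Ω)`. -/
def toL2 (hB : HasBrownianCovariance P A B) (t : ℝ≥0) : Lp ℂ 2 P := (hB.memLp t t.2).toLp

theorem coeFn_toL2 (hB : HasBrownianCovariance P A B) (t : ℝ≥0) : hB.toL2 t =ᵐ[P] B t :=
  (hB.memLp t t.2).coeFn_toLp

theorem re_inner_toL2 (hB : HasBrownianCovariance P A B) (s t : ℝ≥0) :
    (inner ℂ (hB.toL2 s) (hB.toL2 t)).re = A * inner ℝ (timeIndicator s) (timeIndicator t) := by
  wlog hst : s ≤ t generalizing s t
  · rw [← inner_conj_symm, Complex.conj_re, this t s (le_of_not_ge hst), real_inner_comm]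
  rw [inner_timeIndicator, min_eq_left hst, ← hB.covariance s t s.2 hst, L2.inner_def]
  have hi := L2.integrable_inner (𝕜 := ℂ) (hB.toL2 s) (hB.toL2 t)
  refine (integral_re (𝕜 := ℂ) hi).symm.trans (integral_congr_ae ?_)
  filter_upwards [hB.coeFn_toL2 s, hB.coeFn_toL2 t] with ω h1 h2
  rw [h1, h2]
  simp [mul_comm]

theorem norm_sq_linearCombination (hB : HasBrownianCovariance P A B) (x : ℝ≥0 →₀ ℝ) :
    ‖Finsupp.linearCombination ℝ hB.toL2 x‖ ^ 2 =
      A * ‖Finsupp.linearCombination ℝ timeIndicator x‖ ^ 2 :=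
  norm_sq_linearCombination_of_gram hB.re_inner_toL2 x

theorem norm_linearCombination_le (hB : HasBrownianCovariance P A B) (x : ℝ≥0 →₀ ℝ) :
    ‖Finsupp.linearCombination ℝ hB.toL2 x‖ ≤
      √A * ‖Finsupp.linearCombination ℝ timeIndicator x‖ := by
  rw [← Real.sqrt_sq (norm_nonneg (Finsupp.linearCombination ℝ hB.toL2 x)),
    hB.norm_sq_linearCombination, Real.sqrt_mul' _ (sq_nonneg _), Real.sqrt_sq (norm_nonneg _)]

/-- The Wiener integral `g ↦ ∫ g dB` on `L₂((0, ∞))`. -/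
def wiener (hB : HasBrownianCovariance P A B) : L2Time →L[ℝ] Lp ℂ 2 P :=
  (Finsupp.linearCombination ℝ hB.toL2).extendOfNorm (Finsupp.linearCombination ℝ timeIndicator)

theorem norm_wiener_le (hB : HasBrownianCovariance P A B) (g : L2Time) :
    ‖hB.wiener g‖ ≤ √A * ‖g‖ :=
  LinearMap.norm_extendOfNorm_apply_le dense_span_timeIndicator _ hB.norm_linearCombination_le g

theorem wiener_timeIndicator (hB : HasBrownianCovariance P A B) (t : ℝ≥0) :
    hB.wiener (timeIndicator t) = hB.toL2 t := by
  have := LinearMap.extendOfNorm_eq (f := Finsupp.linearCombination ℝ hB.toL2)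
    dense_span_timeIndicator ⟨_, hB.norm_linearCombination_le⟩ (Finsupp.single t 1)
  simpa [wiener] using this

end HasBrownianCovariance

/-- The step function `stepFun n p c`, as an element of `L₂((0, ∞))`. -/
def stepTime (n : ℕ) (p : ℕ → ℝ≥0) (c : ℕ → ℝ) : L2Time :=
  ∑ i ∈ Finset.range n, c i • (timeIndicator (p (i + 1)) - timeIndicator (p i))

theorem stepTime_ae_eq (n : ℕ) {p : ℕ → ℝ≥0} (hp : Monotone p) (c : ℕ → ℝ) :
    stepTime n p c =ᵐ[volume.restrict (Set.Ioi 0)] stepFun n (fun i => (p i : ℝ)) c := by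
  have h1 := Lp.coeFn_finsetSum (Finset.range n)
    (fun i => c i • (timeIndicator (p (i + 1)) - timeIndicator (p i)))
  have h2 : ∀ᵐ s ∂(volume.restrict (Set.Ioi (0 : ℝ))), ∀ i,
      (c i • (timeIndicator (p (i + 1)) - timeIndicator (p i)) : L2Time) s =
        (Set.Ioc (p i : ℝ) (p (i + 1))).indicator (fun _ => c i) s := by
    refine ae_all_iff.2 fun i => ?_
    have ht : ∀ t : ℝ≥0, ∀ᵐ s ∂(volume.restrict (Set.Ioi (0 : ℝ))), timeIndicator t s =
      (Set.Ioc 0 (t : ℝ)).indicator (fun _ => (1 : ℝ)) s := fun t => indicatorConstLp_coeFn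
    filter_upwards [Lp.coeFn_smul (c i) (timeIndicator (p (i + 1)) - timeIndicator (p i)),
      Lp.coeFn_sub (timeIndicator (p (i + 1))) (timeIndicator (p i)), ht (p (i + 1)), ht (p i),
      ae_restrict_mem measurableSet_Ioi] with s e1 e2 e3 e4 hs
    rw [e1, Pi.smul_apply, e2, Pi.sub_apply, e3, e4]
    have hs' : 0 < s := hs
    have hle : (p i : ℝ) ≤ p (i + 1) := hp (Nat.le_succ i)
    simp only [Set.indicator_apply, Set.mem_Ioc, hs', true_and]
    by_cases h : s ≤ p i
    · simp [h, h.trans hle, not_lt.2 h]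
    · simp [h, lt_of_not_ge h]
  filter_upwards [h1, h2] with s e1 e2
  rw [stepTime, e1, stepFun, Finset.sum_apply]
  exact Finset.sum_congr rfl fun i _ => e2 i

theorem stepFun_eq_of_mem {n : ℕ} {p c : ℕ → ℝ} (hp : Monotone p) {i : ℕ} (hi : i < n) {s : ℝ}
    (hs : s ∈ Set.Ioc (p i) (p (i + 1))) : stepFun n p c s = c i := by
  rw [stepFun, Finset.sum_eq_single_of_mem i (Finset.mem_range.2 hi), Set.indicator_of_mem hs]
  intro j _ hj
  refine Set.indicator_of_notMem (fun hs' => ?_) _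
  exact Set.disjoint_left.1 (hp.pairwise_disjoint_on_Ioc_succ hj) hs' hs

theorem stepFun_eq_zero_of_notMem {n : ℕ} {p c : ℕ → ℝ} {a b : ℝ} (hp : ∀ i, p i ∈ Set.Icc a b)
    {s : ℝ} (hs : s ∉ Set.Ioc a b) : stepFun n p c s = 0 := by
  refine Finset.sum_eq_zero fun i _ => Set.indicator_of_notMem (fun hs' => hs ?_) _
  exact ⟨(hp i).1.trans_lt hs'.1, hs'.2.trans (hp (i + 1)).2⟩

theorem memLp_indicator_Ioc {T : ℝ} {g : ℝ → ℝ} (hg : MemLp g 2 (volume.restrict (Set.Icc 0 T))) :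
    MemLp ((Set.Ioc 0 T).indicator g) 2 (volume.restrict (Set.Ioi 0)) := by
  rw [memLp_indicator_iff_restrict measurableSet_Ioc, Measure.restrict_restrict measurableSet_Ioc,
    Set.inter_eq_left.2 Set.Ioc_subset_Ioi_self]
  exact hg.mono_measure (Measure.restrict_mono_set _ Set.Ioc_subset_Icc_self)

/-- The class of `1_{(0, T]} g` in `L₂((0, ∞))`. -/
def timeKernel (T : ℝ) (g : ℝ → ℝ) (hg : MemLp g 2 (volume.restrict (Set.Icc 0 T))) : L2Time :=
  (memLp_indicator_Ioc hg).toLp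

/-- Both functions vanish off `(0, T]` and the endpoint `0` is null, so closeness on `[0, T]`, as
used in `IsWienerIntegral`, is distance in `L2Time`. -/
theorem enorm_stepTime_sub_timeKernel (n : ℕ) {p : ℕ → ℝ≥0} (hp : Monotone p) (c : ℕ → ℝ) {T : ℝ}
    (hpT : ∀ i, (p i : ℝ) ∈ Set.Icc 0 T) {g : ℝ → ℝ}
    (hg : MemLp g 2 (volume.restrict (Set.Icc 0 T))) :
    ‖stepTime n p c - timeKernel T g hg‖ₑ =
      eLpNorm (fun s => stepFun n (fun i => (p i : ℝ)) c s - g s) 2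
        (volume.restrict (Set.Icc 0 T)) := by
  have h1 : (stepTime n p c - timeKernel T g hg : L2Time) =ᵐ[volume.restrict (Set.Ioi 0)]
      (Set.Ioc 0 T).indicator (fun s => stepFun n (fun i => (p i : ℝ)) c s - g s) := by
    filter_upwards [Lp.coeFn_sub (stepTime n p c) (timeKernel T g hg), stepTime_ae_eq n hp c,
      (memLp_indicator_Ioc hg).coeFn_toLp] with s e1 e2 e3
    rw [e1, Pi.sub_apply, e2, timeKernel, e3]
    by_cases hs : s ∈ Set.Ioc 0 T
    · simp [hs]
    · rw [Set.indicator_of_notMem hs, Set.indicator_of_notMem hs, stepFun_eq_zero_of_notMem hpT hs,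
        sub_zero]
  rw [Lp.enorm_def, eLpNorm_congr_ae h1, eLpNorm_indicator_eq_eLpNorm_restrict measurableSet_Ioc,
    Measure.restrict_restrict measurableSet_Ioc, Set.inter_eq_left.2 Set.Ioc_subset_Ioi_self,
    Measure.restrict_congr_set Ioc_ae_eq_Icc]

/-- Continuous functions are approximated by step functions in `L₂([0, T])`. -/
theorem exists_stepFun_eLpNorm_lt {g : ℝ → ℝ} (hg : Continuous g) {T : ℝ} (hT : 0 ≤ T)
    {ε : ENNReal} (hε : 0 < ε) : ∃ (n : ℕ) (p : ℕ → ℝ≥0) (c : ℕ → ℝ), Monotone p ∧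
      (∀ i, (p i : ℝ) ∈ Set.Icc 0 T) ∧
      eLpNorm (fun s => stepFun n (fun i => (p i : ℝ)) c s - g s) 2
        (volume.restrict (Set.Icc 0 T)) < ε := by
  obtain ⟨C, hC0, hC⟩ : ∃ C : ℝ, 0 < C ∧
      (volume.restrict (Set.Icc 0 T)) Set.univ ^ (2 : ENNReal).toReal⁻¹ * ENNReal.ofReal C < ε := by
    have h1 : Filter.Tendsto (fun C : ℝ =>
        (volume.restrict (Set.Icc 0 T)) Set.univ ^ (2 : ENNReal).toReal⁻¹ * ENNReal.ofReal C)
        (nhdsWithin 0 (Set.Ioi 0)) (nhds ((volume.restrict (Set.Icc 0 T)) Set.univ ^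
          (2 : ENNReal).toReal⁻¹ * ENNReal.ofReal 0)) := by
      refine ENNReal.Tendsto.const_mul (ENNReal.tendsto_ofReal
        (tendsto_nhdsWithin_of_tendsto_nhds Filter.tendsto_id)) (Or.inr ?_)
      exact ENNReal.rpow_ne_top_of_nonneg (by simp) (by simp)
    rw [ENNReal.ofReal_zero, mul_zero] at h1
    obtain ⟨C, h2, h3⟩ := ((h1.eventually (gt_mem_nhds hε)).and self_mem_nhdsWithin).exists
    exact ⟨C, h3, h2⟩
  obtain ⟨δ, hδ, hgδ⟩ := Metric.uniformContinuousOn_iff.1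
    (isCompact_Icc.uniformContinuousOn_of_continuous hg.continuousOn) C hC0
  obtain ⟨n, hn⟩ := exists_nat_gt (T / δ)
  have hn0 : (0 : ℝ) < n := (div_nonneg hT hδ.le).trans_lt hn
  have hTn : T / n < δ := by rw [div_lt_iff₀ hn0]; rwa [div_lt_iff₀ hδ, mul_comm] at hn
  -- The uniform partition, frozen at `T` from index `n` on: all points of the sequence must lie in
  -- `[0, T]`.
  obtain ⟨q, hq⟩ : ∃ q : ℕ → ℝ, q = fun i : ℕ => T * (min i n : ℕ) / n := ⟨_, rfl⟩
  have hpT : ∀ i : ℕ, q i ∈ Set.Icc 0 T := fun i => by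
    rw [hq]
    refine ⟨by positivity, ?_⟩
    rw [div_le_iff₀ hn0]
    gcongr
    exact min_le_right _ _
  have hpm : Monotone q := by
    intro i j hij
    have : min i n ≤ min j n := min_le_min_right _ hij
    simp only [hq]
    gcongr
  lift q to ℕ → ℝ≥0 using fun i => (hpT i).1
  have hq' : ∀ i, (q i : ℝ) = T * (min i n : ℕ) / n := fun i => congrFun hq i
  refine ⟨n, q, fun i => g (q (i + 1)), hpm, hpT, ?_⟩
  refine (eLpNorm_le_of_ae_bound (C := C) ?_).trans_lt hC
  rw [Measure.restrict_congr_set Ioc_ae_eq_Icc.symm]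
  filter_upwards [ae_restrict_mem measurableSet_Ioc] with s hs
  have hTpos : 0 < T := hs.1.trans_le hs.2
  -- The ceiling is the index of the right endpoint of the half-open cell containing `s`; it is
  -- positive because `s = 0` has been discarded as a null set.
  set k := ⌈s * n / T⌉₊ with hk
  have hk0 : 0 < k := Nat.ceil_pos.2 (by have := hs.1; positivity)
  have hkn : k ≤ n := Nat.ceil_le.2 (by
    rw [div_le_iff₀ hTpos, mul_comm]
    exact mul_le_mul_of_nonneg_left hs.2 hn0.le)
  obtain ⟨i, hi⟩ : ∃ i, k = i + 1 := ⟨k - 1, by lia⟩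
  have hin : i < n := by lia
  have hup : s ≤ q (i + 1) := by
    rw [hq', ← hi, min_eq_left hkn, le_div_iff₀ hn0, mul_comm T, ← div_le_iff₀ hTpos]
    exact Nat.le_ceil _
  have hlow : q i < s := by
    rw [hq', min_eq_left hin.le, div_lt_iff₀ hn0, mul_comm T, ← lt_div_iff₀ hTpos]
    exact Nat.lt_ceil.1 (by lia)
  rw [stepFun_eq_of_mem (p := fun i => (q i : ℝ)) (fun i j hij => hpm hij) hin ⟨hlow, hup⟩]
  have hd := hgδ _ (hpT (i + 1)) s (Set.Ioc_subset_Icc_self hs) ?_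
  · exact hd.le
  · rw [Real.dist_eq, abs_of_nonneg (sub_nonneg.2 hup)]
    rw [hq', min_eq_left hin.le] at hlow
    rw [hq', min_eq_left (by lia : i + 1 ≤ n)]
    have : T * ((i + 1 : ℕ) : ℝ) / n = T * i / n + T / n := by push_cast; ring
    linarith

namespace HasBrownianCovariance

variable {P : Measure Ω} {A : ℝ} {B : ℝ → Ω → ℂ}

theorem wiener_stepTime (hB : HasBrownianCovariance P A B) (n : ℕ) (p : ℕ → ℝ≥0) (c : ℕ → ℝ) :
    hB.wiener (stepTime n p c) =ᵐ[P] stepIntegral B n (fun i => (p i : ℝ)) c := by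
  have h0 : hB.wiener (stepTime n p c) =
      ∑ i ∈ Finset.range n, c i • (hB.toL2 (p (i + 1)) - hB.toL2 (p i)) := by
    simp only [stepTime, map_sum, map_smul, map_sub, wiener_timeIndicator]
  rw [h0]
  have h2 : ∀ᵐ ω ∂P, ∀ i, (c i • (hB.toL2 (p (i + 1)) - hB.toL2 (p i)) : Lp ℂ 2 P) ω =
      (c i : ℂ) * (B (p (i + 1)) ω - B (p i) ω) := by
    refine ae_all_iff.2 fun i => ?_
    filter_upwards [Lp.coeFn_smul (c i) (hB.toL2 (p (i + 1)) - hB.toL2 (p i)),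
      Lp.coeFn_sub (hB.toL2 (p (i + 1))) (hB.toL2 (p i)),
      hB.coeFn_toL2 (p (i + 1)), hB.coeFn_toL2 (p i)] with ω e1 e2 e3 e4
    rw [e1, Pi.smul_apply, e2, Pi.sub_apply, e3, e4, Complex.real_smul]
  filter_upwards [Lp.coeFn_finsetSum (Finset.range n)
    (fun i => c i • (hB.toL2 (p (i + 1)) - hB.toL2 (p i))), h2] with ω e1 e2
  rw [e1, Finset.sum_apply, stepIntegral]
  exact Finset.sum_congr rfl fun i _ => e2 i

theorem enorm_wiener_le (hB : HasBrownianCovariance P A B) (g : L2Time) :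
    ‖hB.wiener g‖ₑ ≤ ENNReal.ofReal √A * ‖g‖ₑ := by
  rw [← ofReal_norm, ← ofReal_norm, ← ENNReal.ofReal_mul (Real.sqrt_nonneg _)]
  exact ENNReal.ofReal_le_ofReal (hB.norm_wiener_le g)

theorem eLpNorm_stepIntegral_sub (hB : HasBrownianCovariance P A B) (n : ℕ) (p : ℕ → ℝ≥0)
    (c : ℕ → ℝ) (X : Lp ℂ 2 P) :
    eLpNorm (fun ω => stepIntegral B n (fun i => (p i : ℝ)) c ω - X ω) 2 P =
      ‖hB.wiener (stepTime n p c) - X‖ₑ := by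
  rw [Lp.enorm_def]
  refine eLpNorm_congr_ae ?_
  filter_upwards [Lp.coeFn_sub (hB.wiener (stepTime n p c)) X, hB.wiener_stepTime n p c]
    with ω e1 e2
  rw [e1, Pi.sub_apply, e2]

theorem isWienerIntegral_wiener (hB : HasBrownianCovariance P A B) {g : ℝ → ℝ} (hg : Continuous g)
    {T : ℝ} (hT : 0 ≤ T) (hg' : MemLp g 2 (volume.restrict (Set.Icc 0 T))) :
    IsWienerIntegral P B 0 T g (hB.wiener (timeKernel T g hg')) := by
  refine ⟨hg', fun ε hε => ?_⟩
  -- Adding `1` keeps the divisor nonzero when `A = 0`.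
  have hK : ENNReal.ofReal √A + 1 ≠ ⊤ := by simp
  have hK0 : ENNReal.ofReal √A + 1 ≠ 0 := by simp
  obtain ⟨n, p, c, hp, hpT, h⟩ := exists_stepFun_eLpNorm_lt hg hT
    (lt_min hε (ENNReal.div_pos hε.ne' hK))
  refine ⟨n, fun i => p i, c, hp, hpT, h.trans_le (min_le_left _ _), ?_⟩
  rw [hB.eLpNorm_stepIntegral_sub, ← map_sub]
  rw [← enorm_stepTime_sub_timeKernel n hp c hpT hg'] at h
  have h2 := h.trans_le (min_le_right _ _)
  rw [ENNReal.lt_div_iff_mul_lt (Or.inl hK0) (Or.inl hK), mul_comm] at h2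
  refine ((hB.enorm_wiener_le _).trans ?_).trans_lt h2
  gcongr
  exact le_self_add

/-- The same step functions approximate `g` and have integrals close to `X`; boundedness of `wiener`
then forces `X` to be its value. This uniqueness makes the arbitrary choice in `wienerIntegral`
irrelevant. -/
theorem eq_wiener_of_isWienerIntegral (hB : HasBrownianCovariance P A B) {g : ℝ → ℝ} {T : ℝ}
    (hg' : MemLp g 2 (volume.restrict (Set.Icc 0 T))) {X : Lp ℂ 2 P}
    (hX : IsWienerIntegral P B 0 T g X) : X = hB.wiener (timeKernel T g hg') := by
  have hK : ENNReal.ofReal √A + 1 ≠ ⊤ := by simp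
  have hK0 : ENNReal.ofReal √A + 1 ≠ 0 := by simp
  rw [← sub_eq_zero, ← enorm_eq_zero]
  refine nonpos_iff_eq_zero.1 (le_of_forall_pos_le_add fun ε hε => ?_)
  rw [zero_add]
  obtain ⟨n, p, c, hp, hpT, h1, h2⟩ := hX.2 (ε / (ENNReal.ofReal √A + 1))
    (ENNReal.div_pos hε.ne' hK)
  lift p to ℕ → ℝ≥0 using fun i => (hpT i).1
  rw [← enorm_stepTime_sub_timeKernel n hp c hpT hg'] at h1
  rw [hB.eLpNorm_stepIntegral_sub] at h2
  have e : X - hB.wiener (timeKernel T g hg') = hB.wiener (stepTime n p c - timeKernel T g hg') -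
      (hB.wiener (stepTime n p c) - X) := by rw [map_sub]; abel
  calc ‖X - hB.wiener (timeKernel T g hg')‖ₑ
      ≤ ENNReal.ofReal √A * (ε / (ENNReal.ofReal √A + 1)) + ε / (ENNReal.ofReal √A + 1) := by
        rw [e]
        refine (enorm_sub_le).trans (add_le_add ((hB.enorm_wiener_le _).trans ?_) h2.le)
        gcongr
    _ = (ENNReal.ofReal √A + 1) * (ε / (ENNReal.ofReal √A + 1)) := by ring
    _ = ε := ENNReal.mul_div_cancel hK0 hK

theorem wienerIntegral_eq (hB : HasBrownianCovariance P A B) {g : ℝ → ℝ} (hg : Continuous g)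
    {T : ℝ} (hT : 0 ≤ T) (hg' : MemLp g 2 (volume.restrict (Set.Icc 0 T))) :
    wienerIntegral P B 0 T g = hB.wiener (timeKernel T g hg') := by
  have h : ∃ X : Lp ℂ 2 P, IsWienerIntegral P B 0 T g X :=
    ⟨_, hB.isWienerIntegral_wiener hg hT hg'⟩
  rw [wienerIntegral, dif_pos h]
  exact hB.eq_wiener_of_isWienerIntegral hg' h.choose_spec

end HasBrownianCovariance

end WienerIsometry

/-! ### Covariance of the Fourier coefficients of the noise -/

section QWiener

variable {Ω : Type*} [MeasurableSpace Ω] {P : Measure Ω} {τ : ℝ} {Q : L2R →L[ℝ] L2R}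
  {W : ℝ → Ω → L2R}

theorem memLp_of_map_eq_gaussianReal {X : Ω → ℝ} {v : NNReal} (hX : AEMeasurable X P)
    (h : P.map X = gaussianReal 0 v) : MemLp X 2 P := by
  have := memLp_id_gaussianReal' (μ := 0) (v := v) 2 (by simp)
  rw [← h, memLp_map_measure_iff aestronglyMeasurable_id hX] at this
  exact this

theorem integral_of_map_eq_gaussianReal {X : Ω → ℝ} {v : NNReal} (hX : AEMeasurable X P)
    (h : P.map X = gaussianReal 0 v) : ∫ ω, X ω ∂P = 0 := by
  rw [← integral_id_gaussianReal (μ := 0) (v := v), ← h,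
    integral_map hX (f := fun x : ℝ => x) aestronglyMeasurable_id]

theorem integral_sq_of_map_eq_gaussianReal {X : Ω → ℝ} {v : NNReal} (hX : AEMeasurable X P)
    (h : P.map X = gaussianReal 0 v) : ∫ ω, X ω ^ 2 ∂P = v := by
  have h1 := variance_fun_id_gaussianReal (μ := 0) (v := v)
  rw [variance_of_integral_eq_zero (by fun_prop) integral_id_gaussianReal, ← h,
    integral_map hX (f := fun x : ℝ => x ^ 2) (by fun_prop)] at h1
  exact h1

namespace IsQWiener

theorem aestronglyMeasurable_inner (hW : IsQWiener P τ Q W) {s t : ℝ} (hs : τ ≤ s) (ht : τ ≤ t)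
    (f : L2R) : AEStronglyMeasurable (fun ω => inner ℝ (W t ω - W s ω) f) P :=
  ((hW.aestronglyMeasurable t ht).sub (hW.aestronglyMeasurable s hs)).inner
    aestronglyMeasurable_const

theorem memLp_inner_sub (hW : IsQWiener P τ Q W) {s t : ℝ} (hs : τ ≤ s) (hst : s ≤ t)
    (f : L2R) : MemLp (fun ω => inner ℝ (W t ω - W s ω) f) 2 P :=
  memLp_of_map_eq_gaussianReal (hW.aestronglyMeasurable_inner hs (hs.trans hst) f).aemeasurable
    (hW.gaussian_increments s t hs hst f)

theorem ae_inner_sub_initial (hW : IsQWiener P τ Q W) (t : ℝ) (f : L2R) :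
    (fun ω => inner ℝ (W t ω - W τ ω) f) =ᵐ[P] fun ω => inner ℝ (W t ω) f := by
  filter_upwards [hW.initial] with ω h
  rw [h, sub_zero]

theorem memLp_inner (hW : IsQWiener P τ Q W) {t : ℝ} (ht : τ ≤ t)
    (f : L2R) : MemLp (fun ω => inner ℝ (W t ω) f) 2 P :=
  (memLp_congr_ae (hW.ae_inner_sub_initial t f)).1 (hW.memLp_inner_sub le_rfl ht f)

/-- Write `W t = W s + (W t - W s)`: the increment is centred and independent of `W s - W τ`, and `W
τ = 0` almost surely. Only the variance of `W s - W τ` remains. -/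
theorem integral_inner_mul_inner (hW : IsQWiener P τ Q W) {s t : ℝ} (hs : τ ≤ s)
    (hst : s ≤ t) (f : L2R) :
    ∫ ω, inner ℝ (W s ω) f * inner ℝ (W t ω) f ∂P = (s - τ) * inner ℝ (Q f) f := by
  have ht := hs.trans hst
  have hind : IndepFun (fun ω => inner ℝ (W s ω - W τ ω) f) (fun ω => inner ℝ (W t ω - W s ω) f)
      P := by
    let _ : MeasurableSpace L2R := borel L2R
    have : BorelSpace L2R := ⟨rfl⟩
    have h := hW.indep_increments.indepFun_sub_sub (r := ⟨τ, Set.self_mem_Ici⟩) (s := ⟨s, hs⟩)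
      (t := ⟨t, ht⟩) hs hst
    have hm : Measurable fun w : L2R => (inner ℝ w f : ℝ) :=
      (continuous_id.inner continuous_const).measurable
    exact h.comp hm hm
  have hcross : ∫ ω, inner ℝ (W s ω - W τ ω) f * inner ℝ (W t ω - W s ω) f ∂P = 0 := by
    rw [hind.integral_fun_mul_eq_mul_integral (hW.aestronglyMeasurable_inner le_rfl hs f)
      (hW.aestronglyMeasurable_inner hs ht f), integral_of_map_eq_gaussianReal
        (hW.aestronglyMeasurable_inner le_rfl hs f).aemeasurable
        (hW.gaussian_increments τ s le_rfl hs f), zero_mul]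
  have hsq := integral_sq_of_map_eq_gaussianReal
    (hW.aestronglyMeasurable_inner le_rfl hs f).aemeasurable
    (hW.gaussian_increments τ s le_rfl hs f)
  rw [Real.coe_toNNReal _ (mul_nonneg (sub_nonneg.2 hs) (by
    simpa using hW.covariance_isPositive.re_inner_nonneg_left f))] at hsq
  have h1 := hW.memLp_inner_sub le_rfl hs f
  have h2 := hW.memLp_inner_sub hs hst f
  have h3 : Integrable (fun ω => inner ℝ (W s ω - W τ ω) f * inner ℝ (W t ω - W s ω) f) P :=
    h1.integrable_mul h2
  rw [← hsq, ← add_zero (∫ ω, inner ℝ (W s ω - W τ ω) f ^ 2 ∂P), ← hcross,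
    ← integral_add h1.integrable_sq h3]
  refine integral_congr_ae ?_
  filter_upwards [hW.initial] with ω h
  simp only [h, sub_zero, inner_sub_left]
  ring

end IsQWiener

theorem inner_complexify (f : L2C) (w : L2R) :
    inner ℂ f (complexify w) =
      (inner ℝ w (rePart f) : ℝ) - Complex.I * (inner ℝ w (imPart f) : ℝ) := by
  have hc : complexify w =ᵐ[sphereMeasure] fun x => ((w x : ℝ) : ℂ) :=
    Complex.ofRealCLM.coeFn_compLp w
  have hr : rePart f =ᵐ[sphereMeasure] fun x => (f x).re := Complex.reCLM.coeFn_compLp f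
  have hi : imPart f =ᵐ[sphereMeasure] fun x => (f x).im := Complex.imCLM.coeFn_compLp f
  rw [L2.inner_def, L2.inner_def, L2.inner_def, ← integral_complex_ofReal,
    ← integral_complex_ofReal, ← integral_const_mul, ← integral_sub]
  · refine integral_congr_ae ?_
    filter_upwards [hc, hr, hi] with x h1 h2 h3
    rw [h1, h2, h3]
    apply Complex.ext <;> simp [mul_comm]
  · exact (L2.integrable_inner w (rePart f)).ofReal
  · exact ((L2.integrable_inner w (imPart f)).ofReal).const_mul _

theorem complexify_rePart_add (f : L2C) :
    complexify (rePart f) + Complex.I • complexify (imPart f) = f := by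
  refine Lp.ext ?_
  filter_upwards [Lp.coeFn_add (complexify (rePart f)) (Complex.I • complexify (imPart f)),
    Lp.coeFn_smul Complex.I (complexify (imPart f)), Complex.ofRealCLM.coeFn_compLp (rePart f),
    Complex.ofRealCLM.coeFn_compLp (imPart f), Complex.reCLM.coeFn_compLp f,
    Complex.imCLM.coeFn_compLp f] with x h1 h2 h3 h4 h5 h6
  rw [h1, Pi.add_apply, h2, Pi.smul_apply, complexify, complexify, h3, h4, rePart, imPart, h5, h6]
  apply Complex.ext <;> simp

/-- Lets the variances coming from the real and imaginary parts of a harmonic add up to `A_ℓ`. -/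
theorem norm_sq_rePart_add_imPart (f : L2C) :
    ‖rePart f‖ ^ 2 + ‖imPart f‖ ^ 2 = ‖f‖ ^ 2 := by
  have h : (inner ℂ f (complexify (rePart f) + Complex.I • complexify (imPart f))).re =
      ‖f‖ ^ 2 := by
    rw [complexify_rePart_add]
    exact inner_self_eq_norm_sq (𝕜 := ℂ) f
  rw [← h, inner_add_right, inner_smul_right, inner_complexify, inner_complexify]
  simp [-Complex.ofReal_pow]

theorem fourierW_eq {Ω : Type*} (W : ℝ → Ω → L2R) (l : ℕ) (m : ℤ) (t : ℝ) (ω : Ω) :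
    fourierW W l m t ω = (inner ℝ (W t ω) (rePart (sphHarmL2 l m)) : ℝ) -
      Complex.I * (inner ℝ (W t ω) (imPart (sphHarmL2 l m)) : ℝ) :=
  inner_complexify _ _

/-- The real part of `conj (B s) * B t` is the sum of the products of the real and of the imaginary
parts, so its expectation is `A_ℓ s (‖Re Y‖² + ‖Im Y‖²) = A_ℓ s`. Correlations between the real and
imaginary parts do not enter. -/
theorem IsQWiener.hasBrownianCovariance (hW : IsQWiener P τ Q W) {A : ℕ → ℝ}
    (hA : IsAngularPowerSpectrum Q A) {l : ℕ} {m : ℤ} (hm : m ∈ Finset.Icc (-(l : ℤ)) l) :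
    HasBrownianCovariance P (A l) (fourierW0 τ W l m) := by
  have hlp : ∀ s, 0 ≤ s → MemLp (fourierW0 τ W l m s) 2 P := fun s hs => by
    have h1 := (hW.memLp_inner (le_add_of_nonneg_right hs) (rePart (sphHarmL2 l m))).ofReal (K := ℂ)
    have h2 := (hW.memLp_inner (le_add_of_nonneg_right hs) (imPart (sphHarmL2 l m))).ofReal (K := ℂ)
    refine (memLp_congr_ae (Filter.Eventually.of_forall fun ω => ?_)).1
      (h1.sub (h2.const_mul Complex.I))
    exact (fourierW_eq W l m (τ + s) ω).symm
  refine ⟨hlp, fun s t hs hst => ?_⟩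
  have hs' : τ ≤ τ + s := le_add_of_nonneg_right hs
  have ht' : τ ≤ τ + t := le_add_of_nonneg_right (hs.trans hst)
  have e : ∀ ω, (starRingEnd ℂ (fourierW0 τ W l m s ω) * fourierW0 τ W l m t ω).re =
      inner ℝ (W (τ + s) ω) (rePart (sphHarmL2 l m)) *
        inner ℝ (W (τ + t) ω) (rePart (sphHarmL2 l m)) +
      inner ℝ (W (τ + s) ω) (imPart (sphHarmL2 l m)) *
        inner ℝ (W (τ + t) ω) (imPart (sphHarmL2 l m)) := fun ω => by
    simp [fourierW0, fourierW_eq]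
  have hi : ∀ f : L2R, Integrable (fun ω => inner ℝ (W (τ + s) ω) f * inner ℝ (W (τ + t) ω) f) P :=
    fun f => (hW.memLp_inner hs' f).integrable_mul (hW.memLp_inner ht' f)
  simp only [e]
  rw [integral_add (hi _) (hi _),
    hW.integral_inner_mul_inner hs' (by linarith), hW.integral_inner_mul_inner hs' (by linarith),
    ((hA l).2 m hm).1, ((hA l).2 m hm).2, real_inner_smul_left, real_inner_smul_left,
    real_inner_self_eq_norm_sq, real_inner_self_eq_norm_sq]
  have hn : ‖sphHarmL2 l m‖ ^ 2 = 1 := by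
    rw [← inner_self_eq_norm_sq (𝕜 := ℂ), inner_sphHarmL2 l l m m (by
      rw [Finset.mem_Icc] at hm; lia)]
    simp
  have := norm_sq_rePart_add_imPart (sphHarmL2 l m)
  rw [hn] at this
  linear_combination (s * A l) * this

end QWiener

/-! ### The Volterra equation for the kernel, as an identity in `L₂((0, ∞))` -/

noncomputable section VolterraKernel

open scoped NNReal

theorem memLp_Icc_of_continuous {g : ℝ → ℝ} (hg : Continuous g) (a b : ℝ) :
    MemLp g 2 (volume.restrict (Set.Icc a b)) := by
  obtain ⟨C, hC⟩ := isCompact_Icc.exists_bound_of_continuousOn (s := Set.Icc a b) hg.continuousOn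
  have : IsFiniteMeasure (volume.restrict (Set.Icc a b)) := ⟨by simp⟩
  refine MemLp.of_bound hg.aestronglyMeasurable C ?_
  filter_upwards [ae_restrict_mem measurableSet_Icc] with x hx using hC x hx

variable {u : ℝ → ℝ}

/-- The class of `s ↦ 1_{(0, r]}(s) u (r - s)` in `L₂((0, ∞))`. -/
def convKernel (hu : Continuous u) (r : ℝ) : L2Time :=
  timeKernel r (fun s => u (r - s)) (memLp_Icc_of_continuous (hu.comp (continuous_sub_left r)) 0 r)

theorem coeFn_convKernel (hu : Continuous u) (r : ℝ) :
    convKernel hu r =ᵐ[volume.restrict (Set.Ioi 0)]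
      (Set.Ioc 0 r).indicator fun s => u (r - s) :=
  (memLp_indicator_Ioc (memLp_Icc_of_continuous (hu.comp (continuous_sub_left r)) 0 r)).coeFn_toLp

theorem inner_convKernel (hu : Continuous u) (r : ℝ) (h : L2Time) :
    inner ℝ h (convKernel hu r) = ∫ s in Set.Ioc 0 r, h s * u (r - s) := by
  have e : ∀ᵐ s ∂(volume.restrict (Set.Ioi (0 : ℝ))), inner ℝ (h s) (convKernel hu r s) =
      (Set.Ioc 0 r).indicator (fun s => h s * u (r - s)) s := by
    filter_upwards [coeFn_convKernel hu r] with s hs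
    rw [hs]
    by_cases h' : s ∈ Set.Ioc 0 r <;> simp [h', mul_comm]
  rw [L2.inner_def, integral_congr_ae e, setIntegral_indicator measurableSet_Ioc,
    Set.inter_eq_right.2 Set.Ioc_subset_Ioi_self]

theorem norm_sq_convKernel (hu : Continuous u) {r : ℝ} (hr : 0 ≤ r) :
    ‖convKernel hu r‖ ^ 2 = ∫ s in (0 : ℝ)..r, u s ^ 2 := by
  have e : ∀ᵐ s ∂(volume.restrict (Set.Ioc 0 r)), convKernel hu r s * u (r - s) =
      u (r - s) ^ 2 := by
    filter_upwards [ae_mono (Measure.restrict_mono_set _ Set.Ioc_subset_Ioi_self)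
      (coeFn_convKernel hu r), ae_restrict_mem measurableSet_Ioc] with s h1 h2
    rw [h1, Set.indicator_of_mem h2, sq]
  rw [← real_inner_self_eq_norm_sq, inner_convKernel, integral_congr_ae e,
    ← intervalIntegral.integral_of_le hr,
    intervalIntegral.integral_comp_sub_left (fun s => u s ^ 2), sub_self, sub_zero]

/-- For `r ≤ R` the kernel is the restriction to `(0, ∞)` of `s ↦ v(r - s)` with the fixed function
`v = 1_{[0,R]} u` in `L₂(ℝ)`, and translation is continuous in `L₂`. The cut-off at `R` supplies
square integrability. -/
theorem continuousOn_convKernel (hu : Continuous u) (R : ℝ) :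
    ContinuousOn (convKernel hu) (Set.Iic R) := by
  have hV : MemLp ((Set.Icc 0 R).indicator u) 2 volume := by
    rw [memLp_indicator_iff_restrict measurableSet_Icc]
    exact memLp_Icc_of_continuous hu 0 R
  let φ : ℝ → C(ℝ, ℝ) := fun r => ⟨fun s => r - s, continuous_sub_left r⟩
  have hφ : Continuous φ := by
    refine ContinuousMap.continuous_of_continuous_uncurry _ ?_
    exact continuous_fst.sub continuous_snd
  have hmp : ∀ r, MeasurePreserving (φ r) volume volume := fun r =>
    volume.measurePreserving_sub_left r
  have hc : Continuous fun r => LpToLpRestrictCLM ℝ ℝ ℝ volume 2 (Set.Ioi 0)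
      (Lp.compMeasurePreserving (φ r) (hmp r) hV.toLp) :=
    (ContinuousLinearMap.continuous _).comp
      ((continuous_const (y := hV.toLp)).compMeasurePreservingLp hφ hmp (by simp))
  refine hc.continuousOn.congr fun r hr => Lp.ext ?_
  have hcomp : (Lp.compMeasurePreserving (φ r) (hmp r) hV.toLp : Lp ℝ 2 volume) =ᵐ[volume]
      fun s => (Set.Icc 0 R).indicator u (r - s) :=
    (Lp.coeFn_compMeasurePreserving _ _).trans ((hmp r).quasiMeasurePreserving.ae_eq_comp
      hV.coeFn_toLp)
  filter_upwards [coeFn_convKernel hu r, LpToLpRestrictCLM_coeFn ℝ (Set.Ioi 0)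
    (Lp.compMeasurePreserving (φ r) (hmp r) hV.toLp), ae_restrict_of_ae hcomp,
    ae_restrict_mem measurableSet_Ioi] with s h1 h2 h3 hs
  rw [h1, h2, h3]
  have hs' : 0 < s := hs
  have hr' : r ≤ R := hr
  by_cases h : s ≤ r
  · rw [Set.indicator_of_mem (Set.mem_Ioc.2 ⟨hs', h⟩),
      Set.indicator_of_mem (Set.mem_Icc.2 ⟨by linarith, by linarith⟩)]
  · rw [Set.indicator_of_notMem fun h' => h h'.2,
      Set.indicator_of_notMem fun h' => h (by linarith [h'.1])]

theorem continuous_convKernel (hu : Continuous u) : Continuous (convKernel hu) :=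
  continuous_iff_continuousAt.2 fun r =>
    (continuousOn_convKernel hu (r + 1)).continuousAt (Iic_mem_nhds (by linarith))

theorem intervalIntegrable_rpow_smul {E : Type*} [NormedAddCommGroup E] [NormedSpace ℝ E] {α : ℝ}
    (hα : 0 < α) {a t : ℝ} {k : ℝ → E} (hk : ContinuousOn k (Set.uIcc a t)) :
    IntervalIntegrable (fun s => (t - s) ^ (α - 1) • k s) volume a t :=
  (intervalIntegrable_sub_rpow hα a t).smul_continuousOn hk

/-- The Volterra equation for the Mittag-Leffler kernel, in `L₂((0, ∞))`. -/
theorem integral_rpow_smul_convKernel {α : ℝ} (hα : 0 < α) (lam : ℝ) (r : ℝ≥0) :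
    (lam * (Real.Gamma α)⁻¹) • ∫ s in (0 : ℝ)..r, ((r : ℝ) - s) ^ (α - 1) •
        convKernel (continuous_mlRelax hα lam) s =
      timeIndicator r - convKernel (continuous_mlRelax hα lam) r := by
  have hu := continuous_mlRelax hα lam
  have hr : (0 : ℝ) ≤ r := r.2
  -- Pairing with an arbitrary `h` turns the vector-valued integral into a double integral to which
  -- Fubini applies.
  refine ext_inner_left ℝ fun h => ?_
  have hi := intervalIntegrable_rpow_smul hα (a := 0) (t := r)
    (continuous_convKernel hu).continuousOn
  have hh : Integrable h (volume.restrict (Set.Ioc 0 (r : ℝ))) := by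
    have : IsFiniteMeasure (volume.restrict (Set.Ioc 0 (r : ℝ))) := ⟨by simp⟩
    exact ((Lp.memLp h).mono_measure
      (Measure.restrict_mono_set _ Set.Ioc_subset_Ioi_self)).integrable (by norm_num)
  have hw : Integrable (fun s => ((r : ℝ) - s) ^ (α - 1)) (volume.restrict (Set.Ioc 0 (r : ℝ))) :=
    (intervalIntegrable_iff_integrableOn_Ioc_of_le hr).1 (intervalIntegrable_sub_rpow hα 0 r)
  rw [inner_smul_right, inner_sub_right, real_inner_comm (timeIndicator r) h, inner_timeIndicator_left,
    inner_convKernel]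
  have e1 : inner ℝ h (∫ s in (0 : ℝ)..r, ((r : ℝ) - s) ^ (α - 1) • convKernel hu s) =
      ∫ s in Set.Ioc 0 (r : ℝ), ∫ x in Set.Ioc 0 (r : ℝ), ((r : ℝ) - s) ^ (α - 1) * h x *
        (Set.Iic s).indicator (fun x => mlRelax α lam (s - x)) x := by
    have := (innerSL ℝ h).intervalIntegral_comp_comm hi
    rw [innerSL_apply_apply] at this
    rw [← this, intervalIntegral.integral_of_le hr]
    refine setIntegral_congr_fun measurableSet_Ioc fun s hs => ?_
    simp only [innerSL_apply_apply]
    rw [inner_smul_right, inner_convKernel, ← integral_const_mul]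
    have e : ∀ x, ((r : ℝ) - s) ^ (α - 1) * h x *
        (Set.Iic s).indicator (fun x => mlRelax α lam (s - x)) x =
        (Set.Iic s).indicator (fun x => ((r : ℝ) - s) ^ (α - 1) * (h x * mlRelax α lam (s - x)))
          x := fun x => by
      by_cases hx : x ∈ Set.Iic s <;> simp only [hx, Set.indicator_of_mem, Set.indicator_of_notMem,
        not_false_eq_true] <;> ring
    simp only [e]
    rw [setIntegral_indicator measurableSet_Iic, Set.Ioc_inter_Iic, min_eq_right hs.2]
  have hK : Integrable (Function.uncurry fun s x => ((r : ℝ) - s) ^ (α - 1) * h x *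
        (Set.Iic s).indicator (fun x => mlRelax α lam (s - x)) x)
      ((volume.restrict (Set.Ioc 0 (r : ℝ))).prod (volume.restrict (Set.Ioc 0 (r : ℝ)))) := by
    obtain ⟨C, hC⟩ := isCompact_Icc.exists_bound_of_continuousOn (s := Set.Icc 0 (r : ℝ))
      hu.continuousOn
    have hm : Measurable fun z : ℝ × ℝ =>
        (Set.Iic z.1).indicator (fun x => mlRelax α lam (z.1 - x)) z.2 := by
      have : (fun z : ℝ × ℝ => (Set.Iic z.1).indicator (fun x => mlRelax α lam (z.1 - x)) z.2) =
          {z : ℝ × ℝ | z.2 ≤ z.1}.indicator fun z => mlRelax α lam (z.1 - z.2) := by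
        ext z
        simp [Set.indicator_apply]
      rw [this]
      exact ((hu.comp (continuous_fst.sub continuous_snd)).measurable).indicator
        (measurableSet_le measurable_snd measurable_fst)
    refine (hw.mul_prod hh).mul_bdd (c := C) hm.aestronglyMeasurable ?_
    rw [Measure.prod_restrict]
    filter_upwards [ae_restrict_mem (measurableSet_Ioc.prod measurableSet_Ioc)] with z hz
    have hC0 : 0 ≤ C := (norm_nonneg _).trans (hC 0 ⟨le_rfl, hr⟩)
    by_cases hx : z.2 ∈ Set.Iic z.1
    · rw [Set.indicator_of_mem hx]
      exact hC _ ⟨sub_nonneg.2 hx, by linarith [hz.1.2, hz.2.1]⟩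
    · rw [Set.indicator_of_notMem hx, norm_zero]
      exact hC0
  rw [e1, integral_integral_swap hK, ← integral_const_mul, ← integral_sub hh]
  · refine setIntegral_congr_fun measurableSet_Ioc fun x hx => ?_
    -- For fixed `x` the integration runs over `x ≤ s ≤ r`; shifting by `x` leaves the scalar
    -- relaxation equation at time `r - x`.
    have e2 : ∫ s in Set.Ioc 0 (r : ℝ), ((r : ℝ) - s) ^ (α - 1) * h x *
        (Set.Iic s).indicator (fun x => mlRelax α lam (s - x)) x =
        h x * ∫ s in (0 : ℝ)..(r - x), ((r : ℝ) - x - s) ^ (α - 1) * mlRelax α lam s := by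
      have e : ∀ s, ((r : ℝ) - s) ^ (α - 1) * h x *
          (Set.Iic s).indicator (fun x => mlRelax α lam (s - x)) x =
          h x * (Set.Ici x).indicator (fun s => ((r : ℝ) - s) ^ (α - 1) * mlRelax α lam (s - x))
            s := fun s => by
        by_cases hxs : x ≤ s <;> simp [hxs]; ring
      simp only [e]
      have hset : Set.Ioc 0 (r : ℝ) ∩ Set.Ici x = Set.Icc x r := by
        ext s
        simp only [Set.mem_inter_iff, Set.mem_Ioc, Set.mem_Ici, Set.mem_Icc]
        exact ⟨fun h => ⟨h.2, h.1.2⟩, fun h => ⟨⟨hx.1.trans_le h.1, h.2⟩, h.1⟩⟩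
      have hsub := intervalIntegral.integral_comp_sub_right (a := x) (b := r)
        (fun s => ((r : ℝ) - x - s) ^ (α - 1) * mlRelax α lam s) x
      rw [sub_self] at hsub
      rw [integral_const_mul, setIntegral_indicator measurableSet_Ici, hset,
        integral_Icc_eq_integral_Ioc, ← intervalIntegral.integral_of_le hx.2, ← hsub]
      simp only [sub_sub_sub_cancel_right]
    have e3 := mlRelax_integral_eq hα lam (sub_nonneg.2 hx.2)
    simp only [e2]
    linear_combination h x * e3
  · obtain ⟨C, hC⟩ := isCompact_Icc.exists_bound_of_continuousOn (s := Set.Icc 0 (r : ℝ))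
      hu.continuousOn
    refine hh.mul_bdd (c := C) (hu.comp (continuous_sub_left _)).aestronglyMeasurable ?_
    filter_upwards [ae_restrict_mem measurableSet_Ioc] with x hx
    exact hC _ ⟨sub_nonneg.2 hx.2, by linarith [hx.1]⟩

end VolterraKernel

/-! ### Random harmonic series in `L₂(Ω × 𝕊²)` -/

noncomputable section RandomFields

theorem norm_sq_sum_of_inner_eq_zero {ι E : Type*} [NormedAddCommGroup E] [InnerProductSpace ℂ E]
    {D : ι → E} (s : Finset ι) (h : ∀ i ∈ s, ∀ j ∈ s, i ≠ j → inner ℂ (D i) (D j) = 0) :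
    ‖∑ i ∈ s, D i‖ ^ 2 = ∑ i ∈ s, ‖D i‖ ^ 2 := by
  classical
  induction s using Finset.induction_on with
  | empty => simp
  | insert a s ha ih =>
    rw [Finset.sum_insert ha, Finset.sum_insert ha, ← ih fun i hi j hj => h i
      (Finset.mem_insert_of_mem hi) j (Finset.mem_insert_of_mem hj), sq, sq, sq]
    refine norm_add_sq_eq_norm_sq_add_norm_sq_of_inner_eq_zero _ _ ?_ (𝕜 := ℂ)
    rw [inner_sum]
    exact Finset.sum_eq_zero fun i hi => h a (Finset.mem_insert_self _ _) i
      (Finset.mem_insert_of_mem hi) fun e => ha (e ▸ hi)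

/-- By Pythagoras, Cauchy's criterion for the squared norms is Cauchy's criterion for the series. -/
theorem summable_of_inner_eq_zero {ι E : Type*} [NormedAddCommGroup E] [InnerProductSpace ℂ E]
    [CompleteSpace E] {D : ι → E} (h : ∀ i j, i ≠ j → inner ℂ (D i) (D j) = 0)
    (hs : Summable fun i => ‖D i‖ ^ 2) : Summable D := by
  rw [summable_iff_vanishing_norm]
  intro ε hε
  obtain ⟨s, hs'⟩ := summable_iff_vanishing_norm.1 hs (ε ^ 2) (by positivity)
  refine ⟨s, fun t ht => lt_of_pow_lt_pow_left₀ 2 hε.le ?_⟩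
  rw [norm_sq_sum_of_inner_eq_zero t fun i _ j _ => h i j]
  exact (le_abs_self _).trans_lt (hs' t ht)

variable {Ω : Type*} [MeasurableSpace Ω] {P : Measure Ω}

theorem coeFn_randomMul (X : Lp ℂ 2 P) (f : L2C) : randomMul P X f =ᵐ[P] fun ω => X ω • f :=
  (ContinuousLinearMap.toSpanSingleton ℂ f).coeFn_compLp X

theorem inner_randomMul (X X' : Lp ℂ 2 P) (f f' : L2C) :
    inner ℂ (randomMul P X f) (randomMul P X' f') = inner ℂ X X' * inner ℂ f f' := by
  rw [L2.inner_def, L2.inner_def X, ← integral_mul_const]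
  refine integral_congr_ae ?_
  filter_upwards [coeFn_randomMul X f, coeFn_randomMul X' f'] with ω h1 h2
  rw [h1, h2, inner_smul_left, inner_smul_right]
  simp
  ring

/-- `F ↦ ⟨F, f⟩` as a continuous linear map `L₂(Ω × 𝕊²) → L₂(Ω)`. -/
def pairingL (P : Measure Ω) (f : L2C) : L2Field P →L[ℂ] Lp ℂ 2 P :=
  (innerSL ℂ f).compLpL 2 P

theorem pairingL_apply (f : L2C) (F : L2Field P) : pairingL P f F = pairing P f F := rfl

theorem coeFn_pairing (f : L2C) (F : L2Field P) : pairing P f F =ᵐ[P] fun ω => inner ℂ f (F ω) :=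
  (innerSL ℂ f).coeFn_compLp F

theorem norm_pairing_le (f : L2C) (F : L2Field P) : ‖pairing P f F‖ ≤ ‖f‖ * ‖F‖ := by
  have := ContinuousLinearMap.norm_compLp_le (innerSL ℂ f) F
  rwa [innerSL_apply_norm] at this

theorem pairing_randomMul (f g : L2C) (X : Lp ℂ 2 P) :
    pairing P f (randomMul P X g) = (inner ℂ f g : ℂ) • X := by
  refine Lp.ext ?_
  filter_upwards [coeFn_pairing f (randomMul P X g), coeFn_randomMul X g,
    Lp.coeFn_smul (inner ℂ f g : ℂ) X] with ω h1 h2 h3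
  rw [h1, h2, h3, inner_smul_right, Pi.smul_apply, smul_eq_mul, mul_comm]

/-- The field of degree `l` with random coefficients `c l m`. -/
def harmonicField (c : ℕ → ℤ → Lp ℂ 2 P) (l : ℕ) : L2Field P :=
  ∑ m ∈ Finset.Icc (-(l : ℤ)) l, randomMul P (c l m) (sphHarmL2 l m)

theorem natAbs_le_of_mem_Icc {l : ℕ} {m : ℤ} (hm : m ∈ Finset.Icc (-(l : ℤ)) l) :
    m.natAbs ≤ l := by
  rw [Finset.mem_Icc] at hm
  lia

theorem pairing_harmonicField (f : L2C) (c : ℕ → ℤ → Lp ℂ 2 P) (l : ℕ) :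
    pairing P f (harmonicField c l) =
      ∑ m ∈ Finset.Icc (-(l : ℤ)) l, (inner ℂ f (sphHarmL2 l m) : ℂ) • c l m := by
  rw [← pairingL_apply, harmonicField, map_sum]
  exact Finset.sum_congr rfl fun m _ => pairing_randomMul _ _ _

theorem inner_harmonicField (c : ℕ → ℤ → Lp ℂ 2 P) {l l' : ℕ} (h : l ≠ l') :
    inner ℂ (harmonicField c l) (harmonicField c l') = 0 := by
  rw [harmonicField, harmonicField, sum_inner]
  refine Finset.sum_eq_zero fun m hm => ?_
  rw [inner_sum]
  refine Finset.sum_eq_zero fun m' _ => ?_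
  rw [inner_randomMul, inner_sphHarmL2 _ _ _ _ (natAbs_le_of_mem_Icc hm), if_neg fun e => h e.1,
    mul_zero]

theorem norm_sq_harmonicField (c : ℕ → ℤ → Lp ℂ 2 P) (l : ℕ) :
    ‖harmonicField c l‖ ^ 2 = ∑ m ∈ Finset.Icc (-(l : ℤ)) l, ‖c l m‖ ^ 2 := by
  rw [harmonicField, norm_sq_sum_of_inner_eq_zero]
  · refine Finset.sum_congr rfl fun m hm => ?_
    rw [← inner_self_eq_norm_sq (𝕜 := ℂ), inner_randomMul,
      inner_sphHarmL2 _ _ _ _ (natAbs_le_of_mem_Icc hm), if_pos ⟨rfl, rfl⟩, mul_one,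
      inner_self_eq_norm_sq (𝕜 := ℂ)]
  · intro m hm m' _ hmm
    rw [inner_randomMul, inner_sphHarmL2 _ _ _ _ (natAbs_le_of_mem_Icc hm),
      if_neg fun e => hmm e.2, mul_zero]

theorem norm_sq_harmonicField_le {c : ℕ → ℤ → Lp ℂ 2 P} {A : ℕ → ℝ} {r : ℝ}
    (hc : ∀ l : ℕ, ∀ m ∈ Finset.Icc (-(l : ℤ)) l, ‖c l m‖ ^ 2 ≤ A l * r) (l : ℕ) :
    ‖harmonicField c l‖ ^ 2 ≤ (2 * (l : ℝ) + 1) * A l * r := by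
  rw [norm_sq_harmonicField]
  refine (Finset.sum_le_sum (hc l)).trans_eq ?_
  rw [Finset.sum_const, Int.card_Icc, nsmul_eq_mul]
  have : ((l : ℤ) + 1 - -(l : ℤ)).toNat = 2 * l + 1 := by lia
  rw [this]
  push_cast
  ring

theorem summable_harmonicField {c : ℕ → ℤ → Lp ℂ 2 P} {A : ℕ → ℝ} {r : ℝ}
    (hsum : Summable fun l : ℕ => (2 * (l : ℝ) + 1) * A l)
    (hc : ∀ l : ℕ, ∀ m ∈ Finset.Icc (-(l : ℤ)) l, ‖c l m‖ ^ 2 ≤ A l * r) :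
    Summable (harmonicField c) :=
  summable_of_inner_eq_zero (fun _ _ => inner_harmonicField c)
    (Summable.of_nonneg_of_le (fun _ => sq_nonneg _) (norm_sq_harmonicField_le hc)
      (hsum.mul_right r))

/-- A bound independent of the finite set `s`, used as the majorant for partial sums in dominated
convergence. -/
theorem norm_sum_harmonicField_le {c : ℕ → ℤ → Lp ℂ 2 P} {A : ℕ → ℝ} {r : ℝ} (hr : 0 ≤ r)
    (hA : ∀ l, 0 ≤ A l) (hsum : Summable fun l : ℕ => (2 * (l : ℝ) + 1) * A l)
    (hc : ∀ l : ℕ, ∀ m ∈ Finset.Icc (-(l : ℤ)) l, ‖c l m‖ ^ 2 ≤ A l * r) (s : Finset ℕ) :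
    ‖∑ l ∈ s, harmonicField c l‖ ≤ √((∑' l : ℕ, (2 * (l : ℝ) + 1) * A l) * r) := by
  refine Real.le_sqrt_of_sq_le ?_
  rw [norm_sq_sum_of_inner_eq_zero s fun _ _ _ _ => inner_harmonicField c]
  refine (Finset.sum_le_sum fun l _ => norm_sq_harmonicField_le hc l).trans ?_
  rw [← Finset.sum_mul]
  refine mul_le_mul_of_nonneg_right (hsum.sum_le_tsum s fun l _ => ?_) hr
  have := hA l
  positivity

/-- The Fourier coefficients of a convergent random harmonic series. -/
theorem pairing_sphHarmL2_of_hasSum {c : ℕ → ℤ → Lp ℂ 2 P} {F : L2Field P}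
    (hF : HasSum (harmonicField c) F) {l : ℕ} {m : ℤ} (hm : m ∈ Finset.Icc (-(l : ℤ)) l) :
    pairing P (sphHarmL2 l m) F = c l m := by
  have h1 := (pairingL P (sphHarmL2 l m)).hasSum hF
  refine h1.unique ?_
  have h2 : ∀ l', pairingL P (sphHarmL2 l m) (harmonicField c l') =
      if l' = l then c l m else 0 := fun l' => by
    rw [pairingL_apply, pairing_harmonicField]
    simp only [inner_sphHarmL2 _ _ _ _ (natAbs_le_of_mem_Icc hm)]
    split_ifs with e
    · subst e
      rw [Finset.sum_eq_single_of_mem m hm fun m' _ hmm => by simp [hmm.symm]]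
      simp
    · exact Finset.sum_eq_zero fun m' _ => by simp [Ne.symm e]
  simp only [h2]
  exact hasSum_ite_eq l _

end RandomFields

/-! ### The stochastic equation, coefficient by coefficient and then summed -/

noncomputable section StochasticVolterra

open scoped NNReal

variable {Ω : Type*} [MeasurableSpace Ω] {P : Measure Ω} {τ : ℝ} {Q : L2R →L[ℝ] L2R}
  {W : ℝ → Ω → L2R} {A : ℕ → ℝ} {α : ℝ}

open Classical in
/-- The class of the Fourier coefficient `Ŵ_{ℓ,m}(t)` in `L₂(Ω)`. -/
def noiseCoeff (P : Measure Ω) (W : ℝ → Ω → L2R) (t : ℝ) (l : ℕ) (m : ℤ) : Lp ℂ 2 P :=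
  if h : MemLp (fourierW W l m t) 2 P then h.toLp else 0

namespace HasBrownianCovariance

variable {l : ℕ} {m : ℤ} {a : ℝ}

theorem memLp_fourierW (hB : HasBrownianCovariance P a (fourierW0 τ W l m)) {t : ℝ}
    (ht : τ ≤ t) : MemLp (fourierW W l m t) 2 P := by
  have := hB.memLp (t - τ) (sub_nonneg.2 ht)
  rwa [show fourierW0 τ W l m (t - τ) = fourierW W l m t by
    ext ω; rw [fourierW0, add_sub_cancel]] at this

theorem coeFn_noiseCoeff (hB : HasBrownianCovariance P a (fourierW0 τ W l m)) {t : ℝ}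
    (ht : τ ≤ t) : noiseCoeff P W t l m =ᵐ[P] fourierW W l m t := by
  rw [noiseCoeff, dif_pos (hB.memLp_fourierW ht)]
  exact (hB.memLp_fourierW ht).coeFn_toLp

theorem noiseCoeff_eq (hB : HasBrownianCovariance P a (fourierW0 τ W l m)) (r : ℝ≥0) :
    noiseCoeff P W (τ + r) l m = hB.wiener (timeIndicator r) := by
  rw [wiener_timeIndicator]
  exact Lp.ext ((hB.coeFn_noiseCoeff (le_add_of_nonneg_right r.2)).trans (hB.coeFn_toL2 r).symm)

theorem coeffU_eq (hB : HasBrownianCovariance P a (fourierW0 τ W l m)) (hα : 0 < α) {t : ℝ}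
    (ht : τ ≤ t) : coeffU P α τ W t l m =
      hB.wiener (convKernel (continuous_mlRelax hα (lam l)) (t - τ)) :=
  hB.wienerIntegral_eq ((continuous_mlRelax hα (lam l)).comp (continuous_sub_left (t - τ)))
    (sub_nonneg.2 ht) _

theorem isWienerIntegral_coeffU (hB : HasBrownianCovariance P a (fourierW0 τ W l m)) (hα : 0 < α)
    {t : ℝ} (ht : τ ≤ t) : IsWienerIntegral P (fourierW0 τ W l m) 0 (t - τ) (kernelU α τ t l)
      (coeffU P α τ W t l m) := by
  rw [hB.coeffU_eq hα ht]
  exact hB.isWienerIntegral_wiener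
    ((continuous_mlRelax hα (lam l)).comp (continuous_sub_left (t - τ))) (sub_nonneg.2 ht) _

theorem norm_sq_wiener_le (hB : HasBrownianCovariance P a (fourierW0 τ W l m)) (ha : 0 ≤ a)
    (g : L2Time) : ‖hB.wiener g‖ ^ 2 ≤ a * ‖g‖ ^ 2 := by
  have h := pow_le_pow_left₀ (norm_nonneg _) (hB.norm_wiener_le g) 2
  rwa [mul_pow, Real.sq_sqrt ha] at h

/-- The energy estimate for the relaxation function makes this bound uniform in `λ_ℓ`, so
summability of `(2ℓ+1) A_ℓ` alone suffices for the series. -/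
theorem norm_sq_coeffU_le (hB : HasBrownianCovariance P a (fourierW0 τ W l m)) (ha : 0 ≤ a)
    (hα : 0 < α) (hα1 : α ≤ 1) {t : ℝ} (ht : τ ≤ t) :
    ‖coeffU P α τ W t l m‖ ^ 2 ≤ a * (t - τ) := by
  have hl : 0 ≤ lam l := by unfold lam; positivity
  rw [hB.coeffU_eq hα ht]
  refine (hB.norm_sq_wiener_le ha _).trans (mul_le_mul_of_nonneg_left ?_ ha)
  rw [norm_sq_convKernel _ (sub_nonneg.2 ht)]
  exact integral_mlRelax_sq_le hα hα1 hl (sub_nonneg.2 ht)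

theorem norm_sq_noiseCoeff_le (hB : HasBrownianCovariance P a (fourierW0 τ W l m)) (ha : 0 ≤ a)
    {t : ℝ} (ht : τ ≤ t) : ‖noiseCoeff P W t l m‖ ^ 2 ≤ a * (t - τ) := by
  obtain ⟨r, rfl⟩ : ∃ r : ℝ≥0, t = τ + r := ⟨⟨t - τ, sub_nonneg.2 ht⟩, (add_sub_cancel τ t).symm⟩
  rw [hB.noiseCoeff_eq]
  refine (hB.norm_sq_wiener_le ha _).trans (mul_le_mul_of_nonneg_left ?_ ha)
  rw [← real_inner_self_eq_norm_sq, inner_timeIndicator]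
  simp

theorem continuousOn_coeffU (hB : HasBrownianCovariance P a (fourierW0 τ W l m)) (hα : 0 < α) :
    ContinuousOn (fun t => coeffU P α τ W t l m) (Set.Ici τ) := by
  have h : Continuous fun t => hB.wiener (convKernel (continuous_mlRelax hα (lam l)) (t - τ)) :=
    hB.wiener.continuous.comp ((continuous_convKernel _).comp (continuous_sub_right τ))
  exact h.continuousOn.congr fun t ht => hB.coeffU_eq hα ht

/-- The Volterra equation for a single Fourier coefficient. -/
theorem integral_rpow_smul_coeffU (hB : HasBrownianCovariance P a (fourierW0 τ W l m))
    (hα : 0 < α) {t : ℝ} (ht : τ ≤ t) :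
    (lam l * (Real.Gamma α)⁻¹) • ∫ s in τ..t, (t - s) ^ (α - 1) • coeffU P α τ W s l m =
      noiseCoeff P W t l m - coeffU P α τ W t l m := by
  obtain ⟨r, rfl⟩ : ∃ r : ℝ≥0, t = τ + r := ⟨⟨t - τ, sub_nonneg.2 ht⟩, (add_sub_cancel τ t).symm⟩
  -- `wiener` is bounded and linear, so it passes through the Bochner integral of the deterministic
  -- identity.
  have h := congrArg hB.wiener (integral_rpow_smul_convKernel hα (lam l) r)
  rw [map_smul, map_sub, ← hB.noiseCoeff_eq, ← hB.wiener.intervalIntegral_comp_comm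
    (intervalIntegrable_rpow_smul hα (continuous_convKernel _).continuousOn)] at h
  rw [hB.coeffU_eq hα ht, add_sub_cancel_left, ← h]
  congr 1
  have hsub := intervalIntegral.integral_comp_sub_right (a := τ) (b := τ + r)
    (fun s => hB.wiener (((r : ℝ) - s) ^ (α - 1) •
      convKernel (continuous_mlRelax hα (lam l)) s)) τ
  rw [sub_self, add_sub_cancel_left] at hsub
  rw [← hsub]
  refine intervalIntegral.integral_congr fun s hs => ?_
  rw [Set.uIcc_of_le ht] at hs
  simp only [map_smul]
  rw [hB.coeffU_eq hα hs.1, show τ + (r : ℝ) - s = r - (s - τ) by ring]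

end HasBrownianCovariance

namespace IsQWiener

theorem norm_sq_coeffU_le (hW : IsQWiener P τ Q W) (hA : IsAngularPowerSpectrum Q A)
    (hα : 0 < α) (hα1 : α ≤ 1) {s t : ℝ} (hs : τ ≤ s) (hst : s ≤ t) (l : ℕ) :
    ∀ m ∈ Finset.Icc (-(l : ℤ)) l, ‖coeffU P α τ W s l m‖ ^ 2 ≤ A l * (t - τ) := fun _ hm =>
  ((hW.hasBrownianCovariance hA hm).norm_sq_coeffU_le (hA l).1 hα hα1 hs).trans
    (mul_le_mul_of_nonneg_left (by linarith) (hA l).1)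

theorem hasSum_fieldU (hW : IsQWiener P τ Q W) (hA : IsAngularPowerSpectrum Q A)
    (hsum : Summable fun l : ℕ => (2 * (l : ℝ) + 1) * A l) (hα : 0 < α) (hα1 : α ≤ 1) {t : ℝ}
    (ht : τ ≤ t) : HasSum (fun l => degreeU P α τ W t l) (fieldU P α τ W t) := by
  rcases ht.eq_or_lt with rfl | h
  -- At `t = τ` the field is `0` by definition, and each degree vanishes because its squared norm is
  -- bounded by a multiple of `t - τ`.
  · rw [fieldU, if_neg (lt_irrefl _)]
    have h0 : ∀ l, degreeU P α τ W τ l = 0 := fun l => by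
      have h1 := norm_sq_harmonicField_le (hW.norm_sq_coeffU_le hA hα hα1 le_rfl (le_refl τ)) l
      rw [sub_self, mul_zero] at h1
      exact norm_eq_zero.1 (pow_eq_zero_iff two_ne_zero |>.1 (le_antisymm h1 (sq_nonneg _)))
    simp only [h0]
    exact hasSum_zero
  · rw [fieldU, if_pos h]
    exact (summable_harmonicField hsum (hW.norm_sq_coeffU_le hA hα hα1 ht (le_refl t))).hasSum

theorem hasSum_noise (hW : IsQWiener P τ Q W) (hA : IsAngularPowerSpectrum Q A)
    (hsum : Summable fun l : ℕ => (2 * (l : ℝ) + 1) * A l) {t : ℝ} (ht : τ ≤ t) :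
    HasSum (harmonicField (noiseCoeff P W t)) (∑' l, harmonicField (noiseCoeff P W t) l) :=
  (summable_harmonicField hsum fun l _ hm =>
    (hW.hasBrownianCovariance hA hm).norm_sq_noiseCoeff_le (hA l).1 ht).hasSum

/-- The Karhunen–Loève expansion of the noise. -/
theorem ae_tsum_noise_eq (hW : IsQWiener P τ Q W) (hA : IsAngularPowerSpectrum Q A)
    (hsum : Summable fun l : ℕ => (2 * (l : ℝ) + 1) * A l) {t : ℝ} (ht : τ ≤ t) :
    ∀ᵐ ω ∂P, (∑' l, harmonicField (noiseCoeff P W t) l : L2Field P) ω = complexify (W t ω) := by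
  -- Only countably many coefficients are compared, so one null set serves them all and completeness
  -- can be applied for each remaining `ω`.
  have h : ∀ᵐ ω ∂P, ∀ l : ℕ, ∀ m : ℤ, m ∈ Finset.Icc (-(l : ℤ)) l → inner ℂ (sphHarmL2 l m)
      ((∑' l, harmonicField (noiseCoeff P W t) l : L2Field P) ω - complexify (W t ω)) = 0 := by
    refine ae_all_iff.2 fun l => ae_all_iff.2 fun m => ?_
    by_cases hm : m ∈ Finset.Icc (-(l : ℤ)) l
    · filter_upwards [coeFn_pairing (sphHarmL2 l m)
        (∑' l, harmonicField (noiseCoeff P W t) l : L2Field P),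
        (hW.hasBrownianCovariance hA hm).coeFn_noiseCoeff ht] with ω h1 h2 _
      rw [inner_sub_right, ← h1, pairing_sphHarmL2_of_hasSum (hW.hasSum_noise hA hsum ht) hm, h2,
        fourierW, sub_self]
    · exact Filter.Eventually.of_forall fun ω h => absurd h hm
  filter_upwards [h] with ω hω
  exact sub_eq_zero.1 (eq_zero_of_inner_sphHarmL2 hω)

theorem intervalIntegrable_pairing_degreeU (hW : IsQWiener P τ Q W)
    (hA : IsAngularPowerSpectrum Q A) (hα : 0 < α) {t : ℝ} (ht : τ ≤ t) (f : L2C) (l : ℕ) :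
    IntervalIntegrable (fun s => (t - s) ^ (α - 1) • pairing P f (degreeU P α τ W s l))
      volume τ t := by
  refine intervalIntegrable_rpow_smul hα ?_
  rw [Set.uIcc_of_le ht]
  have h : ∀ s, pairing P f (degreeU P α τ W s l) = _ := fun s => pairing_harmonicField f _ l
  simp only [h]
  refine continuousOn_finsetSum _ fun m hm => ?_
  exact (((hW.hasBrownianCovariance hA hm).continuousOn_coeffU hα).mono
    Set.Icc_subset_Ici_self).const_smul (inner ℂ f (sphHarmL2 l m) : ℂ)

/-- Pairing with the Laplacian of `φ` produces the factor `-λ_ℓ`, so the Volterra equation of each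
coefficient gives field minus noise. -/
theorem integral_pairing_degreeU (hW : IsQWiener P τ Q W)
    (hA : IsAngularPowerSpectrum Q A) (hα : 0 < α) {t : ℝ} (ht : τ ≤ t) {φ : E3 → ℂ}
    (hφ : ContDiff ℝ (⊤ : ℕ∞) φ) (l : ℕ) :
    (Real.Gamma α)⁻¹ • ∫ s in τ..t,
        (t - s) ^ (α - 1) • pairing P (laplaceTestL2 φ hφ) (degreeU P α τ W s l) =
      pairing P (testL2 φ hφ) (degreeU P α τ W t l) -
        pairing P (testL2 φ hφ) (harmonicField (noiseCoeff P W t) l) := by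
  have h : ∀ f s, pairing P f (degreeU P α τ W s l) = _ := fun f s => pairing_harmonicField f _ l
  have sm : ∀ (r : ℝ) (X : Lp ℂ 2 P), r • X = (r : ℂ) • X := fun r X => by
    rw [← one_smul ℂ X, ← smul_assoc, Complex.real_smul, mul_one, one_smul]
  simp only [h, pairing_harmonicField, Finset.smul_sum]
  rw [intervalIntegral.integral_finsetSum, Finset.smul_sum, ← Finset.sum_sub_distrib]
  · refine Finset.sum_congr rfl fun m hm => ?_
    rw [inner_laplaceTestL2_sphHarmL2]
    have hc := (hW.hasBrownianCovariance hA hm).integral_rpow_smul_coeffU hα ht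
    have e : ∀ s, (t - s) ^ (α - 1) •
        ((-(lam l : ℂ) * inner ℂ (testL2 φ hφ) (sphHarmL2 l m)) • coeffU P α τ W s l m) =
        (-(lam l : ℂ) * inner ℂ (testL2 φ hφ) (sphHarmL2 l m)) •
          ((t - s) ^ (α - 1) • coeffU P α τ W s l m) := fun s => smul_comm _ _ _
    simp only [e]
    rw [intervalIntegral.integral_smul, ← smul_sub, ← neg_sub (noiseCoeff P W t l m), ← hc,
      sm, sm, smul_neg, ← neg_smul, smul_smul, smul_smul]
    congr 1
    push_cast
    ring
  · intro m hm
    refine intervalIntegrable_rpow_smul hα ?_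
    rw [Set.uIcc_of_le ht]
    exact (((hW.hasBrownianCovariance hA hm).continuousOn_coeffU hα).mono
      Set.Icc_subset_Ici_self).const_smul
        (inner ℂ (laplaceTestL2 φ hφ) (sphHarmL2 l m) : ℂ)

/-- The fractional integral of `Δ U` is `U - W`. -/
theorem isFracIntegralLaplacian_fieldU (hW : IsQWiener P τ Q W)
    (hA : IsAngularPowerSpectrum Q A) (hsum : Summable fun l : ℕ => (2 * (l : ℝ) + 1) * A l)
    (hα : 0 < α) (hα1 : α ≤ 1) {t : ℝ} (ht : τ ≤ t) :
    IsFracIntegralLaplacian P α τ (fieldU P α τ W) t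
      (fieldU P α τ W t - ∑' l, harmonicField (noiseCoeff P W t) l) := by
  intro φ hφ
  set M : ℝ := ‖laplaceTestL2 φ hφ‖ * √((∑' l : ℕ, (2 * (l : ℝ) + 1) * A l) * (t - τ)) with hM
  let G : ℕ → ℝ → Lp ℂ 2 P := fun N s => ∑ l ∈ Finset.range N,
    (t - s) ^ (α - 1) • pairing P (laplaceTestL2 φ hφ) (degreeU P α τ W s l)
  have hG : ∀ N, IntervalIntegrable (G N) volume τ t := fun N => by
    have h := IntervalIntegrable.sum (Finset.range N) fun l _ =>
      hW.intervalIntegrable_pairing_degreeU hA hα ht (laplaceTestL2 φ hφ) l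
    refine h.congr ?_
    exact fun s _ => by simp only [G, Finset.sum_apply]
  have hGm : ∀ N, AEStronglyMeasurable (G N) (volume.restrict (Set.Ioc τ t)) := fun N =>
    ((intervalIntegrable_iff_integrableOn_Ioc_of_le ht).1 (hG N)).aestronglyMeasurable
  have hGe : ∀ N s, G N s = (t - s) ^ (α - 1) • pairingL P (laplaceTestL2 φ hφ)
      (∑ l ∈ Finset.range N, degreeU P α τ W s l) := fun N s => by
    rw [map_sum, Finset.smul_sum]
    rfl
  -- The bound on the partial sums is taken at the final time `t`, so the majorant is a constant
  -- times the integrable singularity `(t - s)^(α-1)`, uniformly in `N`.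
  have hGb : ∀ N, ∀ s ∈ Set.Ioc τ t, ‖G N s‖ ≤ (t - s) ^ (α - 1) * M := fun N s hs => by
    have h0 : 0 ≤ (t - s) ^ (α - 1) := Real.rpow_nonneg (sub_nonneg.2 hs.2) _
    rw [hGe, norm_smul, Real.norm_of_nonneg h0]
    refine mul_le_mul_of_nonneg_left ((norm_pairing_le _ _).trans ?_) h0
    refine mul_le_mul_of_nonneg_left ?_ (norm_nonneg _)
    exact norm_sum_harmonicField_le (sub_nonneg.2 ht) (fun l => (hA l).1) hsum
      (hW.norm_sq_coeffU_le hA hα hα1 hs.1.le hs.2) (Finset.range N)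
  have hGl : ∀ s ∈ Set.Ioc τ t, Filter.Tendsto (fun N => G N s) Filter.atTop
      (nhds ((t - s) ^ (α - 1) • pairing P (laplaceTestL2 φ hφ) (fieldU P α τ W s))) :=
    fun s hs => by
    simp only [hGe]
    exact (((pairingL P (laplaceTestL2 φ hφ)).continuous.tendsto _).comp
      (hW.hasSum_fieldU hA hsum hα hα1 hs.1.le).tendsto_sum_nat).const_smul _
  have hbi : IntervalIntegrable (fun s => (t - s) ^ (α - 1) * M) volume τ t :=
    (intervalIntegrable_sub_rpow hα τ t).mul_const M
  have hint : IntervalIntegrable (fun s => (t - s) ^ (α - 1) •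
      pairing P (laplaceTestL2 φ hφ) (fieldU P α τ W s)) volume τ t := by
    rw [intervalIntegrable_iff_integrableOn_Ioc_of_le ht] at hbi ⊢
    refine Integrable.mono' hbi (aestronglyMeasurable_of_tendsto_ae Filter.atTop hGm ?_) ?_
    · filter_upwards [ae_restrict_mem measurableSet_Ioc] with s hs using hGl s hs
    · filter_upwards [ae_restrict_mem measurableSet_Ioc] with s hs
      exact le_of_tendsto (hGl s hs).norm (Filter.Eventually.of_forall fun N => hGb N s hs)
  refine ⟨hint, ?_⟩
  have hlim := intervalIntegral.tendsto_integral_filter_of_dominated_convergence (a := τ) (b := t)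
    (μ := volume) (F := G) (l := Filter.atTop) (fun s => (t - s) ^ (α - 1) * M)
    (f := fun s => (t - s) ^ (α - 1) • pairing P (laplaceTestL2 φ hφ) (fieldU P α τ W s))
    (Filter.Eventually.of_forall fun N => by rw [Set.uIoc_of_le ht]; exact hGm N)
    (Filter.Eventually.of_forall fun N => Filter.Eventually.of_forall fun s hs => by
      rw [Set.uIoc_of_le ht] at hs; exact hGb N s hs) hbi
    (Filter.Eventually.of_forall fun s hs => by rw [Set.uIoc_of_le ht] at hs; exact hGl s hs)
  -- The integrals of the partial sums have two limits: the integral of the full field, by dominated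
  -- convergence, and the pairing with field minus noise, by the equation in each degree.
  refine tendsto_nhds_unique ?_ (hlim.const_smul _)
  have hval : ∀ N, (Real.Gamma α)⁻¹ • ∫ s in τ..t, G N s = pairingL P (testL2 φ hφ)
      (∑ l ∈ Finset.range N, degreeU P α τ W t l -
        ∑ l ∈ Finset.range N, harmonicField (noiseCoeff P W t) l) := fun N => by
    rw [intervalIntegral.integral_finsetSum fun l _ =>
      hW.intervalIntegrable_pairing_degreeU hA hα ht _ l, Finset.smul_sum, map_sub, map_sum,
      map_sum, ← Finset.sum_sub_distrib]
    exact Finset.sum_congr rfl fun l _ => hW.integral_pairing_degreeU hA hα ht hφ l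
  simp only [hval]
  exact ((pairingL P (testL2 φ hφ)).continuous.tendsto _).comp
    ((hW.hasSum_fieldU hA hsum hα hα1 ht).tendsto_sum_nat.sub
      (hW.hasSum_noise hA hsum ht).tendsto_sum_nat)

end IsQWiener

end StochasticVolterra

/-! ### The solution of the equation -/

theorem proposition4p3 {Ω : Type*} [MeasurableSpace Ω] (P : Measure Ω) [IsProbabilityMeasure P]
    (α τ : ℝ) (hα0 : 0 < α) (hα1 : α ≤ 1) (hτ : 0 < τ)
    (Q : L2R →L[ℝ] L2R) (A : ℕ → ℝ) (hA : IsAngularPowerSpectrum Q A)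
    (hsum : Summable fun l : ℕ => (2 * (l : ℝ) + 1) * A l)
    (W : ℝ → Ω → L2R) (hW : IsQWiener P τ Q W) :
    -- the field `U^I` is well defined
    (∀ t, τ < t →
      (∀ l : ℕ, ∀ m ∈ Finset.Icc (-(l : ℤ)) l,
        IsWienerIntegral P (fourierW0 τ W l m) 0 (t - τ) (kernelU α τ t l)
          (coeffU P α τ W t l m)) ∧
      HasSum (fun l : ℕ => degreeU P α τ W t l) (fieldU P α τ W t)) ∧
    -- it vanishes up to time `τ`
    (∀ t, 0 < t → t ≤ τ → fieldU P α τ W t = 0) ∧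
    -- it solves the integral equation on `[τ, ∞)`, in `L₂(Ω × 𝕊²)`
    ∃ F : ℝ → L2Field P,
      (∀ t, τ ≤ t → IsFracIntegralLaplacian P α τ (fieldU P α τ W) t (F t)) ∧
      ∀ T, τ < T →
        (⨆ t ∈ Set.Icc τ T,
          (∫⁻ ω, ‖fieldU P α τ W t ω - F t ω - complexify (W t ω)‖ₑ ^ 2 ∂P)) = 0 := by
  refine ⟨fun t ht => ⟨fun l m hm =>
    (hW.hasBrownianCovariance hA hm).isWienerIntegral_coeffU hα0 ht.le,
    hW.hasSum_fieldU hA hsum hα0 hα1 ht.le⟩, fun t _ ht => if_neg (not_lt.2 ht),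
    -- The fractional integral is defined as the field minus the harmonic expansion of the noise, an
    -- element of `L₂(Ω × 𝕊²)`; `W t` itself is only a function on `Ω`, and is compared with the
    -- expansion almost surely.
    fun t => fieldU P α τ W t - ∑' l, harmonicField (noiseCoeff P W t) l,
    fun t ht => hW.isFracIntegralLaplacian_fieldU hA hsum hα0 hα1 ht, fun T _ => ?_⟩
  refine le_antisymm (iSup₂_le fun t ht => ?_) bot_le
  refine (lintegral_eq_zero_of_ae_eq_zero ?_).le
  filter_upwards [hW.ae_tsum_noise_eq hA hsum ht.1, Lp.coeFn_sub (fieldU P α τ W t)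
    (∑' l, harmonicField (noiseCoeff P W t) l)] with ω h1 h2
  rw [h2, Pi.sub_apply, h1, sub_sub_cancel, sub_self]
  simp
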